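/- **Conventions.** $\lg=\log_2$ and $h_2(x)=-x\lg x-(1-x)\lg(1-x)$. A *biclique* of a graph $G$ is a pair $(L,R)$ of disjoint nonempty vertex sets such that every vertex of $L$ is adjacent in $G$ to every vertex of $R$. A *biclique partition* of $G$ is a finite family of bicliques $(L_i,R_i)$ of $G$ such that every edge of $G$ lies in exactly one of them; its *weight* is $\sum_i(|L_i|+|R_i|)$. Let $\mathrm{bp}(G)$ be the minimum weight of a biclique partition of $G$, and let $\mathrm{bp}(n,\gamma)$ be the maximum of $\mathrm{bp}(G)$ over all simple graphs $G$ with $n$ vertices and exactly $\gamma\binom n2$ edges. **Theorem.** Consider $n\to\infty$ along any sequence, and densities $\gamma=\gamma(n)\in(0,1)$ such that $\gamma\binom n2$ is an integer and $\max\{\gamma^{-1},(1-\gamma)^{-1}\}=n^{o(1)}$. 1. We have $$\mathrm{bp}(n,\gamma)\;\sim\;\frac{h_2(\gamma)}2\cdot\frac{n^2}{\lg n}.$$ 2. There is a deterministic algorithm which, given an adjacency list of any graph $G$ with $n$ vertices and $m=\gamma\binom n2$ edges, outputs a biclique partition of $G$ of weight at most $(1+o(1))\,\frac{h_2(\gamma)}2\cdot\frac{n^2}{\lg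 n}$ in time $O(m)$. Precisely, in part 2 there are one program and constants $c,C$, independent of the sequence of pairs $(n,\gamma)$, such that for every such sequence and every $\varepsilon>0$ the following holds for all sufficiently late $(n,\gamma)$ of the sequence. For every graph $G$ as above, every adjacency list of $G$ (neighbours in any order, stored as consecutive lists together with their starting positions), and every word length $w$ with $2^w\ge n^c$, the program, run on a deterministic word RAM with $w$-bit words (unit-cost arithmetic, comparison and array access, cells other than the input initially $0$), halts within $C\,m$ steps and outputs the bicliques of a biclique partition of $G$, each one as the sizes of its two sides followed by the vertices of the two sides, of total weight at most $(1+\varepsilon)\,\frac{h_2(\gamma)}2\cdot\frac{n^2}{\lg n}$. -/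

import Mathlib

open Filter Topology Asymptotics

/-! ### Biclique partitions -/

/-- The pair `B` of vertex sets spans a biclique of `G`: both sides are nonempty, they are
disjoint, and every vertex of the first side is adjacent to every vertex of the second. -/
def IsBiclique {V : Type*} (G : SimpleGraph V) (B : Finset V × Finset V) : Prop :=
  B.1.Nonempty ∧ B.2.Nonempty ∧ Disjoint B.1 B.2 ∧ ∀ x ∈ B.1, ∀ y ∈ B.2, G.Adj x y

/-- The pair `{u, v}` is an edge of the complete bipartite graph with sides `B.1` and `B.2`. -/
def BicliqueCovers {V : Type*} (B : Finset V × Finset V) (u v : V) : Prop :=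
  (u ∈ B.1 ∧ v ∈ B.2) ∨ (v ∈ B.1 ∧ u ∈ B.2)

/-- `P` lists bicliques of `G` such that every edge of `G` lies in exactly one of them. -/
def IsBicliquePartition {V : Type*} (G : SimpleGraph V) (P : List (Finset V × Finset V)) : Prop :=
  (∀ B ∈ P, IsBiclique G B) ∧
    ∀ u v : V, G.Adj u v → ∃! i : Fin P.length, BicliqueCovers (P.get i) u v

/-- The weight of a family of bicliques: the sum of their numbers of vertices. -/
def bicliqueWeight {V : Type*} (P : List (Finset V × Finset V)) : ℕ :=
  (P.map fun B => B.1.card + B.2.card).sum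

/-- The minimum weight of a biclique partition of `G`. -/
noncomputable def minBicliqueWeight {V : Type*} (G : SimpleGraph V) : ℕ :=
  sInf {W : ℕ | ∃ P : List (Finset V × Finset V), IsBicliquePartition G P ∧ bicliqueWeight P = W}

/-- `G` has edge density `γ`, i.e. `|E(G)| = γ * (n choose 2)`. -/
def HasDensity {n : ℕ} (G : SimpleGraph (Fin n)) (γ : ℝ) : Prop :=
  (G.edgeSet.ncard : ℝ) = γ * (n.choose 2 : ℝ)

/-- The maximum of `minBicliqueWeight G` over all `n`-vertex graphs `G` of edge density `γ`. -/
noncomputable def maxMinBicliqueWeight (n : ℕ) (γ : ℝ) : ℕ :=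
  sSup {W : ℕ | ∃ G : SimpleGraph (Fin n), HasDensity G γ ∧ minBicliqueWeight G = W}

/-- The binary entropy function, with logarithms to base `2`. -/
noncomputable def binaryEntropy (x : ℝ) : ℝ :=
  -x * Real.logb 2 x - (1 - x) * Real.logb 2 (1 - x)

/-- `γ k` is an edge density of `n k`-vertex graphs with `0 < γ k < 1`, where `n k → ∞` and
`max {1 / γ, 1 / (1 - γ)} = n ^ o(1)`. -/
structure IsAdmissible (n : ℕ → ℕ) (γ : ℕ → ℝ) : Prop where
  tendsto : Tendsto n atTop atTop
  mem_Ioo : ∀ᶠ k in atTop, γ k ∈ Set.Ioo (0 : ℝ) 1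
  integral : ∀ᶠ k in atTop, ∃ m : ℕ, γ k * ((n k).choose 2 : ℝ) = m
  subpolynomial : ∃ e : ℕ → ℝ, Tendsto e atTop (𝓝 0) ∧
    ∀ᶠ k in atTop, max (γ k)⁻¹ (1 - γ k)⁻¹ = (n k : ℝ) ^ e k

/-! ### A deterministic word RAM

A machine has registers and random-access arrays whose cells hold words of `w` bits, and a
write-only output tape. A program is a fixed command and mentions finitely many registers and
arrays, by constant names; array indices are computed at run time. -/

namespace WordRAM

/-- The operations on words. -/
inductive BinOp
  | add | sub | mul | div | mod | lt | eq

/-- The result of an operation on `w`-bit words: sums and products are reduced modulo `2 ^ w`,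
subtraction is truncated at `0`, `div` and `mod` are division with remainder, and a comparison
returns `1` or `0`. -/
def BinOp.apply (w : ℕ) : BinOp → ℕ → ℕ → ℕ
  | add, x, y => (x + y) % 2 ^ w
  | sub, x, y => (x - y) % 2 ^ w
  | mul, x, y => (x * y) % 2 ^ w
  | div, x, y => (x / y) % 2 ^ w
  | mod, x, y => (x % y) % 2 ^ w
  | lt, x, y => (if x < y then 1 else 0) % 2 ^ w
  | eq, x, y => (if x = y then 1 else 0) % 2 ^ w

/-- Expressions: constants, registers, the cell of array `a` at a computed index, operations. -/
inductive Expr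
  | const (c : ℕ)
  | reg (x : ℕ)
  | read (a : ℕ) (i : Expr)
  | bin (o : BinOp) (e f : Expr)

/-- Commands: do nothing, assign to a register, assign to a cell of array `a`, append a word to
the output, sequencing, branching on a nonzero test, looping while a test is nonzero. -/
inductive Cmd
  | skip
  | set (x : ℕ) (e : Expr)
  | write (a : ℕ) (i e : Expr)
  | emit (e : Expr)
  | seq (p q : Cmd)
  | cond (e : Expr) (p q : Cmd)
  | loop (e : Expr) (p : Cmd)

/-- The contents of the registers, of the arrays (name, then index), and of the output tape. -/
structure State where
  reg : ℕ → ℕ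
  arr : ℕ → ℕ → ℕ
  out : List ℕ

/-- The value of an expression. -/
def Expr.eval (w : ℕ) (s : State) : Expr → ℕ
  | const c => c % 2 ^ w
  | reg x => s.reg x
  | read a i => s.arr a (i.eval w s)
  | bin o e f => o.apply w (e.eval w s) (f.eval w s)

/-- One unit of time, on a configuration consisting of the commands that are still to be executed
and the state. One command is executed, or one test evaluated, per unit; the expressions of a
program have constant size, so this is the usual unit-cost measure up to a constant factor.
The machine has halted when no command is left. -/
def step (w : ℕ) : List Cmd × State → List Cmd × State
  | ([], s) => ([], s)
  | (.skip :: K, s) => (K, s)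
  | (.set x e :: K, s) => (K, { s with reg := Function.update s.reg x (e.eval w s) })
  | (.write a i e :: K, s) =>
      (K, { s with arr := Function.update s.arr a
                            (Function.update (s.arr a) (i.eval w s) (e.eval w s)) })
  | (.emit e :: K, s) => (K, { s with out := s.out ++ [e.eval w s] })
  | (.seq p q :: K, s) => (p :: q :: K, s)
  | (.cond e p q :: K, s) => (if e.eval w s ≠ 0 then p :: K else q :: K, s)
  | (.loop e p :: K, s) => (if e.eval w s ≠ 0 then p :: .loop e p :: K else K, s)

/-- With `w`-bit words and started in state `s`, the program `p` halts after at most `t` units of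
time, with output `o`. -/
def HaltsWithin (w : ℕ) (p : Cmd) (s : State) (t : ℕ) (o : List ℕ) : Prop :=
  ((step w)^[t] ([p], s)).1 = [] ∧ ((step w)^[t] ([p], s)).2.out = o

end WordRAM

/-! ### Input and output of graph algorithms -/

/-- `adj` is an adjacency list of `G`: for every vertex, the list of its neighbours, each listed
once, in any order. -/
def IsAdjacencyList {n : ℕ} (G : SimpleGraph (Fin n)) (adj : Fin n → List (Fin n)) : Prop :=
  ∀ v, (adj v).Nodup ∧ ∀ u, u ∈ adj v ↔ G.Adj v u

/-- The initial state for the adjacency list `adj`. Register `0` holds the number `n` of vertices.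
Array `1` holds the concatenation of the lists `adj 0, …, adj (n - 1)`. Cell `v < n` of array `0`
holds the position in array `1` at which `adj v` starts, and cell `n` holds the total length.
All other cells hold `0`. -/
def adjacencyInput {n : ℕ} (adj : Fin n → List (Fin n)) : WordRAM.State where
  reg := fun x => if x = 0 then n else 0
  arr := fun a i =>
    if a = 0 then (if i ≤ n then ((List.ofFn adj).take i).flatten.length else 0)
    else if a = 1 then ((List.ofFn adj).flatten.map Fin.val).getD i 0
    else 0
  out := []

/-- The output format for a sequence of bicliques: for each one, the two side sizes, then the
vertices of the first side, then those of the second side. -/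
def encodeBicliques {n : ℕ} (bs : List (List (Fin n) × List (Fin n))) : List ℕ :=
  bs.flatMap fun b => b.1.length :: b.2.length :: (b.1 ++ b.2).map Fin.val

/-- The word sequence `o` is a listing, without repeated vertices within a side, of the sequence
`P` of bicliques. -/
def IsBicliqueOutput {n : ℕ} (o : List ℕ) (P : List (Finset (Fin n) × Finset (Fin n))) : Prop :=
  ∃ bs : List (List (Fin n) × List (Fin n)),
    (∀ b ∈ bs, b.1.Nodup ∧ b.2.Nodup) ∧ o = encodeBicliques bs ∧
      P = bs.map fun b => (b.1.toFinset, b.2.toFinset)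

/-! Upper bound. Row `u` of the adjacency matrix below the diagonal lists the neighbours `v < u`.
Cut every row into phrases. A set of columns that is a phrase of several rows yields a biclique:
that set on one side, those rows on the other. An entry costs `α ≈ K log (1/γ)` and a gap costs `β ≈
K log (1/(1-γ))`, where `K = n²`, and a phrase is closed before its cost would exceed `T ≈ K log M`.
Each closing uses up at least `T - α` of the total cost `α m + β (N - m) ≈ K N H(γ)`, where `N =
n(n-1)/2` and `H` is the entropy in natural logarithms. So the row sides have total size about `N
H(γ) / log M` (`Finished.charge_sum`).

Few different phrases occur. The weights `(p/n)^i (q/n)^z` of the subsets of one interval sum to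
`1`, and a phrase of cost at most `T` has weight at least `1/M`. This Kraft argument
(`card_le_of_kraft`, `Params.kraft`) leaves at most `n D M` phrases of length at most `D`, so the
column sides have total size at most `n D² M`. The choice `M ≈ (pq)³ / (n⁵ log⁴ n)`, with `p ≈ γn`
and `q = n - p`, makes this of lower order (`Params.dictionary_le`), while still `log M ~ log n`
because `γ(1-γ) = n^(-o(1))` (`Params.threshold_sub_ge`).

Linear time. The phrases form a trie as in Lempel–Ziv parsing. All rows are parsed simultaneously,
column by column, so neighbour lists in any order suffice. Logarithms are replaced by integer
harmonic sums, rounded so that the Kraft inequality holds without error.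

Lower bound. A biclique partition of weight `W` is encoded by a word of length `W` over an alphabet
of `4n` letters (`card_graphs_le`), while there are at least `exp(N H(γ)) / (N + 1)` graphs
(`entropy_le_log_choose`). Hence `W log (4n)` is at least `(1 - o(1)) N H(γ)`. -/

/-! ### Running-time rules for the word RAM. -/

namespace WordRAM

/-- Started in state `s`, the command `p` terminates in state `s'` within `t` units of time. -/
def Runs (w : ℕ) (p : Cmd) (s : State) (t : ℕ) (s' : State) : Prop :=
  ∃ k ≤ t, ∀ K, (step w)^[k] (p :: K, s) = (K, s')

theorem Runs.mono {w p s t t' s'} (h : Runs w p s t s') (ht : t ≤ t') : Runs w p s t' s' := by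
  obtain ⟨k, hk, h⟩ := h
  exact ⟨k, hk.trans ht, h⟩

theorem Runs.seq {w p q s t s' t' s''} (h : Runs w p s t s') (h' : Runs w q s' t' s'') :
    Runs w (.seq p q) s (t + t' + 1) s'' := by
  obtain ⟨k, hk, h⟩ := h
  obtain ⟨l, hl, h'⟩ := h'
  refine ⟨l + (k + 1), by omega, fun K => ?_⟩
  rw [Function.iterate_add_apply, Function.iterate_succ_apply, step, h, h']

theorem Runs.cond_true {w e p q s t s'} (he : e.eval w s ≠ 0) (h : Runs w p s t s') :
    Runs w (.cond e p q) s (t + 1) s' := by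
  obtain ⟨k, hk, h⟩ := h
  refine ⟨k + 1, by omega, fun K => ?_⟩
  rw [Function.iterate_succ_apply, step, if_pos he, h]

theorem Runs.cond_false {w e p q s t s'} (he : e.eval w s = 0) (h : Runs w q s t s') :
    Runs w (.cond e p q) s (t + 1) s' := by
  obtain ⟨k, hk, h⟩ := h
  refine ⟨k + 1, by omega, fun K => ?_⟩
  rw [Function.iterate_succ_apply, step, if_neg (by simpa using he), h]

/-- The loop rule: `Inv` is an invariant, and the potential `Φ` pays for the running time. -/
theorem Runs.loop {w e p} (Inv : State → Prop) (Φ : State → ℕ)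
    (hbody : ∀ s, Inv s → e.eval w s ≠ 0 →
      ∃ t s', Runs w p s t s' ∧ Inv s' ∧ t + 1 + Φ s' ≤ Φ s) (s : State) (hs : Inv s) :
    ∃ s', Runs w (.loop e p) s (Φ s + 1) s' ∧ Inv s' ∧ e.eval w s' = 0 := by
  induction hN : Φ s using Nat.strong_induction_on generalizing s with
  | _ N ih =>
    by_cases he : e.eval w s = 0
    · refine ⟨s, ⟨1, by omega, fun K => ?_⟩, hs, he⟩
      rw [Function.iterate_one, step, if_neg (by simpa using he)]
    · obtain ⟨t, s₁, ⟨k, hk, h₁⟩, hI, ht⟩ := hbody s hs he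
      obtain ⟨s₂, ⟨l, hl, h₂⟩, hI₂, he₂⟩ := ih (Φ s₁) (by omega) s₁ hI rfl
      refine ⟨s₂, ⟨l + (k + 1), by omega, fun K => ?_⟩, hI₂, he₂⟩
      rw [Function.iterate_add_apply, Function.iterate_succ_apply, step, if_pos he, h₁, h₂]

/-- The state transformer of a loop-free command. -/
def Cmd.run (w : ℕ) : Cmd → State → State
  | .skip, s => s
  | .set x e, s => { s with reg := Function.update s.reg x (e.eval w s) }
  | .write a i e, s =>
      { s with arr := Function.update s.arr a
                        (Function.update (s.arr a) (i.eval w s) (e.eval w s)) }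
  | .emit e, s => { s with out := s.out ++ [e.eval w s] }
  | .seq p q, s => q.run w (p.run w s)
  | .cond e p q, s => if e.eval w s ≠ 0 then p.run w s else q.run w s
  | .loop _ _, s => s

theorem Cmd.run_cond_pos {w : ℕ} {s : State} {e : Expr} (he : e.eval w s ≠ 0) (p q : Cmd) :
    (Cmd.cond e p q).run w s = p.run w s := by
  simp [Cmd.run, he]

theorem Cmd.run_cond_neg {w : ℕ} {s : State} {e : Expr} (he : e.eval w s = 0) (p q : Cmd) :
    (Cmd.cond e p q).run w s = q.run w s := by
  simp [Cmd.run, he]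

/-- The command contains no loop. -/
def Cmd.LoopFree : Cmd → Prop
  | .seq p q => p.LoopFree ∧ q.LoopFree
  | .cond _ p q => p.LoopFree ∧ q.LoopFree
  | .loop _ _ => False
  | _ => True

/-- The number of nodes of a command, a bound on the running time of loop-free commands. -/
def Cmd.size : Cmd → ℕ
  | .seq p q => p.size + q.size + 1
  | .cond _ p q => p.size + q.size + 1
  | _ => 1

theorem Cmd.LoopFree.runs {w : ℕ} {p : Cmd} (hp : p.LoopFree) (s : State) :
    Runs w p s p.size (p.run w s) := by
  induction p generalizing s with
  | skip => exact ⟨1, le_rfl, fun K => rfl⟩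
  | set x e => exact ⟨1, le_rfl, fun K => rfl⟩
  | write a i e => exact ⟨1, le_rfl, fun K => rfl⟩
  | emit e => exact ⟨1, le_rfl, fun K => rfl⟩
  | seq p q ihp ihq => exact (ihp hp.1 s).seq (ihq hp.2 _)
  | cond e p q ihp ihq =>
    by_cases he : e.eval w s = 0
    · rw [Cmd.run_cond_neg he]
      exact (Runs.cond_false he (ihq hp.2 s)).mono (by simp only [Cmd.size]; omega)
    · rw [Cmd.run_cond_pos he]
      exact (Runs.cond_true he (ihp hp.1 s)).mono (by simp only [Cmd.size]; omega)
  | loop e p => exact hp.elim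

theorem iterate_step_halted (w : ℕ) (s : State) (j : ℕ) : (step w)^[j] ([], s) = ([], s) :=
  Function.iterate_fixed (f := step w) (x := ([], s)) rfl j

theorem HaltsWithin.mono {w p s t t' o} (h : HaltsWithin w p s t o) (ht : t ≤ t') :
    HaltsWithin w p s t' o := by
  obtain ⟨j, rfl⟩ := Nat.exists_eq_add_of_le' ht
  obtain ⟨h1, h2⟩ := h
  have h3 : (step w)^[t] ([p], s) = ([], ((step w)^[t] ([p], s)).2) := Prod.ext h1 rfl
  have h4 : (step w)^[j + t] ([p], s) = ([], ((step w)^[t] ([p], s)).2) := by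
    rw [Function.iterate_add_apply, h3, iterate_step_halted]
  exact ⟨by rw [h4], by rw [h4]; exact h2⟩

theorem Runs.haltsWithin {w p s t s'} (h : Runs w p s t s') : HaltsWithin w p s t s'.out := by
  obtain ⟨k, hk, h⟩ := h
  refine HaltsWithin.mono (t := k) ?_ hk
  simp [HaltsWithin, h []]

end WordRAM

/-! ### The parser: its trie and its lists of rows. -/

/-- The data of the parsing algorithm: for every row its current cost, position and trie node;
a trie with child table, parents, labels and depths; for every node the rows that use it. -/
structure Parser where
  cost : ℕ → ℕ
  pos : ℕ → ℕ
  node : ℕ → ℕ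
  ch : ℕ → ℕ
  par : ℕ → ℕ
  lab : ℕ → ℕ
  dep : ℕ → ℕ
  rc : ℕ → ℕ
  rows : ℕ → ℕ
  cnt : ℕ

namespace Parser

open Function

/-- Record that row `u` uses its current node. -/
def close (n : ℕ) (c : Parser) (u : ℕ) : Parser :=
  { c with
    rows := update c.rows (c.node u * n + c.rc (c.node u)) u
    rc := update c.rc (c.node u) (c.rc (c.node u) + 1) }

/-- Make sure that node `x` has a child with label `v`. -/
def child (n : ℕ) (c : Parser) (x v : ℕ) : Parser :=
  if c.ch (x * n + v) ≠ 0 then c else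
    { c with
      cnt := c.cnt + 1
      ch := update c.ch (x * n + v) (c.cnt + 1)
      par := update c.par (c.cnt + 1) x
      lab := update c.lab (c.cnt + 1) v
      dep := update c.dep (c.cnt + 1) (c.dep x + 1) }

/-- Move row `u` to the child with label `v` of node `x`, at cost `t`. -/
def enter (n : ℕ) (c : Parser) (u v x t : ℕ) : Parser :=
  { c.child n x v with
    node := update c.node u ((c.child n x v).ch (x * n + v))
    cost := update c.cost u t
    pos := update c.pos u (v + 1) }

/-- The cost of the current phrase of row `u` if extended by column `v`. -/
def newCost (α β : ℕ) (c : Parser) (u v : ℕ) : ℕ := c.cost u + β * (v - c.pos u) + α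

/-- Process the entry in row `u` and column `v`. -/
def process (n α β T : ℕ) (c : Parser) (u v : ℕ) : Parser :=
  if T < c.newCost α β u v then (c.close n u).enter n u v 0 α
  else c.enter n u v (c.node u) (c.newCost α β u v)

/-- The list `l` of columns lies in an interval that it covers at cost at most `T`. -/
def Cheap (α β T : ℕ) (l : List ℕ) : Prop :=
  ∃ a z, (∀ v ∈ l, a ≤ v ∧ v < a + l.length + z) ∧ α * l.length + β * z ≤ T

/-- The trie is well-formed, and `L x` is the list of labels on the path from `x` to the root. -/
structure TrieInv (n α β T : ℕ) (c : Parser) (L : ℕ → List ℕ) : Prop where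
  root : L 0 = []
  dep_eq : ∀ x ≤ c.cnt, c.dep x = (L x).length
  par_lt : ∀ x, 1 ≤ x → x ≤ c.cnt → c.par x < x
  path : ∀ x, 1 ≤ x → x ≤ c.cnt → L x = c.lab x :: L (c.par x)
  sorted : ∀ x ≤ c.cnt, (L x).Pairwise (· > ·)
  lt : ∀ x ≤ c.cnt, ∀ v ∈ L x, v < n
  ch_par : ∀ x, 1 ≤ x → x ≤ c.cnt → c.ch (c.par x * n + c.lab x) = x
  ch_inv : ∀ x v, v < n → c.ch (x * n + v) ≠ 0 →
    c.ch (x * n + v) ≤ c.cnt ∧ c.par (c.ch (x * n + v)) = x ∧ c.lab (c.ch (x * n + v)) = v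
  cheap : ∀ x, 1 ≤ x → x ≤ c.cnt → Cheap α β T (L x)

/-- Tables indexed by pairs are stored in one array; this shows that the addresses `x * n + v` do
not collide. -/
theorem key_inj {n x v x' v' : ℕ} (hv : v < n) (hv' : v' < n) (h : x * n + v = x' * n + v') :
    x = x' ∧ v = v' := by
  have hn : 0 < n := by omega
  have h1 : (x * n + v) / n = x := by
    rw [mul_comm, Nat.mul_add_div hn, Nat.div_eq_of_lt hv, add_zero]
  have h2 : (x' * n + v') / n = x' := by
    rw [mul_comm, Nat.mul_add_div hn, Nat.div_eq_of_lt hv', add_zero]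
  have : x = x' := by rw [← h1, ← h2, h]
  subst this
  exact ⟨rfl, by omega⟩

/-- If the child exists, `ch_inv` and `path` determine its path. Otherwise the node `c.cnt + 1` is
new and `L` is extended there; old paths are kept, and the path stays descending because `v` exceeds
all its labels. -/
theorem TrieInv.child {n α β T : ℕ} {c : Parser} {L : ℕ → List ℕ} (h : TrieInv n α β T c L)
    {x v : ℕ} (hx : x ≤ c.cnt) (hv : v < n) (hlt : ∀ l ∈ L x, l < v)
    (hc : Cheap α β T (v :: L x)) :
    ∃ L', TrieInv n α β T (c.child n x v) L' ∧ (∀ y ≤ c.cnt, L' y = L y) ∧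
      c.cnt ≤ (c.child n x v).cnt ∧
      1 ≤ (c.child n x v).ch (x * n + v) ∧
      (c.child n x v).ch (x * n + v) ≤ (c.child n x v).cnt ∧
      L' ((c.child n x v).ch (x * n + v)) = v :: L x := by
  by_cases hch : c.ch (x * n + v) ≠ 0
  · rw [Parser.child, if_pos hch]
    obtain ⟨h1, h2, h3⟩ := h.ch_inv x v hv hch
    have h4 : 1 ≤ c.ch (x * n + v) := by omega
    exact ⟨L, h, fun _ _ => rfl, le_rfl, h4, h1, by rw [h.path _ h4 h1, h2, h3]⟩
  · have hch' : c.ch (x * n + v) = 0 := by simpa using hch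
    rw [Parser.child, if_neg hch]
    have hL : ∀ y ≤ c.cnt, update L (c.cnt + 1) (v :: L x) y = L y := fun y hy =>
      update_of_ne (by omega) _ _
    refine ⟨update L (c.cnt + 1) (v :: L x), ⟨?_, ?_, ?_, ?_, ?_, ?_, ?_, ?_, ?_⟩, hL, ?_, ?_, ?_, ?_⟩
    · rw [hL 0 (by omega), h.root]
    · intro y hy
      rcases Nat.lt_or_ge c.cnt y with hy' | hy'
      · obtain rfl : y = c.cnt + 1 := by simp only at hy; omega
        simp [h.dep_eq x hx]
      · rw [hL y hy', ← h.dep_eq y hy']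
        exact update_of_ne (by omega) _ _
    · intro y hy1 hy
      rcases Nat.lt_or_ge c.cnt y with hy' | hy'
      · obtain rfl : y = c.cnt + 1 := by simp only at hy; omega
        simp only [update_self]; omega
      · simp only [update_of_ne (show y ≠ c.cnt + 1 by omega)]
        exact h.par_lt y hy1 hy'
    · intro y hy1 hy
      rcases Nat.lt_or_ge c.cnt y with hy' | hy'
      · obtain rfl : y = c.cnt + 1 := by simp only at hy; omega
        simp only [update_self]; rw [hL x hx]
      · simp only [update_of_ne (show y ≠ c.cnt + 1 by omega)]
        rw [update_of_ne (show c.par y ≠ c.cnt + 1 by have := h.par_lt y hy1 hy'; omega)]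
        exact h.path y hy1 hy'
    · intro y hy
      rcases Nat.lt_or_ge c.cnt y with hy' | hy'
      · obtain rfl : y = c.cnt + 1 := by simp only at hy; omega
        simp only [update_self, List.pairwise_cons]
        exact ⟨hlt, h.sorted x hx⟩
      · rw [hL y hy']; exact h.sorted y hy'
    · intro y hy
      rcases Nat.lt_or_ge c.cnt y with hy' | hy'
      · obtain rfl : y = c.cnt + 1 := by simp only at hy; omega
        simp only [update_self, List.mem_cons, forall_eq_or_imp]
        exact ⟨hv, h.lt x hx⟩
      · rw [hL y hy']; exact h.lt y hy'
    · intro y hy1 hy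
      rcases Nat.lt_or_ge c.cnt y with hy' | hy'
      · obtain rfl : y = c.cnt + 1 := by simp only at hy; omega
        simp only [update_self]
      · simp only [update_of_ne (show y ≠ c.cnt + 1 by omega)]
        have := h.ch_par y hy1 hy'
        rw [update_of_ne, this]
        -- The table entry at the key of an old node `y` is `y ≥ 1`, while it was `0` at the key of
        -- the new child.
        rintro he
        rw [he] at this
        omega
    · intro y l hl hne
      by_cases he : y * n + l = x * n + v
      · obtain ⟨rfl, rfl⟩ := key_inj hl hv he
        simp
      · simp only [update_of_ne he] at hne ⊢
        obtain ⟨h1, h2, h3⟩ := h.ch_inv y l hl hne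
        rw [update_of_ne (by omega), update_of_ne (by omega)]
        exact ⟨by omega, h2, h3⟩
    · intro y hy1 hy
      rcases Nat.lt_or_ge c.cnt y with hy' | hy'
      · obtain rfl : y = c.cnt + 1 := by simp only at hy; omega
        rwa [update_self]
      · rw [hL y hy']; exact h.cheap y hy1 hy'
    · simp
    · simp
    · simp
    · simp

theorem cnt_child_le (n : ℕ) (c : Parser) (x v : ℕ) : (c.child n x v).cnt ≤ c.cnt + 1 := by
  unfold Parser.child; split_ifs <;> simp

theorem cnt_process_le (n α β T : ℕ) (c : Parser) (u v : ℕ) :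
    (c.process n α β T u v).cnt ≤ c.cnt + 1 := by
  unfold process; split_ifs
  · exact cnt_child_le n (c.close n u) _ _
  · exact cnt_child_le n c _ _

/-- `R x` is the list of rows that use the node `x`. -/
structure RowsInv (n : ℕ) (c : Parser) (R : ℕ → List ℕ) : Prop where
  rc_eq : ∀ x, c.rc x = (R x).length
  rows_eq : ∀ x j, (h : j < (R x).length) → c.rows (x * n + j) = (R x)[j]
  nodup : ∀ x, (R x).Nodup
  lt : ∀ x, ∀ u ∈ R x, u < n

theorem length_le_of_nodup_lt {n : ℕ} {l : List ℕ} (hl : l.Nodup) (h : ∀ u ∈ l, u < n) :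
    l.length ≤ n := by
  have : l.toFinset ⊆ Finset.range n := fun x hx => by
    simpa using h x (by simpa using hx)
  simpa [List.toFinset_card_of_nodup hl] using Finset.card_le_card this

theorem length_lt_of_nodup_lt {n u : ℕ} {l : List ℕ} (hl : l.Nodup) (h : ∀ u ∈ l, u < n)
    (hu : u < n) (hul : u ∉ l) : l.length < n := by
  have := length_le_of_nodup_lt (n := n) (l := u :: l) (by simp [hl, hul]) (by simpa [hu] using h)
  simpa using this

/-- The list of the node consists of distinct rows below `n` and misses `u`, so it is shorter than
`n` and the new cell stays inside the node's block of `n` cells. -/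
theorem RowsInv.close {n : ℕ} {c : Parser} {R : ℕ → List ℕ} (h : RowsInv n c R) {u : ℕ}
    (hu : u < n) (hul : u ∉ R (c.node u)) :
    RowsInv n (c.close n u) (update R (c.node u) (R (c.node u) ++ [u])) := by
  set x := c.node u with hx
  have hlen : ∀ y, (R y).length ≤ n := fun y => length_le_of_nodup_lt (h.nodup y) (h.lt y)
  have hlx : (R x).length < n := length_lt_of_nodup_lt (h.nodup x) (h.lt x) hu hul
  refine ⟨?_, ?_, ?_, ?_⟩
  · intro y
    by_cases hy : y = x
    · subst hy; simp [Parser.close, ← hx, h.rc_eq]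
    · simp [Parser.close, ← hx, h.rc_eq, update_of_ne hy]
  · intro y j hj
    simp only [Parser.close, ← hx, h.rc_eq]
    by_cases hy : y = x
    · subst hy
      simp only [update_self, List.length_append, List.length_singleton] at hj ⊢
      by_cases hj' : j = (R x).length
      · subst hj'
        simp
      · have hj'' : j < (R x).length := by omega
        rw [update_of_ne (by omega), List.getElem_append_left hj'', h.rows_eq x j hj'']
    · simp only [update_of_ne hy] at hj ⊢
      rw [update_of_ne, h.rows_eq y j hj]
      intro he
      exact hy (key_inj (hj.trans_le (hlen y)) hlx he).1
  · intro y
    by_cases hy : y = x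
    · subst hy
      simp only [update_self, List.nodup_append, h.nodup, true_and]
      simp only [List.nodup_cons, List.not_mem_nil, not_false_eq_true, List.nodup_nil, and_self,
        List.mem_singleton, forall_eq, true_and]
      rintro a ha rfl
      exact hul ha
    · simpa [update_of_ne hy] using h.nodup y
  · intro y
    by_cases hy : y = x
    · subst hy
      simp only [update_self, List.mem_append, List.mem_singleton]
      rintro v (hv | rfl)
      · exact h.lt _ v hv
      · exact hu
    · simpa [update_of_ne hy] using h.lt y

end Parser

/-! ### Correctness of one parsing step. -/

namespace Parser

open Function

/-- The trie `c` with rows `R` describes a parsing of the entries in the columns `E u` of the rows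
`u`, and `cl u` counts how often row `u` was closed. -/
structure ParseInv (n α β T : ℕ) (c : Parser) (E : ℕ → Finset ℕ) (L R : ℕ → List ℕ)
    (cl : ℕ → ℕ) : Prop where
  node_le : ∀ u, c.node u ≤ c.cnt
  mem_le : ∀ x, ∀ u ∈ R x, x ≤ c.cnt
  fresh : ∀ u x, u ∈ R x → c.node u = x → x = 0
  cover : ∀ u v, v ∈ E u ↔ ∃ x, (u ∈ R x ∨ c.node u = x) ∧ v ∈ L x
  unique : ∀ u v x y, (u ∈ R x ∨ c.node u = x) → v ∈ L x → (u ∈ R y ∨ c.node u = y) → v ∈ L y →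
    x = y
  lt_pos : ∀ u, ∀ v ∈ E u, v < c.pos u
  pos_le : ∀ u, c.pos u ≤ u
  cost_le : ∀ u, c.cost u ≤ T
  phrase : ∀ u, ∃ a z, a + (L (c.node u)).length + z = c.pos u ∧ (∀ v ∈ L (c.node u), a ≤ v) ∧
    α * (L (c.node u)).length + β * z ≤ c.cost u
  charge : ∀ u, ∃ Z, (E u).card + Z = c.pos u ∧
    cl u * (T - α) + c.cost u ≤ α * (E u).card + β * Z
  sum_length : ∑ x ∈ Finset.range (c.cnt + 1), (R x).length = ∑ u ∈ Finset.range n, cl u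

/-- Close row `u` and let a new phrase begin at column `v`. -/
def restart (n : ℕ) (c : Parser) (u v : ℕ) : Parser :=
  { c.close n u with
    node := update c.node u 0
    cost := update c.cost u 0
    pos := update c.pos u v }

/-- Splits a step that closes a phrase into `restart`, which opens an empty phrase at column `v`,
followed by an ordinary entry, so that `enter` has to be analysed only once. -/
theorem enter_restart (n : ℕ) (c : Parser) (u v t : ℕ) :
    (c.restart n u v).enter n u v 0 t = (c.close n u).enter n u v 0 t := by
  unfold enter child restart close
  by_cases h : c.ch v = 0 <;> simp [h]

theorem sum_length_update {R : ℕ → List ℕ} {k x u : ℕ} (hx : x < k) :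
    ∑ y ∈ Finset.range k, (update R x (R x ++ [u]) y).length =
      ∑ y ∈ Finset.range k, (R y).length + 1 := by
  have : ∀ y, (update R x (R x ++ [u]) y).length = (R y).length + if y = x then 1 else 0 := by
    intro y
    by_cases hy : y = x
    · subst hy; simp
    · simp [hy]
  simp [this, Finset.sum_add_distrib, hx]

theorem sum_update_succ {f : ℕ → ℕ} {k x : ℕ} (hx : x < k) :
    ∑ y ∈ Finset.range k, update f x (f x + 1) y = ∑ y ∈ Finset.range k, f y + 1 := by
  have : ∀ y, update f x (f x + 1) y = f y + if y = x then 1 else 0 := by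
    intro y
    by_cases hy : y = x
    · subst hy; simp
    · simp [hy]
  simp [this, Finset.sum_add_distrib, hx]

theorem mem_update_append {R : ℕ → List ℕ} {x u u' y : ℕ} :
    u' ∈ update R x (R x ++ [u]) y ↔ u' ∈ R y ∨ (y = x ∧ u' = u) := by
  by_cases hy : y = x
  · subst hy; simp
  · simp [hy]

/-- Row `u` passes from standing at its node to being recorded there. This changes no use of a node
with a nonempty path, so covering and uniqueness survive; only the account in `charge` moves. -/
theorem ParseInv.restart {n α β T : ℕ} {c : Parser} {E : ℕ → Finset ℕ} {L R : ℕ → List ℕ}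
    {cl : ℕ → ℕ} (h : ParseInv n α β T c E L R cl) (h0 : L 0 = []) {u v : ℕ} (hu : u < n)
    (hvu : v < u) (hv : c.pos u ≤ v) (hT : T < c.newCost α β u v) :
    ParseInv n α β T (c.restart n u v) E L (update R (c.node u) (R (c.node u) ++ [u]))
      (update cl u (cl u + 1)) := by
  have hold : ∀ u' x w, w ∈ L x →
      ((u' ∈ update R (c.node u) (R (c.node u) ++ [u]) x ∨ (c.restart n u v).node u' = x) ↔
        (u' ∈ R x ∨ c.node u' = x)) := by
    intro u' x w hw
    rw [mem_update_append]
    simp only [Parser.restart]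
    by_cases hu' : u' = u
    · subst hu'
      have : x ≠ 0 := by rintro rfl; simp [h0] at hw
      simp only [update_self, this.symm, or_false, and_true]
      exact or_congr_right eq_comm
    · simp [hu']
  refine ⟨?_, ?_, ?_, ?_, ?_, ?_, ?_, ?_, ?_, ?_, ?_⟩
  · intro u'
    simp only [Parser.restart, Parser.close, update_apply]
    split_ifs
    · omega
    · exact h.node_le u'
  · intro x u' hx
    rcases mem_update_append.1 hx with hx | ⟨rfl, rfl⟩
    · exact h.mem_le x u' hx
    · exact h.node_le _
  · intro u' x hx hn
    by_cases hu' : u' = u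
    · subst hu'
      simpa [Parser.restart] using hn.symm
    · simp only [Parser.restart, update_of_ne hu'] at hn
      rcases mem_update_append.1 hx with hx | ⟨-, rfl⟩
      · exact h.fresh u' x hx hn
      · exact absurd rfl hu'
  · intro u' w
    rw [h.cover]
    refine exists_congr fun x => ?_
    by_cases hw : w ∈ L x
    · rw [hold u' x w hw]
    · simp [hw]
  · intro u' w x y hx hwx hy hwy
    exact h.unique u' w x y ((hold u' x w hwx).1 hx) hwx ((hold u' y w hwy).1 hy) hwy
  · intro u' w hw
    have := h.lt_pos u' w hw
    simp only [Parser.restart, update_apply]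
    split_ifs with hu'
    · subst hu'; omega
    · exact this
  · intro u'
    simp only [Parser.restart, update_apply]
    split_ifs with hu'
    · omega
    · exact h.pos_le u'
  · intro u'
    simp only [Parser.restart, update_apply]
    split_ifs with hu'
    · omega
    · exact h.cost_le u'
  · intro u'
    by_cases hu' : u' = u
    · subst hu'
      exact ⟨v, 0, by simp [Parser.restart, h0]⟩
    · simpa only [Parser.restart, update_of_ne hu'] using h.phrase u'
  · intro u'
    by_cases hu' : u' = u
    · subst hu'
      obtain ⟨Z, hZ, hc⟩ := h.charge u'
      refine ⟨Z + (v - c.pos u'), ?_, ?_⟩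
      · simp only [Parser.restart, update_self]; omega
      · simp only [Parser.restart, update_self]
        -- The gap before `v` belongs to no phrase and is charged to the phrase being closed; by
        -- `hT`, old cost and gap together pay `T - α`.
        unfold newCost at hT
        rw [mul_add, add_mul]
        omega
    · simpa only [Parser.restart, update_of_ne hu'] using h.charge u'
  · have hlt : c.node u < c.cnt + 1 := Nat.lt_succ_of_le (h.node_le u)
    change ∑ y ∈ Finset.range (c.cnt + 1), _ = _
    rw [sum_length_update hlt, sum_update_succ hu, h.sum_length]

/-- Column `v` is new to row `u`, whose earlier columns are below `pos u`. The path of the child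
contains `v`, whereas the paths of nodes already recorded for `u` lie in `E u`; hence `u` is not yet
recorded at the child. -/
theorem ParseInv.enter {n α β T : ℕ} {c : Parser} {E : ℕ → Finset ℕ} {L R : ℕ → List ℕ}
    {cl : ℕ → ℕ} (h : ParseInv n α β T c E L R cl) (hL : TrieInv n α β T c L) {u v : ℕ}
    (hu : u < n) (hvu : v < u) (hv : c.pos u ≤ v) (hT : c.newCost α β u v ≤ T) :
    ∃ L', TrieInv n α β T (c.enter n u v (c.node u) (c.newCost α β u v)) L' ∧
      ParseInv n α β T (c.enter n u v (c.node u) (c.newCost α β u v))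
        (update E u (insert v (E u))) L' R cl ∧
      u ∉ R ((c.enter n u v (c.node u) (c.newCost α β u v)).node u) := by
  set x := c.node u with hx
  have hLE : ∀ l ∈ L x, l ∈ E u := fun l hl => (h.cover u l).2 ⟨x, Or.inr rfl, hl⟩
  have hLv : ∀ l ∈ L x, l < v := fun l hl => (h.lt_pos u l (hLE l hl)).trans_le hv
  have hvE : v ∉ E u := fun hvE => (h.lt_pos u v hvE).not_ge hv
  obtain ⟨a, z, haz, hal, hcost⟩ := h.phrase u
  rw [← hx] at haz hal hcost
  have hcost' : α * (v :: L x).length + β * (z + (v - c.pos u)) ≤ c.newCost α β u v := by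
    simp only [List.length_cons, newCost, mul_add]
    omega
  have hcheap : Cheap α β T (v :: L x) := by
    refine ⟨a, z + (v - c.pos u), ?_, hcost'.trans hT⟩
    intro w hw
    simp only [List.length_cons]
    rcases List.mem_cons.1 hw with rfl | hw
    · omega
    · have := hal w hw
      have := hLv w hw
      omega
  obtain ⟨L', hL', hLL', hcnt, hy1, hy, hLy⟩ :=
    hL.child (h.node_le u) (hvu.trans hu) hLv hcheap
  rw [← hx] at hL' hcnt hy1 hy hLy
  set c' := c.child n x v with hc'
  set y := c'.ch (x * n + v) with hyd
  have hRE : ∀ x', u ∈ R x' → ∀ w ∈ L' x', w ∈ E u := fun x' hx' w hw =>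
    (h.cover u w).2 ⟨x', Or.inl hx', by rwa [← hLL' x' (h.mem_le _ _ hx')]⟩
  have hyR : u ∉ R y := fun hyR => hvE (hRE y hyR v (by simp [hLy]))
  have hnode : (c.enter n u v x (c.newCost α β u v)).node = update c.node u y := rfl
  have hholds : ∀ u' ≠ u, ∀ x' w, ((u' ∈ R x' ∨ update c.node u y u' = x') ∧ w ∈ L' x') ↔
      ((u' ∈ R x' ∨ c.node u' = x') ∧ w ∈ L x') := by
    intro u' hu' x' w
    rw [update_of_ne hu']
    refine and_congr_right fun hh => ?_
    rw [hLL' x']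
    rcases hh with hh | rfl
    · exact h.mem_le _ _ hh
    · exact h.node_le _
  refine ⟨L', ⟨hL'.1, hL'.2, hL'.3, hL'.4, hL'.5, hL'.6, hL'.7, hL'.8, hL'.9⟩,
    ⟨?_, ?_, ?_, ?_, ?_, ?_, ?_, ?_, ?_, ?_, ?_⟩, ?_⟩
  · intro u'
    rw [hnode, update_apply]
    split_ifs
    · exact hy
    · exact (h.node_le u').trans hcnt
  · exact fun x' u' hx' => (h.mem_le x' u' hx').trans hcnt
  · intro u' x' hx' hn
    rw [hnode] at hn
    by_cases hu' : u' = u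
    · subst hu'
      rw [update_self] at hn
      subst hn
      exact absurd hx' hyR
    · rw [update_of_ne hu'] at hn
      exact h.fresh u' x' hx' hn
  · intro u' w
    rw [hnode]
    by_cases hu' : u' = u
    · subst hu'
      rw [update_self, update_self, Finset.mem_insert, h.cover]
      constructor
      · rintro (rfl | ⟨x', hx' | hx', hw⟩)
        · exact ⟨y, Or.inr rfl, by simp [hLy]⟩
        · exact ⟨x', Or.inl hx', by rwa [hLL' x' (h.mem_le _ _ hx')]⟩
        · refine ⟨y, Or.inr rfl, ?_⟩
          rw [hLy, hx, hx']
          exact List.mem_cons_of_mem _ hw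
      · rintro ⟨x', hx' | rfl, hw⟩
        · exact Or.inr ⟨x', Or.inl hx', by rwa [← hLL' x' (h.mem_le _ _ hx')]⟩
        · rw [hLy] at hw
          rcases List.mem_cons.1 hw with rfl | hw
          · exact Or.inl rfl
          · exact Or.inr ⟨x, Or.inr rfl, hw⟩
    · rw [update_of_ne hu' (insert v (E u)) E, h.cover]
      exact exists_congr fun x' => (hholds u' hu' x' w).symm
  · intro u' w x₁ x₂
    rw [hnode]
    by_cases hu' : u' = u
    · subst hu'
      rw [update_self]
      -- A column shared by a recorded path and the new current path cannot be `v`. If it belonged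
      -- to the old current phrase, `unique` and `fresh` would make the recorded node the root,
      -- whose path is empty.
      have key : ∀ x₁, u' ∈ R x₁ → w ∈ L' x₁ → w ∈ L' y → False := by
        intro x₁ hx₁ hw hwy
        rw [hLy] at hwy
        rcases List.mem_cons.1 hwy with rfl | hwy
        · exact hvE (hRE x₁ hx₁ _ hw)
        · rw [hLL' x₁ (h.mem_le _ _ hx₁)] at hw
          have := h.unique u' w x₁ x (Or.inl hx₁) hw (Or.inr rfl) hwy
          subst this
          have := h.fresh u' _ hx₁ hx.symm
          rw [this, hL.root] at hw
          simp at hw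
      rintro (h1 | rfl) hw1 (h2 | rfl) hw2
      · rw [hLL' x₁ (h.mem_le _ _ h1)] at hw1
        rw [hLL' x₂ (h.mem_le _ _ h2)] at hw2
        exact h.unique u' w x₁ x₂ (Or.inl h1) hw1 (Or.inl h2) hw2
      · exact (key _ h1 hw1 hw2).elim
      · exact (key _ h2 hw2 hw1).elim
      · rfl
    · intro h1 hw1 h2 hw2
      have h1' := (hholds u' hu' x₁ w).1 ⟨h1, hw1⟩
      have h2' := (hholds u' hu' x₂ w).1 ⟨h2, hw2⟩
      exact h.unique u' w x₁ x₂ h1'.1 h1'.2 h2'.1 h2'.2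
  · intro u' w hw
    simp only [Parser.enter]
    by_cases hu' : u' = u
    · subst hu'
      rw [update_self] at hw ⊢
      rcases Finset.mem_insert.1 hw with rfl | hw
      · omega
      · have := h.lt_pos u' w hw
        omega
    · rw [update_of_ne hu'] at hw ⊢
      exact h.lt_pos u' w hw
  · intro u'
    simp only [Parser.enter, update_apply]
    split_ifs
    · omega
    · exact h.pos_le u'
  · intro u'
    simp only [Parser.enter, update_apply]
    split_ifs
    · exact hT
    · exact h.cost_le u'
  · intro u'
    rw [hnode]
    simp only [Parser.enter]
    by_cases hu' : u' = u
    · subst hu'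
      rw [update_self, update_self, update_self, hLy]
      refine ⟨a, z + (v - c.pos u'), ?_, ?_, hcost'⟩
      · simp only [List.length_cons]; omega
      · intro w hw
        rcases List.mem_cons.1 hw with rfl | hw
        · omega
        · exact hal w hw
    · rw [update_of_ne hu', update_of_ne hu', update_of_ne hu', hLL' _ (h.node_le u')]
      exact h.phrase u'
  · intro u'
    simp only [Parser.enter]
    by_cases hu' : u' = u
    · subst hu'
      obtain ⟨Z, hZ, hc⟩ := h.charge u'
      rw [update_self, update_self, update_self, Finset.card_insert_of_notMem hvE]
      refine ⟨Z + (v - c.pos u'), by omega, ?_⟩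
      unfold newCost
      rw [mul_add, mul_add]
      omega
    · rw [update_of_ne hu', update_of_ne hu', update_of_ne hu']
      exact h.charge u'
  · rw [← h.sum_length]
    symm
    refine Finset.sum_subset ?_ ?_
    · intro x' hx'
      simp only [Finset.mem_range] at hx' ⊢
      exact lt_of_lt_of_le hx' (Nat.succ_le_succ hcnt)
    · intro x' _ hx'
      rw [List.length_eq_zero_iff, List.eq_nil_iff_forall_not_mem]
      intro u' hu'
      exact hx' (by simpa [Nat.lt_succ_iff] using h.mem_le x' u' hu')
  · rw [hnode, update_self]; exact hyR

/-- The invariant of the parsing algorithm, when the entries in columns `E u` of the rows `u` have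
been processed. -/
def Inv (n α β T : ℕ) (c : Parser) (E : ℕ → Finset ℕ) : Prop :=
  ∃ L R cl, TrieInv n α β T c L ∧ RowsInv n c R ∧ ParseInv n α β T c E L R cl ∧
    (∀ u, u ∉ R (c.node u)) ∧ ∀ u, c.pos u ≠ 0 → c.pos u - 1 ∈ E u

theorem pos_process (n α β T : ℕ) (c : Parser) (u v : ℕ) :
    (c.process n α β T u v).pos = update c.pos u (v + 1) := by
  unfold process; split_ifs <;> rfl

/-- Since `pos u - 1` is a processed column, columns arriving in increasing order satisfy `pos u ≤
v`. Between `restart` and `enter` row `u` may stand at the root and be recorded there; entering `v`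
restores the condition that no row is recorded at its current node. -/
theorem Inv.process {n α β T : ℕ} {c : Parser} {E : ℕ → Finset ℕ} (h : Inv n α β T c E)
    (hα : α ≤ T) {u v : ℕ} (hu : u < n) (hvu : v < u) (hE : ∀ w ∈ E u, w < v) :
    Inv n α β T (c.process n α β T u v) (update E u (insert v (E u))) := by
  obtain ⟨L, R, cl, hL, hR, hP, hf, hpos⟩ := h
  have hv : c.pos u ≤ v := by
    by_cases h0 : c.pos u = 0
    · omega
    · have := hE _ (hpos u h0)
      omega
  have hpos' : ∀ u', (c.process n α β T u v).pos u' ≠ 0 →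
      (c.process n α β T u v).pos u' - 1 ∈ update E u (insert v (E u)) u' := by
    intro u'
    rw [pos_process]
    by_cases hu' : u' = u
    · subst hu'
      simp
    · rw [update_of_ne hu', update_of_ne hu']
      exact hpos u'
  unfold Parser.process at hpos' ⊢
  split_ifs at hpos' ⊢ with hT
  · have hP' := hP.restart hL.root hu hvu hv hT
    have hL' : TrieInv n α β T (c.restart n u v) L :=
      ⟨hL.1, hL.2, hL.3, hL.4, hL.5, hL.6, hL.7, hL.8, hL.9⟩
    have hR' := hR.close hu (hf u)
    have hnode : (c.restart n u v).node u = 0 := by simp [Parser.restart]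
    have hcost : (c.restart n u v).newCost α β u v = α := by simp [Parser.restart, newCost]
    -- The hypothesis `α ≤ T` says that a phrase with a single entry is affordable.
    obtain ⟨L', h1, h2, h3⟩ := hP'.enter hL' hu hvu (by simp [Parser.restart])
      (by rw [hcost]; exact hα)
    rw [hnode, hcost, enter_restart] at h1 h2 h3
    refine ⟨L', _, _, h1, ?_, h2, ?_, hpos'⟩
    · unfold Parser.enter Parser.child
      split_ifs <;> exact ⟨hR'.1, hR'.2, hR'.3, hR'.4⟩
    · intro u'
      by_cases hu' : u' = u
      · subst hu'; exact h3
      · have : ((c.close n u).enter n u v 0 α).node u' = c.node u' := by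
          simp [Parser.enter, hu', Parser.close]
        rw [this, mem_update_append]
        rintro (h4 | ⟨-, h4⟩)
        · exact hf u' h4
        · exact hu' h4
  · obtain ⟨L', h1, h2, h3⟩ := hP.enter hL hu hvu hv (not_lt.1 hT)
    refine ⟨L', R, cl, h1, ?_, h2, ?_, hpos'⟩
    · unfold Parser.enter Parser.child
      split_ifs <;> exact ⟨hR.1, hR.2, hR.3, hR.4⟩
    · intro u'
      by_cases hu' : u' = u
      · subst hu'; exact h3
      · have : (c.enter n u v (c.node u) (c.newCost α β u v)).node u' = c.node u' := by
          simp [Parser.enter, hu']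
        rw [this]
        exact hf u'

theorem Inv.bounds {n α β T : ℕ} {c : Parser} {E : ℕ → Finset ℕ} (h : Inv n α β T c E) :
    (∀ u, c.node u ≤ c.cnt) ∧ (∀ u, c.cost u ≤ T) ∧ (∀ x ≤ c.cnt, c.dep x ≤ n) ∧
      ∀ x, c.rc x ≤ n := by
  obtain ⟨L, R, cl, hL, hR, hP, -⟩ := h
  refine ⟨hP.node_le, hP.cost_le, fun x hx => ?_, fun x => ?_⟩
  · rw [hL.dep_eq x hx]
    exact length_le_of_nodup_lt ((hL.sorted x hx).imp fun hab => Nat.ne_of_gt hab) (hL.lt x hx)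
  · rw [hR.rc_eq]
    exact length_le_of_nodup_lt (hR.nodup x) (hR.lt x)

theorem RowsInv.rc_le {n : ℕ} {c : Parser} {R : ℕ → List ℕ} (h : RowsInv n c R) (x : ℕ) :
    c.rc x ≤ n := by
  rw [h.rc_eq]
  exact length_le_of_nodup_lt (h.nodup x) (h.lt x)

end Parser

/-! ### Closing the last phrases of all rows. -/

namespace Parser

open Function

/-- Close the rows `0, …, k - 1`. -/
def closeAll (n : ℕ) (c : Parser) : ℕ → Parser
  | 0 => c
  | k + 1 => (closeAll n c k).close n k

theorem closeAll_frame (n : ℕ) (c : Parser) (k : ℕ) :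
    (c.closeAll n k).node = c.node ∧ (c.closeAll n k).ch = c.ch ∧
    (c.closeAll n k).par = c.par ∧ (c.closeAll n k).lab = c.lab ∧ (c.closeAll n k).dep = c.dep ∧
    (c.closeAll n k).cnt = c.cnt := by
  induction k with
  | zero => exact ⟨rfl, rfl, rfl, rfl, rfl, rfl⟩
  | succ k ih => exact ih

theorem RowsInv.closeAll {n : ℕ} {c : Parser} {R : ℕ → List ℕ} (h : RowsInv n c R)
    (hR : ∀ u, u ∉ R (c.node u)) {k : ℕ} (hk : k ≤ n) :
    RowsInv n (c.closeAll n k)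
      (fun x => R x ++ (List.range k).filter fun u => c.node u = x) := by
  induction k with
  | zero => simpa [Parser.closeAll] using h
  | succ k ih =>
    have hnode := (closeAll_frame n c k).1
    have := (ih (by omega)).close (u := k) (by omega) (by simp [hnode, hR])
    rw [hnode] at this
    change RowsInv n ((c.closeAll n k).close n k) _
    convert this using 1
    funext x
    by_cases hx : c.node k = x
    · subst hx
      simp [List.range_succ]
    · simp [List.range_succ, hx, update_of_ne (Ne.symm hx)]

/-- Equal paths have equal parents by induction, and equal last labels; so both nodes are stored in
the same cell of the child table. -/
theorem TrieInv.eq_of_path_eq {n α β T : ℕ} {c : Parser} {L : ℕ → List ℕ}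
    (h : TrieInv n α β T c L) {x y : ℕ} (hx : x ≤ c.cnt) (hy : y ≤ c.cnt) (he : L x = L y) :
    x = y := by
  induction x using Nat.strong_induction_on generalizing y with
  | _ x ih =>
    rcases Nat.eq_zero_or_pos x with rfl | hx1 <;> rcases Nat.eq_zero_or_pos y with rfl | hy1
    · rfl
    · rw [h.root, h.path y hy1 hy] at he
      simp at he
    · rw [h.root, h.path x hx1 hx] at he
      simp at he
    · rw [h.path x hx1 hx, h.path y hy1 hy, List.cons.injEq] at he
      have hlx := h.par_lt x hx1 hx
      have hly := h.par_lt y hy1 hy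
      have := ih _ hlx (by omega) (y := c.par y) (by omega) he.2
      rw [← h.ch_par x hx1 hx, ← h.ch_par y hy1 hy, this, he.1]

/-- The trie `c` with paths `L` and rows `R` partitions the entries in columns `E u` of the rows
`u`; row `u` is used `cl u + 1` times, counting uses of the root. -/
structure Finished (n α β T : ℕ) (c : Parser) (E : ℕ → Finset ℕ) (L R : ℕ → List ℕ)
    (cl : ℕ → ℕ) : Prop where
  trie : TrieInv n α β T c L
  rows : RowsInv n c R
  cover : ∀ u < n, ∀ v, v ∈ E u ↔ ∃ x, u ∈ R x ∧ v ∈ L x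
  unique : ∀ u < n, ∀ v x y, u ∈ R x → v ∈ L x → u ∈ R y → v ∈ L y → x = y
  mem_le : ∀ x, ∀ u ∈ R x, x ≤ c.cnt
  charge : ∀ u < n, cl u * (T - α) ≤ α * (E u).card + β * (u - (E u).card)
  sum_length : ∑ x ∈ Finset.range (c.cnt + 1), (R x).length = ∑ u ∈ Finset.range n, (cl u + 1)

theorem sum_length_filter_range {f : ℕ → ℕ} {m : ℕ} (hf : ∀ u, f u ≤ m) (k : ℕ) :
    ∑ x ∈ Finset.range (m + 1), ((List.range k).filter fun u => f u = x).length = k := by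
  induction k with
  | zero => simp
  | succ k ih =>
    have : ∀ x, ((List.range (k + 1)).filter fun u => f u = x).length =
        ((List.range k).filter fun u => f u = x).length + if f k = x then 1 else 0 := by
      intro x
      by_cases hx : f k = x <;> simp [List.range_succ, hx]
    have hk : f k < m + 1 := Nat.lt_succ_of_le (hf k)
    simp only [this, Finset.sum_add_distrib, ih, Finset.sum_ite_eq, Finset.mem_range, hk, if_true]

/-- Every row is recorded once more, at its current node, whence `cl u + 1`. The charged gaps lie
left of the diagonal because `pos u ≤ u`. -/
theorem Inv.finished {n α β T : ℕ} {c : Parser} {E : ℕ → Finset ℕ} (h : Inv n α β T c E) :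
    ∃ L R cl, Finished n α β T (c.closeAll n n) E L R cl := by
  obtain ⟨L, R, cl, hL, hR, hP, hf, -⟩ := h
  obtain ⟨h1, h2, h3, h4, h5, h6⟩ := closeAll_frame n c n
  have hmem : ∀ u < n, ∀ x, (u ∈ R x ++ (List.range n).filter fun u => c.node u = x) ↔
      (u ∈ R x ∨ c.node u = x) := by
    intro u hu x
    simp [hu]
  refine ⟨L, fun x => R x ++ (List.range n).filter fun u => c.node u = x, cl, ?_,
    hR.closeAll hf le_rfl, ?_, ?_, ?_, ?_, ?_⟩
  · obtain ⟨g1, g2, g3, g4, g5, g6, g7, g8, g9⟩ := hL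
    constructor <;> simpa only [h2, h3, h4, h5, h6]
  · intro u hu v
    simp only [hmem u hu]
    exact hP.cover u v
  · intro u hu v x y hx hvx hy hvy
    exact hP.unique u v x y ((hmem u hu x).1 hx) hvx ((hmem u hu y).1 hy) hvy
  · intro x u hu
    rw [h6]
    rcases List.mem_append.1 hu with hu | hu
    · exact hP.mem_le x u hu
    · obtain ⟨-, hu⟩ := List.mem_filter.1 hu
      rw [← of_decide_eq_true hu]
      exact hP.node_le u
  · intro u hu
    obtain ⟨Z, hZ, hc⟩ := hP.charge u
    have h7 : β * Z ≤ β * (u - (E u).card) := Nat.mul_le_mul_left _ (by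
      have := hP.pos_le u
      omega)
    omega
  · rw [h6]
    simp only [List.length_append, Finset.sum_add_distrib, hP.sum_length,
      sum_length_filter_range hP.node_le]
    simp

theorem Inv.rc_closeAll_le {n α β T : ℕ} {c : Parser} {E : ℕ → Finset ℕ}
    (h : Inv n α β T c E) {k : ℕ} (hk : k ≤ n) (x : ℕ) : (c.closeAll n k).rc x ≤ n := by
  obtain ⟨L, R, cl, hL, hR, hP, hf, -⟩ := h
  exact (hR.closeAll hf hk).rc_le x

/-- The initial data. -/
def init : Parser := ⟨fun _ => 0, fun _ => 0, fun _ => 0, fun _ => 0, fun _ => 0, fun _ => 0,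
  fun _ => 0, fun _ => 0, fun _ => 0, 0⟩

theorem inv_init (n α β T : ℕ) : Inv n α β T init fun _ => ∅ := by
  refine ⟨fun _ => [], fun _ => [], fun _ => 0, ⟨rfl, ?_, ?_, ?_, ?_, ?_, ?_, ?_, ?_⟩,
    ⟨?_, ?_, ?_, ?_⟩, ⟨?_, ?_, ?_, ?_, ?_, ?_, ?_, ?_, ?_, ?_, ?_⟩, ?_, ?_⟩ <;>
  simp [init] <;> omega

end Parser

/-! ### Lists of vertices, and Kraft counting of phrases. -/

/-- The elements of `l` that are smaller than `n`. -/
def listToFin (n : ℕ) (l : List ℕ) : List (Fin n) :=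
  l.filterMap fun v => if h : v < n then some ⟨v, h⟩ else none

theorem mem_listToFin {n : ℕ} {l : List ℕ} {i : Fin n} : i ∈ listToFin n l ↔ i.val ∈ l := by
  simp only [listToFin, List.mem_filterMap]
  constructor
  · rintro ⟨a, ha, h⟩
    split_ifs at h with h'
    simp only [Option.some.injEq] at h
    subst h
    exact ha
  · intro h
    exact ⟨i, h, by simp⟩

theorem map_val_listToFin {n : ℕ} {l : List ℕ} (hl : ∀ v ∈ l, v < n) :
    (listToFin n l).map Fin.val = l := by
  induction l with
  | nil => rfl
  | cons a l ih =>
    have ha : a < n := hl a (by simp)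
    have := ih fun v hv => hl v (by simp [hv])
    simp only [listToFin, List.filterMap_cons, ha, dif_pos, List.map_cons, List.cons.injEq,
      true_and] at this ⊢
    exact this

theorem length_listToFin {n : ℕ} {l : List ℕ} (hl : ∀ v ∈ l, v < n) :
    (listToFin n l).length = l.length := by
  conv_rhs => rw [← map_val_listToFin hl, List.length_map]

theorem nodup_listToFin {n : ℕ} {l : List ℕ} (hl : ∀ v ∈ l, v < n) (h : l.Nodup) :
    (listToFin n l).Nodup :=
  List.Nodup.of_map Fin.val (by rwa [map_val_listToFin hl])

/-- If `x ^ i * y ^ z` with `x + y = 1` is bounded below on the sets of a family, where `i` counts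
the elements and `z` the gaps in a short interval, then the family is small. -/
theorem card_le_of_kraft {n D : ℕ} {M x y : ℝ} (hM : 0 ≤ M) (hx : 0 ≤ x) (hy : 0 ≤ y)
    (hxy : x + y = 1) (s : Finset (Finset ℕ))
    (hs : ∀ S ∈ s, ∃ a < n, ∃ l, 1 ≤ l ∧ l ≤ D ∧ S ⊆ Finset.Ico a (a + l) ∧
      1 ≤ M * (x ^ S.card * y ^ (l - S.card))) :
    (s.card : ℝ) ≤ n * D * M := by
  classical
  let B : ℕ × ℕ → Finset (Finset ℕ) := fun p =>
    (Finset.Ico p.1 (p.1 + p.2)).powerset.filter fun S =>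
      1 ≤ M * (x ^ S.card * y ^ (p.2 - S.card))
  have hB : ∀ p, ((B p).card : ℝ) ≤ M := by
    intro p
    calc ((B p).card : ℝ) = ∑ S ∈ B p, (1 : ℝ) := by simp
      _ ≤ ∑ S ∈ B p, M * (x ^ S.card * y ^ (p.2 - S.card)) :=
          Finset.sum_le_sum fun S hS => (Finset.mem_filter.1 hS).2
      _ ≤ ∑ S ∈ (Finset.Ico p.1 (p.1 + p.2)).powerset, M * (x ^ S.card * y ^ (p.2 - S.card)) :=
          Finset.sum_le_sum_of_subset_of_nonneg (Finset.filter_subset _ _)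
            fun S _ _ => by positivity
      -- The sum is the law of a random subset of the interval with independent elements, so its
      -- total mass is `(x + y) ^ l = 1`.
      _ = M * (x + y) ^ (Finset.Ico p.1 (p.1 + p.2)).card := by
          rw [← Finset.mul_sum, ← Finset.sum_pow_mul_eq_add_pow]
          simp
      _ = M := by rw [hxy, one_pow, mul_one]
  have hsub : s ⊆ (Finset.range n ×ˢ Finset.Icc 1 D).biUnion B := by
    intro S hS
    obtain ⟨a, ha, l, hl1, hl, hSl, h⟩ := hs S hS
    exact Finset.mem_biUnion.2 ⟨(a, l), by simp [ha, hl1, hl],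
      Finset.mem_filter.2 ⟨Finset.mem_powerset.2 hSl, h⟩⟩
  calc (s.card : ℝ) ≤ ((Finset.range n ×ˢ Finset.Icc 1 D).biUnion B).card := by
        exact_mod_cast Finset.card_le_card hsub
    _ ≤ ∑ p ∈ Finset.range n ×ˢ Finset.Icc 1 D, ((B p).card : ℝ) := by
        exact_mod_cast Finset.card_biUnion_le
    _ ≤ ∑ p ∈ Finset.range n ×ˢ Finset.Icc 1 D, M := Finset.sum_le_sum fun p _ => hB p
    _ = n * D * M := by simp

/-! ### The biclique partition given by the trie, and its weight. -/

namespace Parser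

theorem Finished.nodup_path {n α β T : ℕ} {c : Parser} {E : ℕ → Finset ℕ} {L R : ℕ → List ℕ}
    {cl : ℕ → ℕ} (h : Finished n α β T c E L R cl) {x : ℕ} (hx : x ≤ c.cnt) : (L x).Nodup :=
  (h.trie.sorted x hx).imp fun hab => Nat.ne_of_gt hab

/-- Different nodes have different label sets, since a descending list is determined by its set. So
the Kraft bound counts the nodes other than the root. -/
theorem TrieInv.cnt_le {n α β T D : ℕ} {c : Parser} {L : ℕ → List ℕ} (h : TrieInv n α β T c L)
    {M x y : ℝ} (hM0 : 0 ≤ M) (hx : 0 ≤ x) (hy : 0 ≤ y) (hxy : x + y = 1)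
    (hM : ∀ i z : ℕ, α * i + β * z ≤ T → 1 ≤ M * (x ^ i * y ^ z))
    (hD : ∀ i z : ℕ, α * i + β * z ≤ T → i + z ≤ D) :
    (c.cnt : ℝ) ≤ n * D * M := by
  have hinj : Set.InjOn (fun x => (L x).toFinset) (Finset.Icc 1 c.cnt : Finset ℕ) := by
    intro a ha b hb hab
    simp only [Finset.coe_Icc, Set.mem_Icc] at ha hb
    refine h.eq_of_path_eq ha.2 hb.2 ?_
    have hnd : ∀ x ≤ c.cnt, (L x).Nodup := fun x hx =>
      (h.sorted x hx).imp fun hab => Nat.ne_of_gt hab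
    exact ((List.toFinset_eq_iff_perm_dedup.1 hab).trans
      (by rw [(hnd b hb.2).dedup]) |> fun hp => by
        rw [(hnd a ha.2).dedup] at hp
        exact hp.eq_of_pairwise (fun a b _ _ h1 h2 => absurd h1 (Nat.lt_asymm h2))
          (h.sorted a ha.2) (h.sorted b hb.2))
  have := card_le_of_kraft (n := n) (D := D) (M := M) hM0 hx hy hxy
    ((Finset.Icc 1 c.cnt).image fun x => (L x).toFinset) ?_
  · rwa [Finset.card_image_of_injOn hinj, Nat.card_Icc, Nat.add_sub_cancel] at this
  · intro S hS
    obtain ⟨k, hk, rfl⟩ := Finset.mem_image.1 hS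
    obtain ⟨hk1, hk⟩ := Finset.mem_Icc.1 hk
    obtain ⟨a, z, haz, hc⟩ := h.cheap k hk1 hk
    have hnd : (L k).Nodup := (h.sorted k hk).imp fun hab => Nat.ne_of_gt hab
    have hmem : c.lab k ∈ L k := by rw [h.path k hk1 hk]; simp
    have hpos := List.length_pos_of_mem hmem
    refine ⟨a, (haz _ hmem).1.trans_lt (h.lt k hk _ hmem), (L k).length + z, by omega,
      hD _ _ hc, ?_, ?_⟩
    · intro v hv
      have := haz v (by simpa using hv)
      simp only [Finset.mem_Ico]
      omega
    · rw [List.toFinset_card_of_nodup hnd, Nat.add_sub_cancel_left]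
      exact hM _ _ hc

/-- The nodes that are used by some row. -/
def used (c : Parser) : List ℕ := (List.range' 1 c.cnt).filter fun x => c.rc x ≠ 0

theorem mem_used {c : Parser} {x : ℕ} : x ∈ c.used ↔ (1 ≤ x ∧ x ≤ c.cnt) ∧ c.rc x ≠ 0 := by
  simp [used, List.mem_range'_1]
  omega

/-- The family of bicliques found by the parser. -/
def bicliques (n : ℕ) (c : Parser) (L R : ℕ → List ℕ) : List (List (Fin n) × List (Fin n)) :=
  c.used.map fun x => (listToFin n (L x), listToFin n (R x))

variable {n α β T : ℕ} {c : Parser} {E : ℕ → Finset ℕ} {L R : ℕ → List ℕ} {cl : ℕ → ℕ}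

theorem Finished.nodup_bicliques (h : Finished n α β T c E L R cl) :
    ∀ b ∈ bicliques n c L R, b.1.Nodup ∧ b.2.Nodup := by
  intro b hb
  obtain ⟨x, hx, rfl⟩ := List.mem_map.1 hb
  have hx := (mem_used.1 hx).1.2
  exact ⟨nodup_listToFin (h.trie.lt x hx) (h.nodup_path hx),
    nodup_listToFin (h.rows.lt x) (h.rows.nodup x)⟩

theorem Finished.encode_bicliques (h : Finished n α β T c E L R cl) :
    encodeBicliques (bicliques n c L R) =
      c.used.flatMap fun x => c.dep x :: c.rc x :: (L x ++ R x) := by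
  rw [encodeBicliques, bicliques, List.flatMap_map]
  refine List.flatMap_congr fun x hx => ?_
  have hx := (mem_used.1 hx).1.2
  simp only [List.map_append, map_val_listToFin (h.trie.lt x hx), map_val_listToFin (h.rows.lt x),
    length_listToFin (h.trie.lt x hx), length_listToFin (h.rows.lt x), h.trie.dep_eq x hx,
    h.rows.rc_eq]

/-- Only entries below the diagonal are parsed, so each row of `R x` exceeds each label of `L x`.
This makes the sides disjoint and lets an edge be covered in one orientation only; `cover` and
`unique` then give exactly one node. The root is excluded since its path is empty. -/
theorem Finished.isBicliquePartition (h : Finished n α β T c E L R cl)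
    {G : SimpleGraph (Fin n)} (hE : ∀ u v : Fin n, v.val ∈ E u ↔ v < u ∧ G.Adj u v) :
    IsBicliquePartition G
      ((bicliques n c L R).map fun b => (b.1.toFinset, b.2.toFinset)) := by
  have hadj : ∀ x, ∀ u v : Fin n, u.val ∈ R x → v.val ∈ L x → v < u ∧ G.Adj u v :=
    fun x u v hu hv => (hE u v).1 ((h.cover u u.2 v).2 ⟨x, hu, hv⟩)
  have hnd : c.used.Nodup := List.Nodup.filter _ List.nodup_range'
  rw [bicliques, List.map_map]
  constructor
  · intro B hB
    obtain ⟨x, hx, rfl⟩ := List.mem_map.1 hB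
    obtain ⟨⟨hx1, hx⟩, hr⟩ := mem_used.1 hx
    refine ⟨?_, ?_, ?_, ?_⟩
    · have : c.lab x ∈ L x := by rw [h.trie.path x hx1 hx]; simp
      exact ⟨⟨_, h.trie.lt x hx _ this⟩, by simpa [mem_listToFin] using this⟩
    · rw [h.rows.rc_eq, Ne, List.length_eq_zero_iff] at hr
      obtain ⟨u, hu⟩ := List.exists_mem_of_ne_nil _ hr
      exact ⟨⟨u, h.rows.lt x u hu⟩, by simpa [mem_listToFin] using hu⟩
    · rw [Finset.disjoint_left]
      intro u hu hu'
      simp only [Function.comp, List.mem_toFinset, mem_listToFin] at hu hu'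
      exact lt_irrefl _ (hadj x u u hu' hu).1
    · intro v hv u hu
      simp only [Function.comp, List.mem_toFinset, mem_listToFin] at hu hv
      exact (hadj x u v hu hv).2.symm
  · have key : ∀ u v : Fin n, v < u → G.Adj u v →
        ∃! i : Fin (c.used.map ((fun b : List (Fin n) × List (Fin n) =>
          (b.1.toFinset, b.2.toFinset)) ∘
            fun x => (listToFin n (L x), listToFin n (R x)))).length,
          BicliqueCovers ((c.used.map ((fun b : List (Fin n) × List (Fin n) =>
          (b.1.toFinset, b.2.toFinset)) ∘
            fun x => (listToFin n (L x), listToFin n (R x)))).get i) u v := by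
      intro u v hvu huv
      obtain ⟨x, hux, hvx⟩ := (h.cover u u.2 v).1 ((hE u v).2 ⟨hvu, huv⟩)
      have hcov : ∀ y, BicliqueCovers
          ((listToFin n (L y)).toFinset, (listToFin n (R y)).toFinset) u v ↔ y = x := by
        intro y
        simp only [BicliqueCovers, List.mem_toFinset, mem_listToFin]
        constructor
        · rintro (⟨h1, h2⟩ | ⟨h1, h2⟩)
          · exact absurd (hadj y v u h2 h1).1 (lt_asymm hvu)
          · exact h.unique u u.2 v y x h2 h1 hux hvx
        · rintro rfl
          exact Or.inr ⟨hvx, hux⟩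
      have hxu : x ∈ c.used := by
        rw [mem_used, h.rows.rc_eq, Ne, List.length_eq_zero_iff]
        refine ⟨⟨Nat.one_le_iff_ne_zero.2 ?_, h.mem_le x _ hux⟩, List.ne_nil_of_mem hux⟩
        rintro rfl
        simp [h.trie.root] at hvx
      obtain ⟨i, hi⟩ := List.mem_iff_get.1 hxu
      refine ⟨⟨i, by simp⟩, ?_, ?_⟩
      · simp only [List.get_eq_getElem, List.getElem_map, Function.comp]
        rw [hcov]
        simpa using hi
      · rintro ⟨j, hj⟩ hcj
        simp only [List.get_eq_getElem, List.getElem_map, Function.comp] at hcj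
        rw [hcov] at hcj
        ext
        refine (hnd.getElem_inj_iff (hi := by simpa using hj) (hj := i.2)).1 ?_
        rw [hcj]
        exact hi.symm
    intro u v huv
    rcases lt_trichotomy u v with hlt | heq | hlt
    · obtain ⟨i, hi, hu⟩ := key v u hlt huv.symm
      have hsymm : ∀ B : Finset (Fin n) × Finset (Fin n),
          BicliqueCovers B u v ↔ BicliqueCovers B v u := fun B => or_comm
      simp only [hsymm]
      exact ⟨i, hi, hu⟩
    · exact absurd heq huv.ne
    · exact key u v hlt huv

theorem Finished.bicliqueWeight_eq (h : Finished n α β T c E L R cl) :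
    bicliqueWeight ((bicliques n c L R).map fun b => (b.1.toFinset, b.2.toFinset)) =
      (c.used.map fun x => c.dep x + c.rc x).sum := by
  rw [bicliqueWeight, bicliques, List.map_map, List.map_map]
  congr 1
  refine List.map_congr_left fun x hx => ?_
  have hx := (mem_used.1 hx).1.2
  simp only [Function.comp]
  rw [List.toFinset_card_of_nodup (nodup_listToFin (h.trie.lt x hx) (h.nodup_path hx)),
    List.toFinset_card_of_nodup (nodup_listToFin (h.rows.lt x) (h.rows.nodup x)),
    length_listToFin (h.trie.lt x hx), length_listToFin (h.rows.lt x), h.trie.dep_eq x hx,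
    h.rows.rc_eq]

/-- At most `cnt` paths of length at most `D` form the first sides. The second sides together are
bounded by the number of closings: `cl u` during the scan and one at the end for each row. -/
theorem Finished.weight_le (h : Finished n α β T c E L R cl) {D : ℕ}
    (hD : ∀ i z : ℕ, α * i + β * z ≤ T → i + z ≤ D) :
    (c.used.map fun x => c.dep x + c.rc x).sum ≤
      c.cnt * D + ∑ u ∈ Finset.range n, cl u + n := by
  have h1 : (c.used.map fun x => c.dep x + c.rc x).sum ≤
      ((List.range' 1 c.cnt).map fun x => D + c.rc x).sum := by
    refine le_trans (b := (c.used.map fun x => D + c.rc x).sum) ?_ ?_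
    · refine List.sum_le_sum fun x hx => ?_
      obtain ⟨hx1, hx⟩ := (mem_used.1 hx).1
      obtain ⟨a, z, -, hc⟩ := h.trie.cheap x hx1 hx
      have := hD _ _ hc
      rw [h.trie.dep_eq x hx]
      omega
    · exact List.Sublist.sum_le_sum (List.Sublist.map _ List.filter_sublist) (by simp)
  refine h1.trans ?_
  have h2 : ∑ x ∈ Finset.range (c.cnt + 1), c.rc x = ∑ u ∈ Finset.range n, (cl u + 1) := by
    rw [← h.sum_length]
    exact Finset.sum_congr rfl fun x _ => h.rows.rc_eq x
  have h3 : ((List.range' 1 c.cnt).map c.rc).sum ≤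
      ∑ x ∈ Finset.range (c.cnt + 1), c.rc x := by
    rw [← List.sum_toFinset _ List.nodup_range']
    refine Finset.sum_le_sum_of_subset fun x hx => ?_
    simp only [List.mem_toFinset, List.mem_range'_1, Finset.mem_range] at hx ⊢
    omega
  rw [List.sum_map_add]
  simp only [Finset.sum_add_distrib, Finset.sum_const, Finset.card_range, smul_eq_mul,
    mul_one] at h2
  simp only [List.map_const', List.length_range', List.sum_replicate, smul_eq_mul]
  omega

/-- Summation over the rows: the triangle below the diagonal has `n.choose 2` cells, of which `m`
are entries and the rest gaps. -/
theorem Finished.charge_sum (h : Finished n α β T c E L R cl) (hE : ∀ u, (E u).card ≤ u) {m : ℕ}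
    (hm : ∑ u ∈ Finset.range n, (E u).card = m) :
    (∑ u ∈ Finset.range n, cl u) * (T - α) ≤ α * m + β * (n.choose 2 - m) := by
  have h1 : ∑ u ∈ Finset.range n, (u - (E u).card) = n.choose 2 - m := by
    rw [Nat.choose_two_right, ← Finset.sum_range_id, ← hm, eq_tsub_iff_add_eq_of_le,
      ← Finset.sum_add_distrib]
    · exact Finset.sum_congr rfl fun u _ => Nat.sub_add_cancel (hE u)
    · exact Finset.sum_le_sum fun u _ => hE u
  rw [Finset.sum_mul, ← h1, ← hm, Finset.mul_sum, Finset.mul_sum, ← Finset.sum_add_distrib]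
  exact Finset.sum_le_sum fun u hu => h.charge u (Finset.mem_range.1 hu)

end Parser

namespace WordRAM

open Function

/-! ### The program

Registers: `0` number of vertices `n`; `1` length of the adjacency list; `2`, `3` the integers
`p ≈ γ n` and `q = n - p`; `4` the scale `K = n ^ 2`; `5` loop counter; `6`, `7` the costs `α`, `β`
of an entry and of a gap; `8` an upper bound on `log n`; `9`, `10` the numbers `M` and
`T ≈ K * log M`; `11` the current vertex `v`; `12` the position in the adjacency list; `13` the row
`u`; `14` the new cost; `15` a trie node; `16` a key; `17` the number of trie nodes.
Arrays: `0`, `1` the input; `2`, …, `10` the data of the parser. -/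

/-- Set up the parameters `p`, `q`, `K`. -/
def setupCmd : Cmd :=
  .seq (.set 1 (.read 0 (.reg 0))) <|
  .seq (.set 2 (.bin .div (.reg 1) (.bin .sub (.reg 0) (.const 1)))) <|
  .seq (.set 3 (.bin .sub (.reg 0) (.reg 2))) <|
  .seq (.set 4 (.bin .mul (.reg 0) (.reg 0)))
    (.set 5 (.const 1))

/-- One step of the computation of the costs. -/
def costStep : Cmd :=
  .seq (.set 6 (.bin .add (.reg 6) (.bin .mul (.bin .sub (.const 1) (.bin .lt (.reg 5) (.reg 2)))
    (.bin .add (.bin .div (.reg 4) (.reg 5)) (.const 1))))) <|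
  .seq (.set 7 (.bin .add (.reg 7) (.bin .mul (.bin .sub (.const 1) (.bin .lt (.reg 5) (.reg 3)))
    (.bin .add (.bin .div (.reg 4) (.reg 5)) (.const 1))))) <|
  .seq (.set 8 (.bin .add (.reg 8) (.bin .div (.reg 4) (.reg 5))))
    (.set 5 (.bin .add (.reg 5) (.const 1)))

/-- Compute `M`. -/
def boundCmd : Cmd :=
  .seq (.set 8 (.bin .add (.bin .div (.reg 8) (.reg 4)) (.const 2))) <|
  .seq (.set 9 (.bin .mul (.reg 2) (.reg 3))) <|
  .seq (.set 9 (.bin .div (.bin .mul (.bin .mul (.reg 9) (.reg 9)) (.reg 9))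
    (.bin .mul (.bin .mul (.reg 0) (.bin .mul (.reg 4) (.reg 4)))
      (.bin .mul (.bin .mul (.reg 8) (.reg 8)) (.bin .mul (.reg 8) (.reg 8))))))
    (.set 5 (.const 2))

/-- One step of the computation of `T`. -/
def thresholdStep : Cmd :=
  .seq (.set 10 (.bin .add (.reg 10) (.bin .div (.reg 4) (.reg 5))))
    (.set 5 (.bin .add (.reg 5) (.const 1)))

/-- Record that row `u` uses its current node. -/
def closeCmd : Cmd :=
  .seq (.set 15 (.read 4 (.reg 13))) <|
  .seq (.write 10 (.bin .add (.bin .mul (.reg 15) (.reg 0)) (.read 9 (.reg 15))) (.reg 13))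
    (.write 9 (.reg 15) (.bin .add (.read 9 (.reg 15)) (.const 1)))

/-- Make sure that the node `x` has a child with label `v`. -/
def childCmd : Cmd :=
  .seq (.set 16 (.bin .add (.bin .mul (.reg 15) (.reg 0)) (.reg 11))) <|
  .cond (.read 5 (.reg 16)) .skip <|
  .seq (.set 17 (.bin .add (.reg 17) (.const 1))) <|
  .seq (.write 5 (.reg 16) (.reg 17)) <|
  .seq (.write 6 (.reg 17) (.reg 15)) <|
  .seq (.write 7 (.reg 17) (.reg 11))
    (.write 8 (.reg 17) (.bin .add (.read 8 (.reg 15)) (.const 1)))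

/-- Move row `u` to the child with label `v` of the node `x`. -/
def enterCmd : Cmd :=
  .seq childCmd <|
  .seq (.write 4 (.reg 13) (.read 5 (.reg 16))) <|
  .seq (.write 2 (.reg 13) (.reg 14))
    (.write 3 (.reg 13) (.bin .add (.reg 11) (.const 1)))

/-- Process the entry in row `u` and column `v`. -/
def processCmd : Cmd :=
  .seq (.set 14 (.bin .add (.bin .add (.read 2 (.reg 13))
    (.bin .mul (.reg 7) (.bin .sub (.reg 11) (.read 3 (.reg 13))))) (.reg 6))) <|
  .seq (.cond (.bin .lt (.reg 10) (.reg 14))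
      (.seq closeCmd (.seq (.set 14 (.reg 6)) (.set 15 (.const 0))))
      (.set 15 (.read 4 (.reg 13))))
    enterCmd

/-- One step of the scan of the adjacency list. -/
def scanStep : Cmd :=
  .cond (.bin .lt (.reg 12) (.read 0 (.bin .add (.reg 11) (.const 1))))
    (.seq (.set 13 (.read 1 (.reg 12))) <|
      .seq (.set 12 (.bin .add (.reg 12) (.const 1)))
        (.cond (.bin .lt (.reg 11) (.reg 13)) processCmd .skip))
    (.set 11 (.bin .add (.reg 11) (.const 1)))

/-- One step of the final closing of all rows. -/
def closeStep : Cmd := .seq closeCmd (.set 13 (.bin .add (.reg 13) (.const 1)))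

/-- Output the biclique of the node in register `15`, if it is used. -/
def outputStep : Cmd :=
  .seq (.cond (.read 9 (.reg 15))
    (.seq (.emit (.read 8 (.reg 15))) <|
      .seq (.emit (.read 9 (.reg 15))) <|
      .seq (.set 16 (.reg 15)) <|
      .seq (.loop (.reg 16) (.seq (.emit (.read 7 (.reg 16))) (.set 16 (.read 6 (.reg 16))))) <|
      .seq (.set 5 (.const 0))
        (.loop (.bin .lt (.reg 5) (.read 9 (.reg 15)))
          (.seq (.emit (.read 10 (.bin .add (.bin .mul (.reg 15) (.reg 0)) (.reg 5))))
            (.set 5 (.bin .add (.reg 5) (.const 1))))))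
    .skip)
    (.set 15 (.bin .add (.reg 15) (.const 1)))

/-- The preparation of the parameters. -/
def prepareCmd : Cmd :=
  .seq setupCmd <| .seq (.loop (.bin .lt (.reg 5) (.reg 0)) costStep) <|
  .seq boundCmd (.loop (.bin .lt (.reg 5) (.bin .add (.reg 9) (.const 1))) thresholdStep)

/-- Parsing. -/
def parseCmd : Cmd :=
  .seq (.loop (.bin .lt (.reg 11) (.reg 0)) scanStep) <|
  .seq (.set 13 (.const 0)) (.loop (.bin .lt (.reg 13) (.reg 0)) closeStep)

/-- Output of all bicliques. -/
def outputCmd : Cmd :=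
  .seq (.set 15 (.const 1))
    (.loop (.bin .lt (.reg 15) (.bin .add (.reg 17) (.const 1))) outputStep)

/-- The whole program. -/
def bicliqueCmd : Cmd := .seq prepareCmd (.seq parseCmd outputCmd)

/-- The parser stored in a state. -/
def State.parser (s : State) : Parser :=
  ⟨s.arr 2, s.arr 3, s.arr 4, s.arr 5, s.arr 6, s.arr 7, s.arr 8, s.arr 9, s.arr 10, s.reg 17⟩

/-- The states agree on the registers below `r`, on the input and on the output. -/
def SameBelow (r : ℕ) (s s' : State) : Prop :=
  (∀ i < r, s'.reg i = s.reg i) ∧ s'.arr 0 = s.arr 0 ∧ s'.arr 1 = s.arr 1 ∧ s'.out = s.out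

theorem SameBelow.trans {r : ℕ} {s s' s'' : State} (h : SameBelow r s s')
    (h' : SameBelow r s' s'') : SameBelow r s s'' :=
  ⟨fun i hi => (h'.1 i hi).trans (h.1 i hi), h'.2.1.trans h.2.1, h'.2.2.1.trans h.2.2.1,
    h'.2.2.2.trans h.2.2.2⟩

theorem SameBelow.mono {r r' : ℕ} {s s' : State} (h : SameBelow r s s') (hr : r' ≤ r) :
    SameBelow r' s s' := ⟨fun i hi => h.1 i (hi.trans_le hr), h.2⟩

/-- The hypotheses exclude overflow, so that the words stored by the machine agree with the numbers
of the parser; the same holds for the next three commands. -/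
theorem run_closeCmd {w : ℕ} {s : State}
    (h1 : s.arr 4 (s.reg 13) * s.reg 0 + s.arr 9 (s.arr 4 (s.reg 13)) < 2 ^ w)
    (h2 : s.arr 9 (s.arr 4 (s.reg 13)) + 1 < 2 ^ w) :
    (closeCmd.run w s).parser = s.parser.close (s.reg 0) (s.reg 13) ∧
      SameBelow 15 s (closeCmd.run w s) := by
  have h3 : 1 < 2 ^ w := by omega
  constructor
  · simp [closeCmd, Cmd.run, Expr.eval, BinOp.apply, State.parser, Parser.close,
      Nat.mod_eq_of_lt h1, Nat.mod_eq_of_lt h2]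
  · refine ⟨fun i hi => ?_, ?_, ?_, ?_⟩ <;> simp [closeCmd, Cmd.run]
    rw [update_of_ne (by omega)]

theorem run_childCmd {w : ℕ} {s : State}
    (h1 : s.reg 15 * s.reg 0 + s.reg 11 < 2 ^ w) (h2 : s.reg 17 + 1 < 2 ^ w)
    (h3 : s.arr 8 (s.reg 15) + 1 < 2 ^ w) :
    (childCmd.run w s).parser = s.parser.child (s.reg 0) (s.reg 15) (s.reg 11) ∧
      (childCmd.run w s).reg 16 = s.reg 15 * s.reg 0 + s.reg 11 ∧
      SameBelow 16 s (childCmd.run w s) := by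
  by_cases hc : s.arr 5 (s.reg 15 * s.reg 0 + s.reg 11) = 0
  · refine ⟨?_, ?_, fun i hi => ?_, ?_, ?_, ?_⟩ <;>
    simp [childCmd, Cmd.run, Expr.eval, BinOp.apply, State.parser, Parser.child,
      Nat.mod_eq_of_lt h1, Nat.mod_eq_of_lt h2, Nat.mod_eq_of_lt h3, hc]
    rw [update_of_ne (by omega), update_of_ne (by omega)]
  · refine ⟨?_, ?_, fun i hi => ?_, ?_, ?_, ?_⟩ <;>
    simp [childCmd, Cmd.run, Expr.eval, BinOp.apply, State.parser, Parser.child,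
      Nat.mod_eq_of_lt h1, hc]
    rw [update_of_ne (by omega)]

theorem run_enterCmd {w : ℕ} {s : State}
    (h1 : s.reg 15 * s.reg 0 + s.reg 11 < 2 ^ w) (h2 : s.reg 17 + 1 < 2 ^ w)
    (h3 : s.arr 8 (s.reg 15) + 1 < 2 ^ w) (h4 : s.reg 11 + 1 < 2 ^ w) :
    (enterCmd.run w s).parser =
        s.parser.enter (s.reg 0) (s.reg 13) (s.reg 11) (s.reg 15) (s.reg 14) ∧
      SameBelow 16 s (enterCmd.run w s) := by
  obtain ⟨g1, g2, g3⟩ := run_childCmd h1 h2 h3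
  set s' := childCmd.run w s with hs'
  have g0 : s'.reg 0 = s.reg 0 := g3.1 0 (by norm_num)
  have g11 : s'.reg 11 = s.reg 11 := g3.1 11 (by norm_num)
  have g13 : s'.reg 13 = s.reg 13 := g3.1 13 (by norm_num)
  have g14 : s'.reg 14 = s.reg 14 := g3.1 14 (by norm_num)
  have e : enterCmd.run w s = (Cmd.seq (.write 4 (.reg 13) (.read 5 (.reg 16))) <|
    .seq (.write 2 (.reg 13) (.reg 14))
      (.write 3 (.reg 13) (.bin .add (.reg 11) (.const 1)))).run w s' := rfl
  rw [e]
  constructor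
  · have c2 : s'.arr 2 = s.arr 2 := by
      have := congrArg Parser.cost g1
      unfold Parser.child at this
      split_ifs at this <;> exact this
    have c3 : s'.arr 3 = s.arr 3 := by
      have := congrArg Parser.pos g1
      unfold Parser.child at this
      split_ifs at this <;> exact this
    have c4 : s'.arr 4 = s.arr 4 := by
      have := congrArg Parser.node g1
      unfold Parser.child at this
      split_ifs at this <;> exact this
    unfold Parser.enter
    rw [← g1]
    simp [Cmd.run, Expr.eval, BinOp.apply, State.parser, g2, g11, g13, g14, c2, c3, c4,
      Nat.mod_eq_of_lt h4]
  · refine g3.trans ⟨fun i hi => ?_, ?_, ?_, ?_⟩ <;> simp [Cmd.run]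

theorem run_processCmd {w : ℕ} {s : State}
    (h1 : ∀ x, (x = 0 ∨ x = s.arr 4 (s.reg 13)) → x * s.reg 0 + s.reg 11 < 2 ^ w ∧
      s.arr 8 x + 1 < 2 ^ w)
    (h2 : s.reg 17 + 1 < 2 ^ w) (h4 : s.reg 11 + 1 < 2 ^ w)
    (h5 : s.arr 4 (s.reg 13) * s.reg 0 + s.arr 9 (s.arr 4 (s.reg 13)) < 2 ^ w)
    (h6 : s.arr 9 (s.arr 4 (s.reg 13)) + 1 < 2 ^ w)
    (h7 : s.parser.newCost (s.reg 6) (s.reg 7) (s.reg 13) (s.reg 11) < 2 ^ w) :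
    (processCmd.run w s).parser = s.parser.process (s.reg 0) (s.reg 6) (s.reg 7) (s.reg 10)
        (s.reg 13) (s.reg 11) ∧
      SameBelow 14 s (processCmd.run w s) := by
  set t := s.parser.newCost (s.reg 6) (s.reg 7) (s.reg 13) (s.reg 11) with ht
  have h8 : 1 < 2 ^ w := by omega
  have h9 : s.reg 11 - s.arr 3 (s.reg 13) < 2 ^ w := by omega
  set s₁ : State := { s with reg := update s.reg 14 t } with hs₁
  have e1 : (Cmd.set 14 (.bin .add (.bin .add (.read 2 (.reg 13))
    (.bin .mul (.reg 7) (.bin .sub (.reg 11) (.read 3 (.reg 13))))) (.reg 6))).run w s = s₁ := by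
    simp only [Cmd.run, Expr.eval, BinOp.apply, hs₁]
    -- Inner reductions modulo `2 ^ w` are absorbed by the outermost one; `h9` removes the reduction
    -- of the difference.
    rw [Nat.mod_add_mod, Nat.mod_eq_of_lt h9, add_right_comm, Nat.add_mod_mod, add_right_comm,
      show s.arr 2 (s.reg 13) + s.reg 7 * (s.reg 11 - s.arr 3 (s.reg 13)) + s.reg 6 = t from rfl,
      Nat.mod_eq_of_lt h7]
  have s₁p : s₁.parser = s.parser := by simp [State.parser, hs₁]
  have f1 : SameBelow 14 s s₁ := by
    refine ⟨fun i hi => ?_, rfl, rfl, rfl⟩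
    rw [hs₁]
    exact update_of_ne (by omega) _ _
  have e2 : processCmd.run w s = enterCmd.run w
      (if (if s.reg 10 < t then 1 else 0) % 2 ^ w ≠ 0 then
        (Cmd.seq (.set 14 (.reg 6)) (.set 15 (.const 0))).run w (closeCmd.run w s₁)
      else (Cmd.set 15 (.read 4 (.reg 13))).run w s₁) := by
    have e3 : s.reg 10 = s₁.reg 10 := (f1.1 10 (by norm_num)).symm
    have e4 : t = s₁.reg 14 := by simp [hs₁]
    rw [e3, e4, ← e1]
    rfl
  rw [e2, Parser.process]
  by_cases hT : s.reg 10 < t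
  · rw [if_pos hT, if_pos hT, if_pos (by simp [Nat.mod_eq_of_lt h8])]
    obtain ⟨g1, g2⟩ := run_closeCmd (w := w) (s := s₁) (by simpa [hs₁] using h5)
      (by simpa [hs₁] using h6)
    set s₂ := closeCmd.run w s₁
    rw [s₁p] at g1
    set s₃ := (Cmd.seq (.set 14 (.reg 6)) (.set 15 (.const 0))).run w s₂ with hs₃
    have s₃p : s₃.parser = s₂.parser := by simp [State.parser, hs₃, Cmd.run]
    have f3 : SameBelow 14 s₂ s₃ := by
      refine ⟨fun i hi => ?_, rfl, rfl, rfl⟩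
      simp only [hs₃, Cmd.run]
      rw [update_of_ne (by omega), update_of_ne (by omega)]
    have f : SameBelow 14 s s₃ := f1.trans ((g2.mono (by norm_num)).trans f3)
    have r15 : s₃.reg 15 = 0 := by simp [hs₃, Cmd.run, Expr.eval]
    have r14 : s₃.reg 14 = s.reg 6 := by
      rw [show s₃.reg 14 = s₂.reg 6 by simp [hs₃, Cmd.run, Expr.eval]]
      exact (f1.trans (g2.mono (by norm_num))).1 6 (by norm_num)
    have r17 : s₃.reg 17 = s.reg 17 := by
      have := congrArg Parser.cnt (s₃p.trans g1)
      exact this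
    have a8 : s₃.arr 8 = s.arr 8 := by
      have := congrArg Parser.dep (s₃p.trans g1)
      exact this
    have r0 := f.1 0 (by norm_num)
    have r11 := f.1 11 (by norm_num)
    have r13 := f.1 13 (by norm_num)
    obtain ⟨k1, k2⟩ := run_enterCmd (w := w) (s := s₃)
      (by rw [r15, r0, r11]; exact (h1 0 (Or.inl rfl)).1) (by rw [r17]; exact h2)
      (by rw [r15, a8]; exact (h1 0 (Or.inl rfl)).2) (by rw [r11]; exact h4)
    refine ⟨?_, f.trans (k2.mono (by norm_num))⟩
    rw [k1, s₃p, g1, r0, r11, r13, r14, r15]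
    have : s₁.reg 0 = s.reg 0 ∧ s₁.reg 13 = s.reg 13 :=
      ⟨f1.1 0 (by norm_num), f1.1 13 (by norm_num)⟩
    rw [this.1, this.2]
  · rw [if_neg hT, if_neg hT, if_neg (by simp)]
    set s₃ := (Cmd.set 15 (.read 4 (.reg 13))).run w s₁ with hs₃
    have s₃p : s₃.parser = s.parser := by simp [State.parser, hs₃, Cmd.run, hs₁]
    have f3 : SameBelow 14 s₁ s₃ := by
      refine ⟨fun i hi => ?_, rfl, rfl, rfl⟩
      simp only [hs₃, Cmd.run]
      rw [update_of_ne (by omega)]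
    have f : SameBelow 14 s s₃ := f1.trans f3
    have r15 : s₃.reg 15 = s.arr 4 (s.reg 13) := by simp [hs₃, hs₁, Cmd.run, Expr.eval]
    have r14 : s₃.reg 14 = t := by simp [hs₃, hs₁, Cmd.run]
    have r17 : s₃.reg 17 = s.reg 17 := congrArg Parser.cnt s₃p
    have a8 : s₃.arr 8 = s.arr 8 := congrArg Parser.dep s₃p
    have r0 := f.1 0 (by norm_num)
    have r11 := f.1 11 (by norm_num)
    have r13 := f.1 13 (by norm_num)
    obtain ⟨k1, k2⟩ := run_enterCmd (w := w) (s := s₃)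
      (by rw [r15, r0, r11]; exact (h1 _ (Or.inr rfl)).1) (by rw [r17]; exact h2)
      (by rw [r15, a8]; exact (h1 _ (Or.inr rfl)).2) (by rw [r11]; exact h4)
    refine ⟨?_, f.trans (k2.mono (by norm_num))⟩
    rw [k1, s₃p, r0, r11, r13, r14, r15]
    rfl

end WordRAM

/-! ### Integer substitutes for logarithms. -/

/-- A rounded version of `K * log (n / p)`. -/
def costSum (K p n : ℕ) : ℕ := ∑ i ∈ Finset.Ico 1 n, if i < p then 0 else K / i + 1

/-- A rounded version of `K * log (b / a)`. -/
def harmSum (K a b : ℕ) : ℕ := ∑ i ∈ Finset.Ico a b, K / i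

theorem costSum_le {K p n : ℕ} : costSum K p n ≤ n * (K + 1) := by
  calc costSum K p n ≤ ∑ i ∈ Finset.Ico 1 n, (K + 1) := by
        refine Finset.sum_le_sum fun i _ => ?_
        have := Nat.div_le_self K i
        split_ifs <;> omega
    _ ≤ n * (K + 1) := by
        rw [Finset.sum_const, Nat.card_Ico, smul_eq_mul]
        exact Nat.mul_le_mul_right _ (Nat.sub_le n 1)

theorem harmSum_le {K a b : ℕ} : harmSum K a b ≤ b * K := by
  calc harmSum K a b ≤ ∑ i ∈ Finset.Ico a b, K :=
        Finset.sum_le_sum fun i _ => Nat.div_le_self K i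
    _ ≤ b * K := by
        rw [Finset.sum_const, Nat.card_Ico, smul_eq_mul]
        exact Nat.mul_le_mul_right _ (Nat.sub_le b a)

/-- The integer upper bound on `log n`. -/
def logBound (n : ℕ) : ℕ := harmSum (n * n) 1 n / (n * n) + 2

/-- The bound on the number of phrases that begin at one place. -/
def phraseBound (n p q : ℕ) : ℕ :=
  (p * q) * (p * q) * (p * q) /
    (n * ((n * n) * (n * n)) * (logBound n * logBound n * (logBound n * logBound n)))

/-- The threshold for the cost of a phrase. -/
def threshold (n p q : ℕ) : ℕ := harmSum (n * n) 2 (phraseBound n p q + 1)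

theorem logBound_le {n : ℕ} (hn : 2 ≤ n) : logBound n ≤ 2 * n := by
  have h : harmSum (n * n) 1 n / (n * n) ≤ n - 1 := by
    refine Nat.div_le_of_le_mul ?_
    calc harmSum (n * n) 1 n ≤ ∑ i ∈ Finset.Ico 1 n, n * n :=
          Finset.sum_le_sum fun i _ => Nat.div_le_self _ i
      _ = n * n * (n - 1) := by
          rw [Finset.sum_const, Nat.card_Ico, smul_eq_mul, mul_comm]
  unfold logBound
  omega

theorem phraseBound_le {n p q : ℕ} (hp : p ≤ n) (hq : q ≤ n) : phraseBound n p q ≤ n := by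
  unfold phraseBound
  refine Nat.div_le_of_le_mul ?_
  have h1 : 1 ≤ logBound n * logBound n * (logBound n * logBound n) := by
    have : 1 ≤ logBound n := Nat.le_add_left 1 _
    exact Nat.mul_le_mul (Nat.mul_le_mul this this) (Nat.mul_le_mul this this)
  have h2 : p * q ≤ n * n := Nat.mul_le_mul hp hq
  calc (p * q) * (p * q) * (p * q) ≤ (n * n) * (n * n) * (n * n) := by gcongr
    _ = n * ((n * n) * (n * n)) * 1 * n := by ring
    _ ≤ _ := by gcongr

/-! ### Computation of the parameters on the machine. -/

namespace WordRAM

open Function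

theorem run_setupCmd {w : ℕ} {s : State} {n : ℕ} (hn : 2 ≤ n) (h0 : s.reg 0 = n)
    (hw : n * n < 2 ^ w) (ha : s.arr 0 n ≤ n * (n - 1)) :
    setupCmd.run w s = { s with reg := update (update (update (update (update s.reg 1 (s.arr 0 n))
      2 (s.arr 0 n / (n - 1))) 3 (n - s.arr 0 n / (n - 1))) 4 (n * n)) 5 1 } := by
  have h1 : n ≤ n * n := Nat.le_mul_self n
  have h2 : s.arr 0 n / (n - 1) ≤ n := Nat.div_le_of_le_mul (by rwa [mul_comm])
  have h3 : (n - 1) % 2 ^ w = n - 1 := Nat.mod_eq_of_lt (by omega)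
  have h4 : (s.arr 0 n / (n - 1)) % 2 ^ w = s.arr 0 n / (n - 1) := Nat.mod_eq_of_lt (by omega)
  have h5 : (n - s.arr 0 n / (n - 1)) % 2 ^ w = n - s.arr 0 n / (n - 1) :=
    Nat.mod_eq_of_lt (by omega)
  have h6 : n * n % 2 ^ w = n * n := Nat.mod_eq_of_lt hw
  have h7 : 1 % 2 ^ w = 1 := Nat.mod_eq_of_lt (by omega)
  simp [setupCmd, Cmd.run, Expr.eval, BinOp.apply, h0, h3, h4, h5, h6, h7]

theorem run_costStep {w : ℕ} {s : State} {K p q j : ℕ} (h4 : s.reg 4 = K)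
    (hp : s.reg 2 = p) (hq : s.reg 3 = q) (h5 : s.reg 5 = j) (hj : 1 ≤ j)
    (h6 : s.reg 6 = costSum K p j) (h7 : s.reg 7 = costSum K q j) (h8 : s.reg 8 = harmSum K 1 j)
    (hw : (j + 1) * (K + 1) < 2 ^ w) :
    costStep.run w s = { s with reg := update (update (update (update s.reg
      6 (costSum K p (j + 1))) 7 (costSum K q (j + 1))) 8 (harmSum K 1 (j + 1))) 5 (j + 1) } := by
  have hc : ∀ p, (costSum K p j + (if j < p then 0 else K / j + 1)) % 2 ^ w =
      costSum K p (j + 1) := by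
    intro p
    rw [show costSum K p j + (if j < p then 0 else K / j + 1) = costSum K p (j + 1) from
      (Finset.sum_Ico_succ_top hj _).symm]
    exact Nat.mod_eq_of_lt (costSum_le.trans_lt hw)
  have hh : (harmSum K 1 j + K / j) % 2 ^ w = harmSum K 1 (j + 1) := by
    rw [show harmSum K 1 j + K / j = harmSum K 1 (j + 1) from (Finset.sum_Ico_succ_top hj _).symm]
    refine Nat.mod_eq_of_lt (harmSum_le.trans_lt (lt_of_le_of_lt ?_ hw))
    gcongr; omega
  have hK : j + 1 + K ≤ (j + 1) * (K + 1) := by nlinarith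
  have h1 : 1 % 2 ^ w = 1 := Nat.mod_eq_of_lt (by omega)
  have hj1 : (j + 1) % 2 ^ w = j + 1 := Nat.mod_eq_of_lt (by omega)
  have hdiv := Nat.div_le_self K j
  have hd : (K / j) % 2 ^ w = K / j := Nat.mod_eq_of_lt (by omega)
  have hd1 : (K / j + 1) % 2 ^ w = K / j + 1 := Nat.mod_eq_of_lt (by omega)
  -- The factor `1 - [j < p]` replaces the case distinction in `costSum`.
  have hi : ∀ p, ((1 - (if j < p then 1 else 0) % 2 ^ w) % 2 ^ w * (K / j + 1)) % 2 ^ w =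
      if j < p then 0 else K / j + 1 := by
    intro p
    split_ifs <;> simp [h1, hd1]
  simp only [costStep, Cmd.run, Expr.eval, BinOp.apply, h4, h5, hp, hq, h6, h7, h8, h1, hd, hd1,
    ne_eq, Nat.reduceEqDiff, not_false_eq_true, update_of_ne, hi, hc, hh, hj1]

theorem run_boundCmd {w : ℕ} {s : State} {n p q : ℕ} (hn : 2 ≤ n) (h0 : s.reg 0 = n)
    (h2 : s.reg 2 = p) (h3 : s.reg 3 = q) (hp : p ≤ n) (hq : q ≤ n) (h4 : s.reg 4 = n * n)
    (h8 : s.reg 8 = harmSum (n * n) 1 n) (hw : n ^ 20 < 2 ^ w) :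
    boundCmd.run w s = { s with reg := update (update (update (update s.reg
      8 (logBound n)) 9 (p * q)) 9 (phraseBound n p q)) 5 2 } := by
  have hpow : ∀ k ≤ 20, n ^ k < 2 ^ w := fun k hk =>
    lt_of_le_of_lt (Nat.pow_le_pow_right (by omega) hk) hw
  have hl := logBound_le hn
  have hl2 : logBound n ≤ n ^ 2 := hl.trans (by rw [pow_two]; gcongr)
  have e1 : (harmSum (n * n) 1 n / (n * n)) % 2 ^ w = harmSum (n * n) 1 n / (n * n) :=
    Nat.mod_eq_of_lt (lt_of_le_of_lt (by unfold logBound at hl2; omega) (hpow 2 (by norm_num)))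
  have e2 : 2 % 2 ^ w = 2 :=
    Nat.mod_eq_of_lt (lt_of_le_of_lt hn (by simpa using hpow 1 (by norm_num)))
  have e3 : (harmSum (n * n) 1 n / (n * n) + 2) % 2 ^ w = logBound n :=
    Nat.mod_eq_of_lt (lt_of_le_of_lt hl2 (hpow 2 (by norm_num)))
  have hpq : p * q ≤ n ^ 2 := by rw [pow_two]; exact Nat.mul_le_mul hp hq
  have e4 : (p * q) % 2 ^ w = p * q := Nat.mod_eq_of_lt (lt_of_le_of_lt hpq (hpow 2 (by norm_num)))
  have e5 : (p * q * (p * q) * (p * q)) % 2 ^ w = p * q * (p * q) * (p * q) := by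
    refine Nat.mod_eq_of_lt (lt_of_le_of_lt ?_ (hpow 6 (by norm_num)))
    calc p * q * (p * q) * (p * q) ≤ n ^ 2 * n ^ 2 * n ^ 2 := by gcongr
      _ = n ^ 6 := by ring
  -- The denominator is the largest number in this computation; `logBound n ≤ n ^ 2` bounds it by `n
  -- ^ 13`.
  have e6 : (n * (n * n * (n * n)) *
      (logBound n * logBound n * (logBound n * logBound n))) % 2 ^ w =
      n * (n * n * (n * n)) * (logBound n * logBound n * (logBound n * logBound n)) := by
    refine Nat.mod_eq_of_lt (lt_of_le_of_lt ?_ (hpow 13 (by norm_num)))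
    calc _ ≤ n * (n * n * (n * n)) * (n ^ 2 * n ^ 2 * (n ^ 2 * n ^ 2)) := by gcongr
      _ = n ^ 13 := by ring
  have e7 : phraseBound n p q % 2 ^ w = phraseBound n p q :=
    Nat.mod_eq_of_lt (lt_of_le_of_lt (phraseBound_le hp hq) (by simpa using hpow 1 (by norm_num)))
  unfold phraseBound at e7
  simp only [boundCmd, Cmd.run, Expr.eval, BinOp.apply, h0, h2, h3, h4, h8, e1, e2, e3, e4,
    update_self, ne_eq, Nat.reduceEqDiff, not_false_eq_true, update_of_ne, OfNat.zero_ne_ofNat,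
    Nat.mod_mul_mod, Nat.mul_mod_mod, e5, e6, e7]
  rfl

theorem run_thresholdStep {w : ℕ} {s : State} {K j : ℕ} (h4 : s.reg 4 = K) (h5 : s.reg 5 = j)
    (hj : 2 ≤ j) (h10 : s.reg 10 = harmSum K 2 j) (hw : (j + 1) * (K + 1) < 2 ^ w) :
    thresholdStep.run w s =
      { s with reg := update (update s.reg 10 (harmSum K 2 (j + 1))) 5 (j + 1) } := by
  have hh : (harmSum K 2 j + K / j) % 2 ^ w = harmSum K 2 (j + 1) := by
    rw [show harmSum K 2 j + K / j = harmSum K 2 (j + 1) from (Finset.sum_Ico_succ_top hj _).symm]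
    refine Nat.mod_eq_of_lt (harmSum_le.trans_lt (lt_of_le_of_lt ?_ hw))
    gcongr; omega
  have hK : j + 1 + K ≤ (j + 1) * (K + 1) := by nlinarith
  have h1 : 1 % 2 ^ w = 1 := Nat.mod_eq_of_lt (by omega)
  have hj1 : (j + 1) % 2 ^ w = j + 1 := Nat.mod_eq_of_lt (by omega)
  have hdiv := Nat.div_le_self K j
  have hd : (K / j) % 2 ^ w = K / j := Nat.mod_eq_of_lt (by omega)
  simp only [thresholdStep, Cmd.run, Expr.eval, BinOp.apply, h4, h5, h10, h1, hd,
    ne_eq, Nat.reduceEqDiff, not_false_eq_true, update_of_ne, hh, hj1]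

theorem eval_lt_eq_zero {w : ℕ} {s : State} {e f : Expr} (hw : 1 < 2 ^ w) :
    (Expr.bin .lt e f).eval w s = 0 ↔ f.eval w s ≤ e.eval w s := by
  simp only [Expr.eval, BinOp.apply]
  split_ifs with h
  · simp [Nat.mod_eq_of_lt hw, h]
  · simpa using h

/-- The parameters of the parser are in the registers. -/
structure Ready (n p q : ℕ) (s : State) : Prop where
  reg0 : s.reg 0 = n
  reg6 : s.reg 6 = costSum (n * n) p n
  reg7 : s.reg 7 = costSum (n * n) q n
  reg10 : s.reg 10 = threshold n p q

theorem runs_prepareCmd {w n : ℕ} {s : State} (hn : 2 ≤ n) (h0 : s.reg 0 = n)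
    (hreg : ∀ i, i ≠ 0 → s.reg i = 0) (hw : n ^ 20 < 2 ^ w) (ha : s.arr 0 n ≤ n * (n - 1))
    {p q : ℕ} (hp : p = s.arr 0 n / (n - 1)) (hq : q = n - p) :
    ∃ s', Runs w prepareCmd s (40 * n + 40) s' ∧ Ready n p q s' ∧ s'.arr = s.arr ∧
      s'.out = s.out ∧ s'.reg 11 = 0 ∧ s'.reg 12 = 0 ∧ s'.reg 17 = 0 := by
  have hpow : ∀ k ≤ 20, n ^ k < 2 ^ w := fun k hk =>
    lt_of_le_of_lt (Nat.pow_le_pow_right (by omega) hk) hw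
  have hw2 : n * n < 2 ^ w := by have := hpow 2 (by norm_num); rwa [pow_two] at this
  have hnn : n + n ≤ n * n := by nlinarith
  have hw1 : 1 < 2 ^ w := by omega
  have hwK : ∀ j ≤ n, (j + 1) * (n * n + 1) < 2 ^ w := by
    intro j hj
    refine lt_of_le_of_lt ?_ (hpow 5 (by norm_num))
    calc (j + 1) * (n * n + 1) ≤ (n * n) * (n * n * n) := by
          gcongr
          · omega
          · nlinarith
      _ = n ^ 5 := by ring
  have hpn : p ≤ n := by rw [hp]; exact Nat.div_le_of_le_mul (by rwa [mul_comm])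
  have hqn : q ≤ n := by omega
  have r1 := (show setupCmd.LoopFree by simp [setupCmd, Cmd.LoopFree]).runs (w := w) s
  rw [run_setupCmd hn h0 hw2 ha, ← hp, ← hq] at r1
  set s₁ : State := ⟨update (update (update (update (update s.reg 1 (s.arr 0 n))
      2 p) 3 q) 4 (n * n)) 5 1, s.arr, s.out⟩ with hs₁
  obtain ⟨s₂, r2, ⟨i0, i2, i3, i4, ij1, ijn, i6, i7, i8, i10, i11, i12, i17, ia, io⟩, e2⟩ :=
    Runs.loop (w := w) (e := .bin .lt (.reg 5) (.reg 0)) (p := costStep)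
    (fun s' => s'.reg 0 = n ∧ s'.reg 2 = p ∧ s'.reg 3 = q ∧ s'.reg 4 = n * n ∧ 1 ≤ s'.reg 5 ∧
      s'.reg 5 ≤ n ∧ s'.reg 6 = costSum (n * n) p (s'.reg 5) ∧
      s'.reg 7 = costSum (n * n) q (s'.reg 5) ∧ s'.reg 8 = harmSum (n * n) 1 (s'.reg 5) ∧
      s'.reg 10 = 0 ∧ s'.reg 11 = 0 ∧ s'.reg 12 = 0 ∧ s'.reg 17 = 0 ∧ s'.arr = s.arr ∧
      s'.out = s.out)
    (fun s' => 8 * (n - s'.reg 5)) (by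
      rintro s' ⟨i0, i2, i3, i4, ij1, ijn, i6, i7, i8, i10, i11, i12, i17, ia, io⟩ he
      rw [Ne, eval_lt_eq_zero hw1] at he
      simp only [Expr.eval, i0, not_le] at he
      have r := (show costStep.LoopFree by simp [costStep, Cmd.LoopFree]).runs (w := w) s'
      rw [run_costStep i4 i2 i3 rfl ij1 i6 i7 i8 (hwK _ ijn)] at r
      refine ⟨_, _, r, ?_, ?_⟩
      · refine ⟨?_, ?_, ?_, ?_, ?_, ?_, ?_, ?_, ?_, ?_, ?_, ?_, ?_, ia, io⟩ <;>
        simp [i0, i2, i3, i4, i10, i11, i12, i17]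
        omega
      · simp [costStep, Cmd.size]; omega) s₁
    (by
      have hn1 : 1 ≤ n := by omega
      simp [hs₁, h0, hreg, hn1, costSum, harmSum])
  rw [eval_lt_eq_zero hw1] at e2
  simp only [Expr.eval, i0] at e2
  have ej : s₂.reg 5 = n := le_antisymm ijn e2
  rw [ej] at i6 i7 i8
  have r3 := (show boundCmd.LoopFree by simp [boundCmd, Cmd.LoopFree]).runs (w := w) s₂
  rw [run_boundCmd hn i0 i2 i3 hpn hqn i4 i8 hw] at r3
  set M := phraseBound n p q with hM
  have hMn : M ≤ n := phraseBound_le hpn hqn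
  set s₃ : State := ⟨update (update (update (update s₂.reg
      8 (logBound n)) 9 (p * q)) 9 M) 5 2, s₂.arr, s₂.out⟩ with hs₃
  have hM1 : (M + 1) % 2 ^ w = M + 1 := Nat.mod_eq_of_lt (by omega)
  have h11 : 1 % 2 ^ w = 1 := Nat.mod_eq_of_lt hw1
  obtain ⟨s₄, r4, ⟨j0, j4, jj1, jjn, j6, j7, j9, j10, j11, j12, j17, ja, jo⟩, e4⟩ :=
    Runs.loop (w := w) (e := .bin .lt (.reg 5) (.bin .add (.reg 9) (.const 1)))
    (p := thresholdStep)
    -- The maximum accounts for `M = 0`, when the counter starts at `2`, beyond `M + 1`.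
    (fun s' => s'.reg 0 = n ∧ s'.reg 4 = n * n ∧ 2 ≤ s'.reg 5 ∧
      s'.reg 5 ≤ max 2 (M + 1) ∧ s'.reg 6 = costSum (n * n) p n ∧
      s'.reg 7 = costSum (n * n) q n ∧ s'.reg 9 = M ∧
      s'.reg 10 = harmSum (n * n) 2 (s'.reg 5) ∧ s'.reg 11 = 0 ∧ s'.reg 12 = 0 ∧ s'.reg 17 = 0 ∧
      s'.arr = s.arr ∧ s'.out = s.out)
    (fun s' => 4 * (M + 1 - s'.reg 5)) (by
      rintro s' ⟨j0, j4, jj1, jjn, j6, j7, j9, j10, j11, j12, j17, ja, jo⟩ he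
      rw [Ne, eval_lt_eq_zero hw1] at he
      simp only [Expr.eval, BinOp.apply, j9, h11, hM1, not_le] at he
      have r := (show thresholdStep.LoopFree by simp [thresholdStep, Cmd.LoopFree]).runs
        (w := w) s'
      rw [run_thresholdStep j4 rfl jj1 j10 (hwK _ (by omega))] at r
      refine ⟨_, _, r, ?_, ?_⟩
      · refine ⟨?_, ?_, ?_, ?_, ?_, ?_, ?_, ?_, ?_, ?_, ?_, ja, jo⟩ <;>
        simp [j0, j4, j6, j7, j9, j11, j12, j17] <;> omega
      · simp [thresholdStep, Cmd.size]; omega) s₃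
    (by simp [hs₃, i0, i4, i6, i7, i10, i11, i12, i17, ia, io, harmSum])
  rw [eval_lt_eq_zero hw1] at e4
  simp only [Expr.eval, BinOp.apply, j9, h11, hM1] at e4
  refine ⟨s₄, (r1.seq (r2.seq (r3.seq r4))).mono ?_, ⟨j0, j6, j7, ?_⟩, ja, jo, j11, j12, j17⟩
  · have h1 : s₁.reg 5 = 1 := by simp [hs₁]
    have h2 : s₃.reg 5 = 2 := by simp [hs₃]
    simp only [setupCmd, boundCmd, Cmd.size, h1, h2]
    omega
  · rw [j10, threshold, ← hM]
    rcases le_or_gt 2 (M + 1) with h | h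
    · rw [show s₄.reg 5 = M + 1 by omega]
    · rw [show s₄.reg 5 = 2 by omega, harmSum, harmSum, Finset.Ico_self,
        Finset.Ico_eq_empty (by omega)]

end WordRAM

/-! ### The scan of the adjacency list and the final closing on the machine. -/

/-- The columns of the entries of row `u` that have been seen when the lists of all `v' < v` and
the first `k` entries of the list of `v` have been read. -/
def seenColumns (nb : ℕ → List ℕ) (v k u : ℕ) : Finset ℕ :=
  (Finset.range u).filter fun v' => (v' < v ∧ u ∈ nb v') ∨ (v' = v ∧ u ∈ (nb v).take k)

/-- A neighbour `u ≤ v` gives no entry below the diagonal; the edge is read from the list of its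
smaller endpoint. -/
theorem seenColumns_succ_of_not_lt {nb : ℕ → List ℕ} {v k : ℕ} (hk : k < (nb v).length)
    (h : ¬ v < (nb v)[k]) : seenColumns nb v (k + 1) = seenColumns nb v k := by
  funext u
  refine Finset.filter_congr fun v' hv' => ?_
  rw [List.take_add_one, List.getElem?_eq_getElem hk]
  simp only [Option.toList_some, List.mem_append, List.mem_singleton]
  refine or_congr_right (and_congr_right fun hv => ?_)
  constructor
  · rintro (h1 | h1)
    · exact h1
    · rw [Finset.mem_range, hv, h1] at hv'
      exact absurd hv' h
  · exact Or.inl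

theorem seenColumns_succ_of_lt {nb : ℕ → List ℕ} {v k : ℕ} (hk : k < (nb v).length)
    (h : v < (nb v)[k]) : seenColumns nb v (k + 1) =
      Function.update (seenColumns nb v k) (nb v)[k]
        (insert v (seenColumns nb v k (nb v)[k])) := by
  funext u
  by_cases hu : u = (nb v)[k]
  · subst hu
    rw [Function.update_self]
    ext v'
    simp only [seenColumns, Finset.mem_filter, Finset.mem_range, Finset.mem_insert]
    rw [List.take_add_one, List.getElem?_eq_getElem hk]
    simp only [Option.toList_some, List.mem_append, List.mem_singleton, or_true, and_true]
    constructor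
    · rintro ⟨h1, h2 | rfl⟩
      · exact Or.inr ⟨h1, Or.inl h2⟩
      · exact Or.inl rfl
    · rintro (rfl | ⟨h1, h2 | h2⟩)
      · exact ⟨h, Or.inr rfl⟩
      · exact ⟨h1, Or.inl h2⟩
      · exact ⟨h1, Or.inr h2.1⟩
  · rw [Function.update_of_ne hu]
    refine Finset.filter_congr fun v' hv' => ?_
    rw [List.take_add_one, List.getElem?_eq_getElem hk]
    simp only [Option.toList_some, List.mem_append, List.mem_singleton, hu, or_false]

theorem seenColumns_length (nb : ℕ → List ℕ) (v : ℕ) :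
    seenColumns nb v (nb v).length = seenColumns nb (v + 1) 0 := by
  funext u
  refine Finset.filter_congr fun v' hv' => ?_
  simp only [List.take_length, List.take_zero, List.not_mem_nil, and_false, or_false]
  constructor
  · rintro (h | ⟨rfl, h⟩)
    · exact ⟨by omega, h.2⟩
    · exact ⟨by omega, h⟩
  · rintro ⟨h1, h2⟩
    rcases Nat.lt_succ_iff_lt_or_eq.1 h1 with h3 | rfl
    · exact Or.inl ⟨h3, h2⟩
    · exact Or.inr ⟨rfl, h2⟩

/-- `st` and `fl` hold the lists `nb 0, …, nb (n - 1)` consecutively. -/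
structure StoresLists (n m : ℕ) (nb : ℕ → List ℕ) (st fl : ℕ → ℕ) : Prop where
  nodup : ∀ v, (nb v).Nodup
  lt : ∀ v, ∀ u ∈ nb v, u < n
  start_zero : st 0 = 0
  start_succ : ∀ v < n, st (v + 1) = st v + (nb v).length
  le : ∀ v ≤ n, st v + (nb v).length ≤ m
  getElem : ∀ v k, (hk : k < (nb v).length) → fl (st v + k) = (nb v)[k]

namespace WordRAM

open Function Parser

/-- The outer loop runs over the columns `v`, so every row receives its columns in increasing order,
however the lists are ordered. Each step advances the vertex or the position, which is the
potential. A new trie node uses up a position: this is the invariant `reg 17 ≤ reg 12`, which bounds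
the trie by the length `m` of the lists and so keeps all addresses within a word. -/
theorem runs_scan {w n m α β T : ℕ} {nb : ℕ → List ℕ} {st fl : ℕ → ℕ}
    (hS : StoresLists n m nb st fl) (hn : 2 ≤ n) (hw : n ^ 20 < 2 ^ w) (hm : m ≤ n ^ 2)
    (hα : α ≤ T) (hT : T ≤ n ^ 4) (hβ : β ≤ n ^ 4) {s : State} (h0 : s.reg 0 = n)
    (h6 : s.reg 6 = α) (h7 : s.reg 7 = β) (h10 : s.reg 10 = T) (h11 : s.reg 11 = 0)
    (h12 : s.reg 12 = 0) (ha0 : s.arr 0 = st) (ha1 : s.arr 1 = fl)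
    (hp : s.parser = Parser.init) :
    ∃ s', Runs w (.loop (.bin .lt (.reg 11) (.reg 0)) scanStep) s (60 * (n + m) + 1) s' ∧
      s'.reg 0 = n ∧ s'.out = s.out ∧ Inv n α β T s'.parser (seenColumns nb n 0) ∧
      s'.parser.cnt ≤ m := by
  have hpow : ∀ k ≤ 20, n ^ k < 2 ^ w := fun k hk =>
    lt_of_le_of_lt (Nat.pow_le_pow_right (by omega) hk) hw
  have hnn : n + n ≤ n ^ 2 := by nlinarith
  have hn2 : n ^ 2 < 2 ^ w := hpow 2 (by norm_num)
  have hw1 : 1 < 2 ^ w := by omega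
  have h11' : 1 % 2 ^ w = 1 := Nat.mod_eq_of_lt hw1
  have hn3 : n ^ 2 * n + n < 2 ^ w := by
    refine lt_of_le_of_lt ?_ (hpow 4 (by norm_num))
    calc n ^ 2 * n + n ≤ n ^ 2 * n + n ^ 2 * n := by nlinarith
      _ = n ^ 3 * 2 := by ring
      _ ≤ n ^ 3 * n := by gcongr
      _ = n ^ 4 := by ring
  obtain ⟨s', r, ⟨k, i0, i6, i7, i10, i11, i12, ik, im, ia0, ia1, io, iI, ic⟩, e⟩ :=
    Runs.loop (w := w) (e := .bin .lt (.reg 11) (.reg 0)) (p := scanStep)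
    (fun s' => ∃ k, s'.reg 0 = n ∧ s'.reg 6 = α ∧ s'.reg 7 = β ∧ s'.reg 10 = T ∧
      s'.reg 11 ≤ n ∧ s'.reg 12 = st (s'.reg 11) + k ∧ k ≤ (nb (s'.reg 11)).length ∧
      s'.reg 12 ≤ m ∧ s'.arr 0 = st ∧ s'.arr 1 = fl ∧ s'.out = s.out ∧
      Inv n α β T s'.parser (seenColumns nb (s'.reg 11) k) ∧ s'.reg 17 ≤ s'.reg 12)
    (fun s' => 60 * (n - s'.reg 11 + (m - s'.reg 12))) (by
      rintro s ⟨k, i0, i6, i7, i10, i11, i12, ik, im, ia0, ia1, io, iI, ic⟩ he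
      rw [Ne, eval_lt_eq_zero hw1] at he
      simp only [Expr.eval, i0, not_le] at he
      set v := s.reg 11 with hv
      have hv1 : (v + 1) % 2 ^ w = v + 1 := Nat.mod_eq_of_lt (by omega)
      have hst := hS.start_succ v he
      have hle := hS.le v he.le
      have htest : (Expr.bin .lt (.reg 12) (.read 0 (.bin .add (.reg 11) (.const 1)))).eval w s
          = 0 ↔ st v + (nb v).length ≤ st v + k := by
        rw [eval_lt_eq_zero hw1]
        simp only [Expr.eval, BinOp.apply, ← hv, h11', hv1, ia0, hst, i12]
      rcases ik.lt_or_eq with hk | hk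
      · have hte : (Expr.bin .lt (.reg 12)
            (.read 0 (.bin .add (.reg 11) (.const 1)))).eval w s ≠ 0 := by
          rw [Ne, htest]; omega
        have him : s.reg 12 < m := by omega
        set u := (nb v)[k] with hu
        have hun : u < n := hS.lt v u (List.getElem_mem hk)
        have hfl : fl (s.reg 12) = u := by rw [i12]; exact hS.getElem v k hk
        set s₁ : State := ⟨update (update s.reg 13 u) 12 (s.reg 12 + 1), s.arr, s.out⟩ with hs₁
        have hi1 : (s.reg 12 + 1) % 2 ^ w = s.reg 12 + 1 := Nat.mod_eq_of_lt (by omega)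
        have e1 : (Cmd.seq (.set 13 (.read 1 (.reg 12)))
            (.set 12 (.bin .add (.reg 12) (.const 1)))).run w s = s₁ := by
          simp [Cmd.run, Expr.eval, BinOp.apply, ia1, hfl, hi1, h11', hs₁]
        have s₁p : s₁.parser = s.parser := by simp [State.parser, hs₁]
        have q0 : s₁.reg 0 = n := by simp [hs₁, i0]
        have q6 : s₁.reg 6 = α := by simp [hs₁, i6]
        have q7 : s₁.reg 7 = β := by simp [hs₁, i7]
        have q10 : s₁.reg 10 = T := by simp [hs₁, i10]
        have q11 : s₁.reg 11 = v := by simp [hs₁, hv]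
        have q12 : s₁.reg 12 = s.reg 12 + 1 := by simp [hs₁]
        have q13 : s₁.reg 13 = u := by simp [hs₁]
        have q17 : s₁.reg 17 = s.reg 17 := by simp [hs₁]
        have rr := (show scanStep.LoopFree by
          simp [scanStep, processCmd, closeCmd, enterCmd, childCmd, Cmd.LoopFree]).runs (w := w) s
        have hsize : scanStep.size + 1 ≤ 60 := by
          simp [scanStep, processCmd, closeCmd, enterCmd, childCmd, Cmd.size]
        have e2 : scanStep.run w s =
            (Cmd.cond (.bin .lt (.reg 11) (.reg 13)) processCmd .skip).run w s₁ := by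
          rw [← e1]
          rw [scanStep, Cmd.run_cond_pos hte]
          rfl
        have hcnt : s.parser.cnt = s.reg 17 := rfl
        by_cases hvu : v < u
        · have ht2 : (Expr.bin .lt (.reg 11) (.reg 13)).eval w s₁ ≠ 0 := by
            rw [Ne, eval_lt_eq_zero hw1]
            simp only [Expr.eval, q11, q13]; omega
          rw [Cmd.run_cond_pos ht2] at e2
          obtain ⟨b1, b2, b3, b4⟩ := iI.bounds
          have hnode : s.arr 4 u ≤ n ^ 2 := (b1 u).trans (by omega)
          have hrc : s.arr 9 (s.arr 4 u) ≤ n := b4 _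
          have hmul : s.arr 4 u * n ≤ n ^ 2 * n := Nat.mul_le_mul_right _ hnode
          have hnc : newCost α β s.parser u v < 2 ^ w := by
            refine lt_of_le_of_lt ?_ (hpow 6 (by norm_num))
            have c1 := b2 u
            have c2 : β * (v - s.parser.pos u) ≤ n ^ 4 * n := Nat.mul_le_mul hβ (by omega)
            calc newCost α β s.parser u v ≤ n ^ 4 + n ^ 4 * n + n ^ 4 := by
                  unfold newCost; omega
              _ = n ^ 4 * (n + 2) := by ring
              _ ≤ n ^ 4 * n ^ 2 := Nat.mul_le_mul_left _ (by omega)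
              _ = n ^ 6 := by ring
          obtain ⟨p1, p2⟩ := run_processCmd (w := w) (s := s₁)
            (by
              rw [q0, q11, q13]
              rintro x (rfl | rfl)
              · have : s.arr 8 0 ≤ n := b3 0 (Nat.zero_le _)
                exact ⟨by omega, by change s.arr 8 0 + 1 < _; omega⟩
              · have : s.arr 8 (s.arr 4 u) ≤ n := b3 _ (b1 u)
                exact ⟨by change s.arr 4 u * n + v < _; omega,
                  by change s.arr 8 (s.arr 4 u) + 1 < _; omega⟩)
            (by rw [q17]; omega) (by rw [q11]; omega)
            (by rw [q13, q0]; change s.arr 4 u * n + s.arr 9 (s.arr 4 u) < _; omega)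
            (by rw [q13]; change s.arr 9 (s.arr 4 u) + 1 < _; omega)
            (by rw [s₁p, q6, q7, q13, q11]; exact hnc)
          rw [← e2, s₁p, q0, q6, q7, q10, q11, q13] at p1
          rw [← e2] at p2
          have g : ∀ i < 14, (scanStep.run w s).reg i = s₁.reg i := p2.1
          have gc : (scanStep.run w s).reg 17 ≤ s.reg 17 + 1 := by
            have := cnt_process_le n α β T s.parser u v
            rw [← p1] at this
            exact this
          refine ⟨_, _, rr, ⟨k + 1, ?_, ?_, ?_, ?_, ?_, ?_, ?_, ?_, ?_, ?_, ?_, ?_, ?_⟩, ?_⟩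
          · rw [g 0 (by norm_num), q0]
          · rw [g 6 (by norm_num), q6]
          · rw [g 7 (by norm_num), q7]
          · rw [g 10 (by norm_num), q10]
          · rw [g 11 (by norm_num), q11]; exact i11
          · rw [g 12 (by norm_num), g 11 (by norm_num), q12, q11, i12]; omega
          · rw [g 11 (by norm_num), q11]; omega
          · rw [g 12 (by norm_num), q12]; omega
          · rw [p2.2.1]; exact ia0
          · rw [p2.2.2.1]; exact ia1
          · rw [p2.2.2.2]; exact io
          · rw [g 11 (by norm_num), q11, p1, seenColumns_succ_of_lt hk hvu]
            refine iI.process hα hun hvu ?_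
            intro v' hv'
            simp only [seenColumns, Finset.mem_filter] at hv'
            rcases hv'.2 with h | ⟨-, h⟩
            · exact h.1
            · rw [List.mem_take_iff_getElem] at h
              obtain ⟨j, hj, hj'⟩ := h
              have := ((hS.nodup v).getElem_inj_iff).1 hj'
              omega
          · rw [g 12 (by norm_num), q12]; omega
          · rw [g 11 (by norm_num), g 12 (by norm_num), q11, q12]; omega
        · have ht2 : (Expr.bin .lt (.reg 11) (.reg 13)).eval w s₁ = 0 := by
            rw [eval_lt_eq_zero hw1]
            simp only [Expr.eval, q11, q13]; omega
          rw [Cmd.run_cond_neg ht2, Cmd.run] at e2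
          rw [e2] at rr
          refine ⟨_, _, rr, ⟨k + 1, q0, q6, q7, q10, ?_, ?_, ?_, ?_, ia0, ia1, io, ?_, ?_⟩, ?_⟩
          · rw [q11]; exact i11
          · rw [q11, q12]; omega
          · rw [q11]; omega
          · rw [q12]; omega
          · rw [q11, s₁p, seenColumns_succ_of_not_lt hk hvu]; exact iI
          · rw [q17, q12]; omega
          · rw [q11, q12]; omega
      · have hte : (Expr.bin .lt (.reg 12)
            (.read 0 (.bin .add (.reg 11) (.const 1)))).eval w s = 0 := by
          rw [htest]; omega
        have rr := (show (Cmd.set 11 (.bin .add (.reg 11) (.const 1))).LoopFree from trivial).runs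
          (w := w) s
        rw [show (Cmd.set 11 (.bin .add (.reg 11) (.const 1))).run w s =
          ⟨update s.reg 11 (v + 1), s.arr, s.out⟩ by
            simp [Cmd.run, Expr.eval, BinOp.apply, ← hv, h11', hv1]] at rr
        refine ⟨_, _, Runs.cond_false hte rr, ⟨0, ?_, ?_, ?_, ?_, ?_, ?_, ?_, ?_, ia0, ia1, io,
          ?_, ?_⟩, ?_⟩
        · simp [i0]
        · simp [i6]
        · simp [i7]
        · simp [i10]
        · simp; omega
        · simp [i12, hst, hk]
        · simp
        · simpa using im
        · simp only [update_self]
          rw [← seenColumns_length, ← hk]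
          exact iI
        · simpa using ic
        · simp [Cmd.size]; omega) s
    ⟨0, h0, h6, h7, h10, by omega, by rw [h12, h11, hS.start_zero], by omega, by omega, ha0, ha1,
      rfl, by
        rw [hp, h11]
        convert inv_init n α β T using 2
        simp [seenColumns], by
        have : s.reg 17 = 0 := congrArg Parser.cnt hp
        omega⟩
  rw [eval_lt_eq_zero hw1] at e
  simp only [Expr.eval, i0] at e
  have e11 : s'.reg 11 = n := le_antisymm i11 e
  refine ⟨s', r.mono (by simp only [h11, h12]; omega), i0, io, ?_, ?_⟩
  · have hl : seenColumns nb n k = seenColumns nb n 0 := by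
      funext u
      refine Finset.filter_congr fun v' hv' => ?_
      simp only [List.take_zero, List.not_mem_nil, and_false, or_false, or_iff_left_iff_imp]
      rintro ⟨rfl, h⟩
      have := hS.lt _ _ (List.mem_of_mem_take h)
      rw [Finset.mem_range] at hv'
      omega
    rw [e11] at iI
    rw [← hl]
    exact iI
  · exact ic.trans im

theorem runs_closeAll {w n m α β T : ℕ} {E : ℕ → Finset ℕ} (hn : 2 ≤ n) (hw : n ^ 20 < 2 ^ w)
    (hm : m ≤ n ^ 2) {s : State} (h0 : s.reg 0 = n) (h13 : s.reg 13 = 0)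
    (hI : Inv n α β T s.parser E) (hc : s.parser.cnt ≤ m) :
    ∃ s', Runs w (.loop (.bin .lt (.reg 13) (.reg 0)) closeStep) s (10 * n + 1) s' ∧
      s'.reg 0 = n ∧ s'.out = s.out ∧ s'.parser = s.parser.closeAll n n := by
  have hpow : ∀ k ≤ 20, n ^ k < 2 ^ w := fun k hk =>
    lt_of_le_of_lt (Nat.pow_le_pow_right (by omega) hk) hw
  have hnn : n + n ≤ n ^ 2 := by nlinarith
  have hn2 : n ^ 2 < 2 ^ w := hpow 2 (by norm_num)
  have hw1 : 1 < 2 ^ w := by omega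
  have h11' : 1 % 2 ^ w = 1 := Nat.mod_eq_of_lt hw1
  have hn3 : n ^ 2 * n + n < 2 ^ w := by
    refine lt_of_le_of_lt ?_ (hpow 4 (by norm_num))
    calc n ^ 2 * n + n ≤ n ^ 2 * n + n ^ 2 * n := by nlinarith
      _ = n ^ 3 * 2 := by ring
      _ ≤ n ^ 3 * n := by gcongr
      _ = n ^ 4 := by ring
  obtain ⟨s', r, ⟨i0, i13, io, ip⟩, e⟩ :=
    Runs.loop (w := w) (e := .bin .lt (.reg 13) (.reg 0)) (p := closeStep)
    (fun s' => s'.reg 0 = n ∧ s'.reg 13 ≤ n ∧ s'.out = s.out ∧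
      s'.parser = s.parser.closeAll n (s'.reg 13))
    (fun s' => 10 * (n - s'.reg 13)) (by
      rintro s' ⟨i0, i13, io, ip⟩ he
      rw [Ne, eval_lt_eq_zero hw1] at he
      simp only [Expr.eval, i0, not_le] at he
      have rr := (show closeStep.LoopFree by
        simp [closeStep, closeCmd, Cmd.LoopFree]).runs (w := w) s'
      have hnode : s'.arr 4 = s.arr 4 := by
        have := congrArg Parser.node ip
        rw [(closeAll_frame n s.parser _).1] at this
        exact this
      have hnd : s'.arr 4 (s'.reg 13) ≤ n ^ 2 := by
        rw [hnode]; exact (hI.bounds.1 _).trans (hc.trans hm)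
      have hrc : ∀ x, s'.arr 9 x ≤ n := by
        intro x
        have := hI.rc_closeAll_le i13 x
        rw [← ip] at this
        exact this
      have hmul : s'.arr 4 (s'.reg 13) * n ≤ n ^ 2 * n := Nat.mul_le_mul_right _ hnd
      obtain ⟨g1, g2⟩ := run_closeCmd (w := w) (s := s')
        (by rw [i0]; have := hrc (s'.arr 4 (s'.reg 13)); omega)
        (by have := hrc (s'.arr 4 (s'.reg 13)); omega)
      set s₁ := closeCmd.run w s' with hs₁
      have q13 := g2.1 13 (by norm_num)
      have hv1 : (s'.reg 13 + 1) % 2 ^ w = s'.reg 13 + 1 := Nat.mod_eq_of_lt (by omega)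
      have e1 : closeStep.run w s' = ⟨update s₁.reg 13 (s'.reg 13 + 1), s₁.arr, s₁.out⟩ := by
        rw [show closeStep.run w s' =
          (Cmd.set 13 (.bin .add (.reg 13) (.const 1))).run w s₁ from rfl]
        simp [Cmd.run, Expr.eval, BinOp.apply, q13, h11', hv1]
      rw [e1] at rr
      refine ⟨_, _, rr, ⟨?_, ?_, ?_, ?_⟩, ?_⟩
      · simp [g2.1 0 (by norm_num), i0]
      · simp; omega
      · exact g2.2.2.2.trans io
      · rw [i0, ip] at g1
        simp only [update_self]
        rw [Parser.closeAll, ← g1]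
        simp [State.parser]
      · simp [closeStep, closeCmd, Cmd.size]; omega) s
    ⟨h0, by omega, rfl, by rw [h13]; rfl⟩
  rw [eval_lt_eq_zero hw1] at e
  simp only [Expr.eval, i0] at e
  have e13 : s'.reg 13 = n := le_antisymm i13 e
  rw [e13] at ip
  exact ⟨s', r.mono (by simp only [h13]; omega), i0, io, ip⟩

end WordRAM

/-! ### The output phase, and the run of the whole program. -/

namespace WordRAM

open Function Parser

/-- Following the parents emits the labels in the order of `L`; the test on the node number fails
exactly at the root `0`. -/
theorem runs_emitPath {w n α β T : ℕ} {c : Parser} {L : ℕ → List ℕ} (hL : TrieInv n α β T c L)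
    {s : State} (hp : s.parser = c) (hx : s.reg 16 ≤ c.cnt) :
    ∃ s', Runs w (.loop (.reg 16) (.seq (.emit (.read 7 (.reg 16))) (.set 16 (.read 6 (.reg 16)))))
        s (4 * (L (s.reg 16)).length + 1) s' ∧
      s'.parser = c ∧ s'.reg 0 = s.reg 0 ∧ s'.reg 15 = s.reg 15 ∧
      s'.out = s.out ++ L (s.reg 16) := by
  obtain ⟨s', r, ⟨ip, i0, i15, i16, io⟩, e⟩ := Runs.loop (w := w) (e := .reg 16)
    (p := .seq (.emit (.read 7 (.reg 16))) (.set 16 (.read 6 (.reg 16))))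
    (fun s' => s'.parser = c ∧ s'.reg 0 = s.reg 0 ∧ s'.reg 15 = s.reg 15 ∧ s'.reg 16 ≤ c.cnt ∧
      s'.out ++ L (s'.reg 16) = s.out ++ L (s.reg 16))
    (fun s' => 4 * (L (s'.reg 16)).length) (by
      rintro s' ⟨ip, i0, i15, i16, io⟩ he
      have h1 : 1 ≤ s'.reg 16 := Nat.one_le_iff_ne_zero.2 he
      have hpath := hL.path _ h1 i16
      have hlt := hL.par_lt _ h1 i16
      have a6 : s'.arr 6 (s'.reg 16) = c.par (s'.reg 16) := by rw [← ip]; rfl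
      have a7 : s'.arr 7 (s'.reg 16) = c.lab (s'.reg 16) := by rw [← ip]; rfl
      refine ⟨_, _, Cmd.LoopFree.runs (p := .seq (.emit (.read 7 (.reg 16)))
        (.set 16 (.read 6 (.reg 16)))) ⟨trivial, trivial⟩ s', ?_, ?_⟩
      · simp only [Cmd.run, Expr.eval, a6, a7, update_self]
        refine ⟨?_, ?_, ?_, by omega, ?_⟩
        · rw [← ip]; simp [State.parser]
        · simpa using i0
        · simpa using i15
        · rw [← io, hpath]; simp
      · simp only [Cmd.run, Expr.eval, a6, update_self, hpath, Cmd.size, List.length_cons]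
        omega) s ⟨hp, rfl, rfl, hx, rfl⟩
  have e' : s'.reg 16 = 0 := e
  rw [e', hL.root, List.append_nil] at io
  exact ⟨s', r, ip, i0, i15, io⟩

theorem runs_emitRows {w n : ℕ} {c : Parser} {R : ℕ → List ℕ} (hR : RowsInv n c R)
    {s : State} (hp : s.parser = c) (h0 : s.reg 0 = n) (h5 : s.reg 5 = 0)
    (hw : (s.reg 15 + 1) * n + 1 < 2 ^ w) :
    ∃ s', Runs w (.loop (.bin .lt (.reg 5) (.read 9 (.reg 15)))
          (.seq (.emit (.read 10 (.bin .add (.bin .mul (.reg 15) (.reg 0)) (.reg 5))))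
            (.set 5 (.bin .add (.reg 5) (.const 1)))))
        s (4 * (R (s.reg 15)).length + 1) s' ∧
      s'.parser = c ∧ s'.reg 0 = s.reg 0 ∧ s'.reg 15 = s.reg 15 ∧
      s'.out = s.out ++ R (s.reg 15) := by
  have hw1 : 1 < 2 ^ w := by
    by_contra h
    have : (s.reg 15 + 1) * n = 0 := by omega
    simp only [mul_eq_zero, Nat.add_eq_zero_iff, one_ne_zero, and_false, false_or] at this
    have h2 : 2 ^ w = 1 := by have := Nat.one_le_two_pow (n := w); omega
    rw [this] at hw
    omega
  have h1' : 1 % 2 ^ w = 1 := Nat.mod_eq_of_lt hw1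
  set x := s.reg 15 with hx
  have hrc : c.rc x = (R x).length := hR.rc_eq x
  have hlen : (R x).length ≤ n := length_le_of_nodup_lt (hR.nodup x) (hR.lt x)
  rw [add_mul, one_mul] at hw
  obtain ⟨s', r, ⟨ip, i0, i15, i5, io⟩, e⟩ := Runs.loop (w := w)
    (e := .bin .lt (.reg 5) (.read 9 (.reg 15)))
    (p := .seq (.emit (.read 10 (.bin .add (.bin .mul (.reg 15) (.reg 0)) (.reg 5))))
            (.set 5 (.bin .add (.reg 5) (.const 1))))
    (fun s' => s'.parser = c ∧ s'.reg 0 = n ∧ s'.reg 15 = x ∧ s'.reg 5 ≤ (R x).length ∧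
      s'.out = s.out ++ (R x).take (s'.reg 5))
    (fun s' => 4 * ((R x).length - s'.reg 5)) (by
      rintro s' ⟨ip, i0, i15, i5, io⟩ he
      have a9 : s'.arr 9 x = c.rc x := by rw [← ip]; rfl
      rw [Ne, eval_lt_eq_zero hw1] at he
      simp only [Expr.eval, i15, a9, hrc, not_le] at he
      have a10 : s'.arr 10 (x * n + s'.reg 5) = (R x)[s'.reg 5] := by
        rw [← hR.rows_eq x _ he, ← ip]; rfl
      have m1 : (x * n + s'.reg 5) % 2 ^ w = x * n + s'.reg 5 := Nat.mod_eq_of_lt (by omega)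
      have m2 : (s'.reg 5 + 1) % 2 ^ w = s'.reg 5 + 1 := Nat.mod_eq_of_lt (by omega)
      refine ⟨_, _, Cmd.LoopFree.runs
        (p := .seq (.emit (.read 10 (.bin .add (.bin .mul (.reg 15) (.reg 0)) (.reg 5))))
            (.set 5 (.bin .add (.reg 5) (.const 1)))) ⟨trivial, trivial⟩ s', ?_, ?_⟩
      · simp only [Cmd.run, Expr.eval, BinOp.apply, i0, i15, Nat.mod_add_mod, m1, a10, h1', m2,
          update_self]
        refine ⟨?_, ?_, ?_, by omega, ?_⟩
        · rw [← ip]; simp [State.parser]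
        · simpa using i0
        · simpa using i15
        · rw [io, List.take_add_one, List.getElem?_eq_getElem he]; simp
      · simp only [Cmd.run, Expr.eval, BinOp.apply, h1', m2, update_self, Cmd.size]
        omega) s ⟨hp, h0, rfl, by omega, by simp [h5]⟩
  rw [eval_lt_eq_zero hw1] at e
  have a9 : s'.arr 9 x = c.rc x := by rw [← ip]; rfl
  simp only [Expr.eval, i15, a9, hrc] at e
  rw [List.take_of_length_le e] at io
  exact ⟨s', r.mono (by simp only [h5]; omega), ip, i0.trans h0.symm, i15, io⟩

theorem runs_outputStep {w n α β T : ℕ} {c : Parser} {E : ℕ → Finset ℕ} {L R : ℕ → List ℕ}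
    {cl : ℕ → ℕ} (h : Finished n α β T c E L R cl) {s : State} (hp : s.parser = c)
    (h0 : s.reg 0 = n) (hx : s.reg 15 ≤ c.cnt) (hw : (c.cnt + 1) * n + 1 < 2 ^ w)
    (hw' : c.cnt + 1 < 2 ^ w) :
    ∃ s', Runs w outputStep s
        (20 + if c.rc (s.reg 15) ≠ 0 then 4 * (c.dep (s.reg 15) + c.rc (s.reg 15)) else 0) s' ∧
      s'.parser = c ∧ s'.reg 0 = n ∧ s'.reg 15 = s.reg 15 + 1 ∧
      s'.out = s.out ++ if c.rc (s.reg 15) ≠ 0 then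
        c.dep (s.reg 15) :: c.rc (s.reg 15) :: (L (s.reg 15) ++ R (s.reg 15)) else [] := by
  set x := s.reg 15 with hxd
  have a9 : s.arr 9 x = c.rc x := by rw [← hp]; rfl
  have a8 : s.arr 8 x = c.dep x := by rw [← hp]; rfl
  have hw1 : 1 < 2 ^ w := by omega
  have h1' : 1 % 2 ^ w = 1 := Nat.mod_eq_of_lt hw1
  have m1 : (x + 1) % 2 ^ w = x + 1 := Nat.mod_eq_of_lt (by omega)
  have last : ∀ s₁ : State, s₁.parser = c → s₁.reg 0 = n → s₁.reg 15 = x →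
      ∃ s', Runs w (.set 15 (.bin .add (.reg 15) (.const 1))) s₁ 1 s' ∧
        s'.parser = c ∧ s'.reg 0 = n ∧ s'.reg 15 = x + 1 ∧ s'.out = s₁.out := by
    intro s₁ h1 h2 h3
    refine ⟨_, Cmd.LoopFree.runs (p := .set 15 (.bin .add (.reg 15) (.const 1))) trivial s₁, ?_⟩
    simp only [Cmd.run, Expr.eval, BinOp.apply, h3, h1', m1, update_self, and_true]
    refine ⟨?_, by simpa using h2⟩
    rw [← h1]; simp [State.parser]
  by_cases hr : c.rc x = 0
  · obtain ⟨s', r, h1, h2, h3, h4⟩ := last s hp h0 rfl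
    have he : (Expr.read 9 (.reg 15)).eval w s = 0 := by
      simpa only [Expr.eval, ← hxd, a9] using hr
    have rs : Runs w .skip s 1 s := Cmd.LoopFree.runs (p := .skip) trivial s
    exact ⟨s', ((Runs.cond_false he rs).seq r).mono (by omega), h1, h2, h3, by simp [h4, hr]⟩
  · have he : (Expr.read 9 (.reg 15)).eval w s ≠ 0 := by
      simpa only [Expr.eval, ← hxd, a9] using hr
    have r1 := Cmd.LoopFree.runs (w := w) (p := .emit (.read 8 (.reg 15))) trivial s
    set s₁ : State := ⟨s.reg, s.arr, s.out ++ [c.dep x]⟩ with hs₁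
    have e1 : (Cmd.emit (.read 8 (.reg 15))).run w s = s₁ := by
      simp [Cmd.run, Expr.eval, ← hxd, a8, hs₁]
    rw [e1] at r1
    have r2 := Cmd.LoopFree.runs (w := w) (p := .emit (.read 9 (.reg 15))) trivial s₁
    set s₂ : State := ⟨s.reg, s.arr, s.out ++ [c.dep x] ++ [c.rc x]⟩ with hs₂
    have e2 : (Cmd.emit (.read 9 (.reg 15))).run w s₁ = s₂ := by
      simp [Cmd.run, Expr.eval, hs₁, ← hxd, a9, hs₂]
    rw [e2] at r2
    have r3 := Cmd.LoopFree.runs (w := w) (p := .set 16 (.reg 15)) trivial s₂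
    set s₃ : State := ⟨update s.reg 16 x, s.arr, s.out ++ [c.dep x] ++ [c.rc x]⟩ with hs₃
    have e3 : (Cmd.set 16 (.reg 15)).run w s₂ = s₃ := by
      simp [Cmd.run, Expr.eval, hs₂, ← hxd, hs₃]
    rw [e3] at r3
    have p3 : s₃.parser = c := by rw [← hp]; simp [State.parser, hs₃]
    have q3 : s₃.reg 16 = x := by simp [hs₃]
    obtain ⟨s₄, r4, p4, q4, x4, o4⟩ := runs_emitPath (w := w) h.trie p3 (by rw [q3]; exact hx)
    rw [q3] at r4 o4
    have r5 := Cmd.LoopFree.runs (w := w) (p := .set 5 (.const 0)) trivial s₄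
    set s₅ : State := ⟨update s₄.reg 5 0, s₄.arr, s₄.out⟩ with hs₅
    have e5 : (Cmd.set 5 (.const 0)).run w s₄ = s₅ := by
      simp [Cmd.run, Expr.eval, hs₅]
    rw [e5] at r5
    have x5 : s₅.reg 15 = x := by
      simp only [hs₅, ne_eq, Nat.reduceEqDiff, not_false_eq_true, update_of_ne]
      rw [x4]
      simp [hs₃, hxd]
    have q5 : s₅.reg 0 = n := by
      have : s₃.reg 0 = n := by simp [hs₃, h0]
      simp [hs₅, q4, this]
    obtain ⟨s₆, r6, p6, q6, x6, o6⟩ := runs_emitRows (w := w) h.rows (s := s₅)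
      (by rw [← p4]; simp [State.parser, hs₅]) q5 (by simp [hs₅])
      (lt_of_le_of_lt (by rw [x5]; gcongr) hw)
    rw [x5] at r6 o6 x6
    obtain ⟨s', r7, h1, h2, h3, h4⟩ := last s₆ p6 (q6.trans q5) x6
    refine ⟨s', ((Runs.cond_true he (r1.seq (r2.seq (r3.seq (r4.seq (r5.seq r6)))))).seq r7).mono
      ?_, h1, h2, h3, ?_⟩
    · rw [if_pos hr, h.trie.dep_eq x hx, h.rows.rc_eq]
      simp only [Cmd.size]
      omega
    · rw [if_pos hr, h4, o6]
      simp only [hs₅]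
      rw [o4]
      simp [hs₃]

/-- The potential counts the remaining nodes and the vertices of their bicliques, so the time is
linear in the size of the trie plus the weight. -/
theorem runs_outputCmd {w n α β T : ℕ} {c : Parser} {E : ℕ → Finset ℕ} {L R : ℕ → List ℕ}
    {cl : ℕ → ℕ} (h : Finished n α β T c E L R cl) {s : State} (hp : s.parser = c)
    (h0 : s.reg 0 = n) (hw : (c.cnt + 1) * n + 1 < 2 ^ w) (hw' : c.cnt + 1 < 2 ^ w) :
    ∃ s', Runs w outputCmd s
        (21 * c.cnt + 4 * (c.used.map fun x => c.dep x + c.rc x).sum + 3) s' ∧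
      s'.out = s.out ++ c.used.flatMap fun x => c.dep x :: c.rc x :: (L x ++ R x) := by
  have hw1 : 1 < 2 ^ w := by omega
  have h1' : 1 % 2 ^ w = 1 := Nat.mod_eq_of_lt hw1
  have m1 : (c.cnt + 1) % 2 ^ w = c.cnt + 1 := Nat.mod_eq_of_lt hw'
  have r1 := Cmd.LoopFree.runs (w := w) (p := .set 15 (.const 1)) trivial s
  set s₁ : State := ⟨update s.reg 15 1, s.arr, s.out⟩ with hs₁
  have e1 : (Cmd.set 15 (.const 1)).run w s = s₁ := by
    simp [Cmd.run, Expr.eval, hs₁, h1']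
  rw [e1] at r1
  -- The used nodes that are still to be output when the loop stands at node `x`.
  set tail : ℕ → List ℕ := fun x =>
    (List.range' x (c.cnt + 1 - x)).filter fun x => c.rc x ≠ 0 with htail
  have htail_succ : ∀ x ≤ c.cnt, tail x = if c.rc x ≠ 0 then x :: tail (x + 1)
      else tail (x + 1) := by
    intro x hx
    simp only [htail]
    rw [show c.cnt + 1 - x = (c.cnt + 1 - (x + 1)) + 1 by omega, List.range'_succ,
      List.filter_cons]
    by_cases hr : c.rc x = 0 <;> simp [hr]
  have htail1 : tail 1 = c.used := by simp [htail, used]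
  set f : ℕ → List ℕ := fun x => c.dep x :: c.rc x :: (L x ++ R x) with hf
  obtain ⟨s', r, ⟨ip, i0, i1, i15, io⟩, e⟩ := Runs.loop (w := w)
    (e := .bin .lt (.reg 15) (.bin .add (.reg 17) (.const 1))) (p := outputStep)
    (fun s' => s'.parser = c ∧ s'.reg 0 = n ∧ 1 ≤ s'.reg 15 ∧ s'.reg 15 ≤ c.cnt + 1 ∧
      s'.out ++ (tail (s'.reg 15)).flatMap f = s.out ++ c.used.flatMap f)
    (fun s' => 21 * (c.cnt + 1 - s'.reg 15) +
      4 * ((tail (s'.reg 15)).map fun x => c.dep x + c.rc x).sum) (by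
      rintro s' ⟨ip, i0, i1, i15, io⟩ he
      have a17 : s'.reg 17 = c.cnt := by rw [← ip]; rfl
      rw [Ne, eval_lt_eq_zero hw1] at he
      simp only [Expr.eval, BinOp.apply, a17, h1', m1, not_le] at he
      obtain ⟨s₂, r, p2, q2, x2, o2⟩ := runs_outputStep (w := w) h ip i0 (by omega) hw hw'
      have ht := htail_succ (s'.reg 15) (by omega)
      refine ⟨_, s₂, r, ⟨p2, q2, by omega, by omega, ?_⟩, ?_⟩
      · rw [← io, o2, x2, ht]
        by_cases hr : c.rc (s'.reg 15) = 0
        · simp [hr]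
        · simp [hr, hf]
      · rw [x2, ht]
        by_cases hr : c.rc (s'.reg 15) = 0
        · simp only [hr, ne_eq, not_true_eq_false, if_false]; omega
        · simp only [hr, ne_eq, not_false_eq_true, if_true, List.map_cons, List.sum_cons]; omega)
    s₁ (by
      refine ⟨by rw [← hp]; simp [State.parser, hs₁], by simp [hs₁, h0], by simp [hs₁],
        by simp [hs₁], ?_⟩
      simp [hs₁, htail1])
  have a17 : s'.reg 17 = c.cnt := by rw [← ip]; rfl
  rw [eval_lt_eq_zero hw1] at e
  simp only [Expr.eval, BinOp.apply, a17, h1', m1] at e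
  have hnil : tail (s'.reg 15) = [] := by simp [htail, show c.cnt + 1 - s'.reg 15 = 0 by omega]
  rw [hnil] at io
  have x1 : s₁.reg 15 = 1 := by simp [hs₁]
  refine ⟨s', (r1.seq r).mono ?_, by simpa using io⟩
  simp only [x1, htail1, Cmd.size]
  omega

/-- The effect and the running time of the whole program. -/
theorem runs_bicliqueCmd {w n m : ℕ} {nb : ℕ → List ℕ} {s : State}
    (hS : StoresLists n m nb (s.arr 0) (s.arr 1)) (hn : 4 ≤ n) (hw : n ^ 20 < 2 ^ w)
    (hm : s.arr 0 n = m) (hmn : m ≤ n * (n - 1)) (h0 : s.reg 0 = n)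
    (hreg : ∀ i, i ≠ 0 → s.reg i = 0) (harr : ∀ a, 2 ≤ a → s.arr a = fun _ => 0)
    (hout : s.out = []) {p q α β T : ℕ} (hp : p = m / (n - 1)) (hq : q = n - p)
    (hα : α = costSum (n * n) p n) (hβ : β = costSum (n * n) q n) (hT : T = threshold n p q)
    (hαT : α ≤ T) :
    ∃ c L R cl s', Finished n α β T c (seenColumns nb n 0) L R cl ∧
      Runs w bicliqueCmd s
        (200 * (n + m) + 4 * (c.used.map fun x => c.dep x + c.rc x).sum) s' ∧
      s'.out = c.used.flatMap fun x => c.dep x :: c.rc x :: (L x ++ R x) := by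
  have hpow : ∀ k ≤ 20, n ^ k < 2 ^ w := fun k hk =>
    lt_of_le_of_lt (Nat.pow_le_pow_right (by omega) hk) hw
  have hm2 : m ≤ n ^ 2 := hmn.trans (by rw [pow_two]; exact Nat.mul_le_mul_left _ (Nat.sub_le n 1))
  have hpn : p ≤ n := by rw [hp]; exact Nat.div_le_of_le_mul (by rwa [mul_comm])
  have hqn : q ≤ n := by omega
  obtain ⟨s₁, r1, ⟨j0, j6, j7, j10⟩, ja, jo, j11, j12, j17⟩ :=
    runs_prepareCmd (s := s) (by omega) h0 hreg hw (by rwa [hm]) (by rw [hm]; exact hp) hq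
  have hcube : n ^ 3 * 4 ≤ n ^ 4 := by
    calc n ^ 3 * 4 ≤ n ^ 3 * n := Nat.mul_le_mul_left _ hn
      _ = n ^ 4 := by ring
  have hsq : n * n + 1 ≤ n * n * 2 := by nlinarith
  have hβ4 : β ≤ n ^ 4 := by
    rw [hβ]
    calc costSum (n * n) q n ≤ n * (n * n + 1) := costSum_le
      _ ≤ n * (n * n * 2) := Nat.mul_le_mul_left _ hsq
      _ = n ^ 3 * 2 := by ring
      _ ≤ n ^ 4 := by omega
  have hT4 : T ≤ n ^ 4 := by
    rw [hT]
    calc threshold n p q ≤ (phraseBound n p q + 1) * (n * n) := harmSum_le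
      _ ≤ (n + 1) * (n * n) := Nat.mul_le_mul_right _ (Nat.succ_le_succ (phraseBound_le hpn hqn))
      _ ≤ (2 * n) * (n * n) := Nat.mul_le_mul_right _ (by omega)
      _ = n ^ 3 * 2 := by ring
      _ ≤ n ^ 4 := by omega
  have hpar : s₁.parser = Parser.init := by
    unfold State.parser Parser.init
    rw [ja, j17, harr 2 le_rfl, harr 3 (by norm_num), harr 4 (by norm_num), harr 5 (by norm_num),
      harr 6 (by norm_num), harr 7 (by norm_num), harr 8 (by norm_num), harr 9 (by norm_num),
      harr 10 (by norm_num)]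
  obtain ⟨s₂, r2, k0, ko, kI, kc⟩ := runs_scan (w := w) (s := s₁) hS (by omega) hw hm2 hαT hT4 hβ4
    j0 (j6.trans hα.symm) (j7.trans hβ.symm) (j10.trans hT.symm) j11 j12 (by rw [ja]) (by rw [ja])
    hpar
  have r3 := Cmd.LoopFree.runs (w := w) (p := .set 13 (.const 0)) trivial s₂
  set s₃ : State := ⟨update s₂.reg 13 0, s₂.arr, s₂.out⟩ with hs₃
  have e3 : (Cmd.set 13 (.const 0)).run w s₂ = s₃ := by
    simp [Cmd.run, Expr.eval, hs₃]
  rw [e3] at r3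
  have p3 : s₃.parser = s₂.parser := by simp [State.parser, hs₃]
  obtain ⟨s₄, r4, l0, lo, lp⟩ := runs_closeAll (w := w) (s := s₃) (m := m) (by omega) hw hm2
    (by simp [hs₃, k0]) (by simp [hs₃]) (by rw [p3]; exact kI) (by rw [p3]; exact kc)
  rw [p3] at lp
  obtain ⟨L, R, cl, hF⟩ := kI.finished
  have hcnt : (s₂.parser.closeAll n n).cnt ≤ m := by
    rw [(closeAll_frame n s₂.parser n).2.2.2.2.2]
    exact kc
  obtain ⟨s₅, r5, o5⟩ := runs_outputCmd (w := w) hF lp l0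
    (by
      refine lt_of_le_of_lt ?_ (hpow 4 (by norm_num))
      calc ((s₂.parser.closeAll n n).cnt + 1) * n + 1 ≤ (n ^ 2 + 1) * n + 1 := by
            gcongr; omega
        _ = n ^ 3 + n + 1 := by ring
        _ ≤ n ^ 3 * 4 := by have := Nat.le_self_pow (n := 3) (by norm_num) n; omega
        _ ≤ n ^ 4 := hcube)
    (by
      refine lt_of_le_of_lt ?_ (hpow 3 (by norm_num))
      calc (s₂.parser.closeAll n n).cnt + 1 ≤ n ^ 2 + 1 := by omega
        _ ≤ n ^ 3 := by nlinarith)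
  refine ⟨_, L, R, cl, s₅, hF, (r1.seq ((r2.seq (r3.seq r4)).seq r5)).mono ?_, ?_⟩
  · simp only [Cmd.size]
    omega
  · rw [o5, lo, hs₃, ko, jo, hout, List.nil_append]

end WordRAM

/-! ### From adjacency lists to the input of the parser. -/

/-- The list of neighbours of `v`, as natural numbers. -/
def neighborList {n : ℕ} (adj : Fin n → List (Fin n)) (v : ℕ) : List ℕ :=
  if h : v < n then (adj ⟨v, h⟩).map Fin.val else []

section

variable {n : ℕ} {G : SimpleGraph (Fin n)} {adj : Fin n → List (Fin n)}

theorem mem_neighborList (h : IsAdjacencyList G adj) {u v : Fin n} :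
    u.val ∈ neighborList adj v ↔ G.Adj v u := by
  rw [neighborList, dif_pos v.2, ← (h v).2 u]
  simp [Fin.val_inj]

theorem take_succ_ofFn_flatten {v : ℕ} (hv : v < n) :
    ((List.ofFn adj).take (v + 1)).flatten = ((List.ofFn adj).take v).flatten ++ adj ⟨v, hv⟩ := by
  rw [List.take_add_one, List.getElem?_eq_getElem (by simpa using hv)]
  simp

theorem adjacencyInput_arr_zero {v : ℕ} (hv : v ≤ n) :
    (adjacencyInput adj).arr 0 v = ((List.ofFn adj).take v).flatten.length := by
  simp [adjacencyInput, hv]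

theorem length_flatten_ofFn (h : IsAdjacencyList G adj) :
    (List.ofFn adj).flatten.length = 2 * G.edgeSet.ncard := by
  classical
  have h1 : ∀ v, (adj v).length = G.degree v := by
    intro v
    rw [← List.toFinset_card_of_nodup (h v).1, ← SimpleGraph.card_neighborFinset_eq_degree]
    congr 1
    ext u
    simp [(h v).2 u]
  rw [List.length_flatten, List.map_ofFn, List.sum_ofFn]
  simp only [Function.comp, h1]
  rw [SimpleGraph.sum_degrees_eq_twice_card_edges, Set.ncard_eq_toFinset_card']
  rfl

theorem ncard_edgeSet_le (G : SimpleGraph (Fin n)) : G.edgeSet.ncard ≤ n.choose 2 := by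
  classical
  have := G.card_edgeFinset_le_card_choose_two
  rw [Fintype.card_fin] at this
  rw [Set.ncard_eq_toFinset_card']
  exact this

theorem storesLists (h : IsAdjacencyList G adj) :
    StoresLists n (2 * G.edgeSet.ncard) (neighborList adj) ((adjacencyInput adj).arr 0)
      ((adjacencyInput adj).arr 1) := by
  have hsucc : ∀ v < n, (adjacencyInput adj).arr 0 (v + 1) =
      (adjacencyInput adj).arr 0 v + (neighborList adj v).length := by
    intro v hv
    rw [adjacencyInput_arr_zero hv, adjacencyInput_arr_zero hv.le, take_succ_ofFn_flatten hv,
      List.length_append, neighborList, dif_pos hv, List.length_map]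
  have hle : ∀ v ≤ n, (adjacencyInput adj).arr 0 v ≤ 2 * G.edgeSet.ncard := by
    intro v hv
    rw [adjacencyInput_arr_zero hv, ← length_flatten_ofFn h]
    conv_rhs => rw [← List.take_append_drop v (List.ofFn adj), List.flatten_append,
      List.length_append]
    exact Nat.le_add_right _ _
  refine ⟨?_, ?_, ?_, hsucc, ?_, ?_⟩
  · intro v
    unfold neighborList
    split_ifs with hv
    · exact (h _).1.map Fin.val_injective
    · exact List.nodup_nil
  · intro v u hu
    unfold neighborList at hu
    split_ifs at hu with hv
    · obtain ⟨a, -, rfl⟩ := List.mem_map.1 hu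
      exact a.2
    · simp at hu
  · simp [adjacencyInput]
  · intro v hv
    rcases hv.lt_or_eq with hv' | rfl
    · rw [← hsucc v hv']
      exact hle _ hv'
    · have : neighborList adj v = [] := by simp [neighborList]
      rw [this]
      exact hle v le_rfl
  · intro v k hk
    have hv : v < n := by
      by_contra hv
      simp [neighborList, hv] at hk
    have hsplit : (List.ofFn adj).flatten = ((List.ofFn adj).take v).flatten ++
        (adj ⟨v, hv⟩ ++ ((List.ofFn adj).drop (v + 1)).flatten) := by
      rw [← List.append_assoc, ← take_succ_ofFn_flatten hv, ← List.flatten_append,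
        List.take_append_drop]
    rw [adjacencyInput_arr_zero hv.le]
    have hk' : k < (adj ⟨v, hv⟩).length := by simpa [neighborList, hv] using hk
    simp only [adjacencyInput, one_ne_zero, if_false, if_true]
    rw [hsplit, List.map_append, List.getD_eq_getElem?_getD,
      List.getElem?_append_right (by rw [List.length_map]; exact Nat.le_add_right _ _),
      List.length_map, Nat.add_sub_cancel_left,
      List.map_append, List.getElem?_append_left (by simpa using hk')]
    simp [neighborList, hv, hk']

theorem mem_seenColumns_neighborList (h : IsAdjacencyList G adj) (u v : Fin n) :
    v.val ∈ seenColumns (neighborList adj) n 0 u ↔ v < u ∧ G.Adj u v := by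
  simp [seenColumns, mem_neighborList h, G.adj_comm]

/-- Each edge is counted once, at its larger endpoint. -/
theorem sum_card_seenColumns (h : IsAdjacencyList G adj) :
    ∑ u ∈ Finset.range n, (seenColumns (neighborList adj) n 0 u).card = G.edgeSet.ncard := by
  classical
  have hcard : ∀ u : Fin n, (seenColumns (neighborList adj) n 0 u).card =
      (Finset.univ.filter fun v => v < u ∧ G.Adj u v).card := by
    intro u
    rw [← Finset.card_map Fin.valEmbedding]
    congr 1
    ext v
    simp only [Finset.mem_map, Finset.mem_filter, Finset.mem_univ, true_and,
      Fin.valEmbedding_apply]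
    constructor
    · intro hv
      have hvn : v < n := (Finset.mem_range.1 (Finset.mem_filter.1 hv).1).trans u.2
      exact ⟨⟨v, hvn⟩, (mem_seenColumns_neighborList h u ⟨v, hvn⟩).1 hv, rfl⟩
    · rintro ⟨v, hv, rfl⟩
      exact (mem_seenColumns_neighborList h u v).2 hv
  rw [Finset.sum_range]
  simp only [hcard]
  rw [← Finset.card_sigma, Set.ncard_eq_toFinset_card']
  refine Finset.card_bij (fun a _ => s(a.1, a.2)) ?_ ?_ ?_
  · rintro ⟨u, v⟩ ha
    simp only [Finset.mem_sigma, Finset.mem_univ, Finset.mem_filter, true_and] at ha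
    simpa using ha.2
  · rintro ⟨u, v⟩ ha ⟨u', v'⟩ ha' he
    simp only [Finset.mem_sigma, Finset.mem_univ, Finset.mem_filter, true_and] at ha ha'
    simp only [Sym2.eq_iff] at he
    rcases he with ⟨rfl, rfl⟩ | ⟨rfl, rfl⟩
    · rfl
    · exact absurd ha.1 (lt_asymm ha'.1)
  · intro e he
    induction e with
    | h u v =>
      simp only [Set.mem_toFinset, SimpleGraph.mem_edgeSet] at he
      rcases lt_trichotomy u v with hlt | heq | hlt
      · exact ⟨⟨v, u⟩, by simp [hlt, he.symm], Sym2.eq_swap⟩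
      · exact absurd heq he.ne
      · exact ⟨⟨u, v⟩, by simp [hlt, he], rfl⟩

/-- The output of the program on a graph with `m` edges, in terms of its parameters. -/
theorem exists_bicliqueCmd_output (h : IsAdjacencyList G adj) (hn : 4 ≤ n) {m : ℕ}
    (hm : G.edgeSet.ncard = m) {w : ℕ} (hw : n ^ 20 < 2 ^ w) {p q α β T D : ℕ}
    (hp : p = 2 * m / (n - 1)) (hq : q = n - p)
    (hα : α = costSum (n * n) p n) (hβ : β = costSum (n * n) q n) (hT : T = threshold n p q)
    (hαT : α ≤ T) {M x y : ℝ} (hM0 : 0 ≤ M) (hx : 0 ≤ x) (hy : 0 ≤ y) (hxy : x + y = 1)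
    (hM : ∀ i z : ℕ, α * i + β * z ≤ T → 1 ≤ M * (x ^ i * y ^ z))
    (hD : ∀ i z : ℕ, α * i + β * z ≤ T → i + z ≤ D) :
    ∃ (o : List ℕ) (P : List (Finset (Fin n) × Finset (Fin n))) (S : ℕ),
      WordRAM.HaltsWithin w WordRAM.bicliqueCmd (adjacencyInput adj)
        (200 * (n + 2 * m) + 4 * bicliqueWeight P) o ∧
      IsBicliqueOutput o P ∧ IsBicliquePartition G P ∧
      (bicliqueWeight P : ℝ) ≤ n * D * M * D + S + n ∧
      S * (T - α) ≤ α * m + β * (n.choose 2 - m) := by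
  have hlen : (adjacencyInput adj).arr 0 n = 2 * m := by
    rw [adjacencyInput_arr_zero le_rfl, List.take_of_length_le (by simp), length_flatten_ofFn h, hm]
  have hle : m ≤ n.choose 2 := hm ▸ ncard_edgeSet_le G
  have hmn : 2 * m ≤ n * (n - 1) := by
    rw [Nat.choose_two_right] at hle
    have := Nat.div_mul_le_self (n * (n - 1)) 2
    omega
  have hS := storesLists h
  rw [hm] at hS
  obtain ⟨c, L, R, cl, s', hF, hr, ho⟩ := WordRAM.runs_bicliqueCmd hS hn hw hlen hmn
    (by simp [adjacencyInput]) (fun i hi => by simp [adjacencyInput, hi])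
    (fun a ha => by
      funext i
      simp [adjacencyInput, show a ≠ 0 by omega, show a ≠ 1 by omega]) rfl hp hq hα hβ hT hαT
  -- `S` counts the closings during the scan; those at the end are the summand `n`.
  refine ⟨_, _, ∑ u ∈ Finset.range n, cl u, ?_, ⟨Parser.bicliques n c L R, hF.nodup_bicliques,
    hF.encode_bicliques.symm, rfl⟩,
    hF.isBicliquePartition (mem_seenColumns_neighborList h), ?_, ?_⟩
  · rw [← ho, hF.bicliqueWeight_eq]
    exact hr.haltsWithin
  · rw [hF.bicliqueWeight_eq]
    have h1 : ((c.used.map fun x => c.dep x + c.rc x).sum : ℝ) ≤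
        c.cnt * D + (∑ u ∈ Finset.range n, cl u : ℕ) + n := by
      exact_mod_cast hF.weight_le hD
    have h2 := hF.trie.cnt_le hM0 hx hy hxy hM hD
    refine h1.trans ?_
    gcongr
  · refine hF.charge_sum (fun u => ?_) ?_
    · exact (Finset.card_filter_le _ _).trans (by simp)
    · rw [sum_card_seenColumns h, hm]

end

/-! ### Comparison of the integer sums with logarithms. -/

section Harmonic

open Finset

/-- Telescoping of `log ((i + 1) / i) ≤ 1 / i`. The shifted counterpart below telescopes `1 / (i +
1) ≤ log ((i + 1) / i)`. -/
theorem log_div_le_sum_inv {a b : ℕ} (ha : 1 ≤ a) (hab : a ≤ b) :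
    Real.log (b / a) ≤ ∑ i ∈ Ico a b, (1 : ℝ) / i := by
  have ha' : (0 : ℝ) < a := by exact_mod_cast ha
  induction b, hab using Nat.le_induction with
  | base => simp [ha'.ne']
  | succ b hb ih =>
    have hb' : (0 : ℝ) < b := ha'.trans_le (by exact_mod_cast hb)
    rw [sum_Ico_succ_top hb]
    have h1 : Real.log ((b + 1 : ℕ) / a) = Real.log (b / a) + Real.log ((b + 1) / b) := by
      rw [← Real.log_mul (by positivity) (by positivity)]
      congr 1
      push_cast
      field_simp
    have h2 : Real.log (((b : ℝ) + 1) / b) ≤ 1 / b := by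
      refine (Real.log_le_sub_one_of_pos (by positivity)).trans (le_of_eq ?_)
      field_simp
      ring
    rw [h1]
    linarith

theorem sum_inv_le_log_div {a b : ℕ} (ha : 1 ≤ a) (hab : a ≤ b) :
    ∑ i ∈ Ico (a + 1) (b + 1), (1 : ℝ) / i ≤ Real.log (b / a) := by
  have ha' : (0 : ℝ) < a := by exact_mod_cast ha
  induction b, hab using Nat.le_induction with
  | base => simp [ha'.ne']
  | succ b hb ih =>
    have hb' : (0 : ℝ) < b := ha'.trans_le (by exact_mod_cast hb)
    rw [sum_Ico_succ_top (by omega)]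
    have h1 : Real.log ((b + 1 : ℕ) / a) = Real.log (b / a) + Real.log ((b + 1) / b) := by
      rw [← Real.log_mul (by positivity) (by positivity)]
      congr 1
      push_cast
      field_simp
    have h2 : 1 / ((b + 1 : ℕ) : ℝ) ≤ Real.log (((b : ℝ) + 1) / b) := by
      refine le_trans (le_of_eq ?_) (Real.one_sub_inv_le_log_of_pos (by positivity))
      push_cast
      field_simp
      ring
    rw [h1]
    linarith

theorem cast_div_le_one_div (K i : ℕ) : ((K / i : ℕ) : ℝ) ≤ K * (1 / i) := by
  rw [mul_one_div]
  exact Nat.cast_div_le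

theorem le_cast_div_add_one (K : ℕ) {i : ℕ} (hi : 1 ≤ i) : (K : ℝ) * (1 / i) ≤ (K / i : ℕ) + 1 := by
  have hi' : (0 : ℝ) < i := by exact_mod_cast hi
  rw [mul_one_div, div_le_iff₀ hi']
  have := (Nat.lt_div_mul_add (a := K) (b := i) hi).le
  have h2 : (K : ℝ) ≤ (K / i : ℕ) * i + i := by exact_mod_cast this
  linarith

theorem costSum_eq {K p n : ℕ} (hp : 1 ≤ p) : costSum K p n = ∑ i ∈ Ico p n, (K / i + 1) := by
  unfold costSum
  rw [← sum_subset (Ico_subset_Ico_left hp)]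
  · refine sum_congr rfl fun i hi => if_neg (not_lt.2 (mem_Ico.1 hi).1)
  · intro i hi hi'
    rw [mem_Ico] at hi hi'
    exact if_pos (by omega)

/-- The `+ 1` in each term of `costSum` outweighs the rounding in `K / i`. Costs are therefore never
below the true logarithms, which `Params.kraft` needs. -/
theorem mul_log_le_costSum {K p n : ℕ} (hp : 1 ≤ p) (hpn : p ≤ n) :
    (K : ℝ) * Real.log (n / p) ≤ costSum K p n := by
  rw [costSum_eq hp]
  refine (mul_le_mul_of_nonneg_left (log_div_le_sum_inv hp hpn) (Nat.cast_nonneg K)).trans ?_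
  rw [mul_sum]
  push_cast
  refine sum_le_sum fun i hi => ?_
  exact_mod_cast le_cast_div_add_one K (hp.trans (mem_Ico.1 hi).1)

theorem costSum_le_mul_log {K p n : ℕ} (hp : 1 ≤ p) (hpn : p ≤ n) :
    (costSum K p n : ℝ) ≤ K * (1 / p + Real.log (n / p)) + n := by
  rw [costSum_eq hp]
  have hp' : (0 : ℝ) < p := by exact_mod_cast hp
  have h1 : ∑ i ∈ Ico p n, (1 : ℝ) / i ≤ 1 / p + Real.log (n / p) := by
    calc ∑ i ∈ Ico p n, (1 : ℝ) / i ≤ ∑ i ∈ Ico p (n + 1), (1 : ℝ) / i :=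
          sum_le_sum_of_subset_of_nonneg (Ico_subset_Ico_right (Nat.le_succ n))
            fun i _ _ => by positivity
      _ = 1 / p + ∑ i ∈ Ico (p + 1) (n + 1), (1 : ℝ) / i :=
          sum_eq_sum_Ico_succ_bot (by omega) _
      _ ≤ _ := by gcongr; exact sum_inv_le_log_div hp hpn
  push_cast
  rw [sum_add_distrib]
  have h2 : ∑ i ∈ Ico p n, ((K / i : ℕ) : ℝ) ≤ K * (1 / p + Real.log (n / p)) := by
    refine le_trans ?_ (mul_le_mul_of_nonneg_left h1 (Nat.cast_nonneg K))
    rw [mul_sum]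
    exact sum_le_sum fun i _ => cast_div_le_one_div K i
  have h3 : ∑ i ∈ Ico p n, (1 : ℝ) ≤ n := by
    rw [sum_const, Nat.card_Ico, nsmul_eq_mul, mul_one]
    exact_mod_cast Nat.sub_le n p
  linarith

/-- Here all rounding is downwards, so the threshold stays at most `K log M`, the other half of
`Params.kraft`. -/
theorem harmSum_le_mul_log {K a b : ℕ} (ha : 1 ≤ a) (hab : a ≤ b) :
    (harmSum K (a + 1) (b + 1) : ℝ) ≤ K * Real.log (b / a) := by
  unfold harmSum
  push_cast
  refine le_trans ?_ (mul_le_mul_of_nonneg_left (sum_inv_le_log_div ha hab) (Nat.cast_nonneg K))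
  rw [mul_sum]
  exact sum_le_sum fun i _ => cast_div_le_one_div K i

theorem mul_log_le_harmSum {K a b : ℕ} (ha : 1 ≤ a) (hab : a ≤ b) :
    (K : ℝ) * Real.log (b / a) - b ≤ harmSum K a b := by
  have h1 := mul_le_mul_of_nonneg_left (log_div_le_sum_inv ha hab) (Nat.cast_nonneg (α := ℝ) K)
  have h2 : (K : ℝ) * ∑ i ∈ Ico a b, (1 : ℝ) / i ≤ ∑ i ∈ Ico a b, (((K / i : ℕ) : ℝ) + 1) := by
    rw [mul_sum]
    exact sum_le_sum fun i hi => le_cast_div_add_one K (ha.trans (mem_Ico.1 hi).1)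
  have h3 : ∑ i ∈ Ico a b, (1 : ℝ) ≤ b := by
    rw [sum_const, Nat.card_Ico, nsmul_eq_mul, mul_one]
    exact_mod_cast Nat.sub_le b a
  rw [sum_add_distrib] at h2
  unfold harmSum
  push_cast
  linarith

/-- One unit of the `+ 2` in `logBound` pays for the rounding inside the sum, the other for the
final division. -/
theorem log_le_logBound {n : ℕ} (hn : 2 ≤ n) : Real.log n ≤ logBound n := by
  have hn' : (0 : ℝ) < n := by positivity
  have h1 := mul_log_le_harmSum (K := n * n) (a := 1) (b := n) le_rfl (by omega)
  have h2 : (harmSum (n * n) 1 n : ℝ) ≤ (n * n : ℕ) * ((harmSum (n * n) 1 n / (n * n) : ℕ) + 1) := by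
    have := (Nat.lt_mul_div_succ (harmSum (n * n) 1 n) (b := n * n) (by positivity)).le
    exact_mod_cast this
  unfold logBound
  push_cast at h1 h2 ⊢
  rw [div_one] at h1
  have h3 : (n : ℝ) ≤ n * n := by exact_mod_cast Nat.le_mul_self n
  have h4 : (n : ℝ) * n * Real.log n ≤
      n * n * (((harmSum (n * n) 1 n / (n * n) : ℕ) : ℝ) + 2) := by
    linarith
  exact_mod_cast le_of_mul_le_mul_left h4 (by positivity)

theorem logBound_le_log {n : ℕ} (hn : 2 ≤ n) : (logBound n : ℝ) ≤ Real.log n + 3 := by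
  have hn' : (0 : ℝ) < n := by positivity
  have h1 := harmSum_le_mul_log (K := n * n) (a := 1) (b := n) le_rfl (by omega)
  have h2 : harmSum (n * n) 1 n ≤ n * n + harmSum (n * n) (1 + 1) (n + 1) := by
    unfold harmSum
    calc ∑ i ∈ Ico 1 n, n * n / i ≤ ∑ i ∈ Ico 1 (n + 1), n * n / i :=
          sum_le_sum_of_subset (Ico_subset_Ico_right (Nat.le_succ n))
      _ = _ := by rw [sum_eq_sum_Ico_succ_bot (by omega)]; simp
  have h3 : ((harmSum (n * n) 1 n / (n * n) : ℕ) : ℝ) ≤ Real.log n + 1 := by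
    refine Nat.cast_div_le.trans ?_
    rw [div_le_iff₀ (by positivity)]
    have h4 : (harmSum (n * n) 1 n : ℝ) ≤ (n * n + harmSum (n * n) (1 + 1) (n + 1) : ℕ) := by
      exact_mod_cast h2
    push_cast at h1 h4 ⊢
    rw [div_one] at h1
    linarith
  unfold logBound
  push_cast at h3 ⊢
  linarith

end Harmonic

/-! ### Entropy estimates, and the parameters of the algorithm. -/

/-- The binary entropy with natural logarithms. -/
noncomputable def natEntropy (x : ℝ) : ℝ := -x * Real.log x - (1 - x) * Real.log (1 - x)

/-- Lets error terms be measured against `γ (1 - γ)` instead of the entropy. -/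
theorem natEntropy_ge {x : ℝ} (h0 : 0 < x) (h1 : x < 1) : x * (1 - x) ≤ natEntropy x := by
  unfold natEntropy
  have h2 := Real.log_le_sub_one_of_pos h0
  have h3 := Real.log_nonpos (by linarith : (0 : ℝ) ≤ 1 - x) (by linarith)
  have h4 : x * Real.log x ≤ x * (x - 1) := mul_le_mul_of_nonneg_left h2 h0.le
  have h5 : (1 - x) * Real.log (1 - x) ≤ 0 := mul_nonpos_of_nonneg_of_nonpos (by linarith) h3
  nlinarith

/-- Used to bound the weight, and with it the output time, by a multiple of the number of edges. -/
theorem natEntropy_le {x : ℝ} (h1 : x < 1) :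
    natEntropy x ≤ x * (Real.log x⁻¹ + 1) := by
  unfold natEntropy
  have h2 := Real.one_sub_inv_le_log_of_pos (by linarith : 0 < 1 - x)
  have h3 : (1 - x) * (1 - (1 - x)⁻¹) ≤ (1 - x) * Real.log (1 - x) :=
    mul_le_mul_of_nonneg_left h2 (by linarith)
  have h4 : (1 - x) * (1 - (1 - x)⁻¹) = - x := by
    have : 1 - x ≠ 0 := by linarith
    field_simp
    ring
  rw [Real.log_inv]
  linarith

/-- Parameters of the algorithm for a graph with `n` vertices and density `γ`. -/
structure Params (n : ℕ) (γ : ℝ) (m p q : ℕ) : Prop where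
  hn : 4 ≤ n
  pos : 0 < γ
  lt_one : γ < 1
  two_le : 2 ≤ γ * n
  one_le : 1 ≤ (1 - γ) * n
  m_eq : (m : ℝ) = γ * n.choose 2
  p_eq : p = 2 * m / (n - 1)
  q_eq : q = n - p

namespace Params

variable {n m p q : ℕ} {γ : ℝ} (h : Params n γ m p q)

include h

/-- Because `2 m = γ n (n - 1)`, the number `p` is `γ n` rounded down. -/
theorem p_le : (p : ℝ) ≤ γ * n ∧ γ * n < p + 1 := by
  have hn := h.hn
  have h1 : (2 * m : ℝ) = γ * n * (n - 1 : ℕ) := by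
    rw [h.m_eq, Nat.cast_choose_two, Nat.cast_sub (by omega)]
    push_cast
    ring
  have h2 : (0 : ℝ) < (n - 1 : ℕ) := by exact_mod_cast (by omega : 0 < n - 1)
  rw [h.p_eq]
  constructor
  · have := Nat.div_mul_le_self (2 * m) (n - 1)
    have h3 : ((2 * m / (n - 1) : ℕ) : ℝ) * (n - 1 : ℕ) ≤ 2 * m := by exact_mod_cast this
    rw [h1] at h3
    exact le_of_mul_le_mul_right h3 h2
  · have := Nat.lt_mul_div_succ (2 * m) (b := n - 1) (by omega)
    have h3 : (2 * m : ℝ) < (n - 1 : ℕ) * (((2 * m / (n - 1) : ℕ) : ℝ) + 1) := by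
      exact_mod_cast this
    rw [h1, mul_comm] at h3
    exact lt_of_mul_lt_mul_left h3 h2.le

theorem one_le_p : 1 ≤ p := by
  have h1 := h.p_le.2
  have h2 := h.two_le
  have : (1 : ℝ) < p + 1 := by linarith
  have : 0 < p := by
    by_contra h0
    simp only [not_lt, nonpos_iff_eq_zero] at h0
    simp [h0] at this
  omega

theorem p_lt : p < n := by
  have h1 := h.p_le.1
  have h2 := h.one_le
  have : (p : ℝ) < n := by linarith
  exact_mod_cast this

theorem add_eq : (p : ℝ) + q = n := by
  have := h.p_lt
  rw [h.q_eq, Nat.cast_sub this.le]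
  ring

theorem q_ge : (1 - γ) * n ≤ q := by
  linarith [h.add_eq, h.p_le.1]

theorem one_le_q : 1 ≤ q := by
  have : (1 : ℝ) ≤ q := h.one_le.trans h.q_ge
  exact_mod_cast this

theorem q_le : (q : ℝ) ≤ 2 * ((1 - γ) * n) := by
  linarith [h.add_eq, h.p_le.2, h.one_le]

theorem q_le_n : q ≤ n := by rw [h.q_eq]; exact Nat.sub_le _ _

theorem p_ge : γ * n / 2 ≤ p := by
  linarith [h.p_le.2, h.two_le]

theorem mul_le : (p : ℝ) * q ≤ 2 * (γ * (1 - γ)) * n ^ 2 := by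
  calc (p : ℝ) * q ≤ (γ * n) * (2 * ((1 - γ) * n)) := by
        gcongr
        · linarith [h.two_le]
        · exact h.p_le.1
        · exact h.q_le
    _ = _ := by ring

theorem le_mul : γ * (1 - γ) * n ^ 2 / 2 ≤ (p : ℝ) * q := by
  calc γ * (1 - γ) * n ^ 2 / 2 = (γ * n / 2) * ((1 - γ) * n) := by ring
    _ ≤ (p : ℝ) * q := by
        gcongr
        · linarith [h.one_le]
        · exact h.p_ge
        · exact h.q_ge

theorem costSum_p_le :
    (costSum (n * n) p n : ℝ) ≤ n ^ 2 * (Real.log γ⁻¹ + 5 / (γ * n)) := by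
  have hn : (0 : ℝ) < n := by have := h.hn; positivity
  have hγ := h.pos
  have hp : (0 : ℝ) < p := by exact_mod_cast h.one_le_p
  have h1 := costSum_le_mul_log (K := n * n) h.one_le_p h.p_lt.le
  have h2 : 1 / (p : ℝ) ≤ 2 / (γ * n) := by
    rw [div_le_div_iff₀ hp (by positivity)]
    linarith [h.p_ge]
  have h3 : Real.log (n / p) ≤ Real.log γ⁻¹ + 1 / p := by
    have h4 : (n : ℝ) / p = γ⁻¹ * (γ * n / p) := by field_simp
    rw [h4, Real.log_mul (by positivity) (by positivity)]
    gcongr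
    refine (Real.log_le_sub_one_of_pos (by positivity)).trans ?_
    rw [sub_le_iff_le_add, div_le_iff₀ hp, add_mul, one_mul, one_div, inv_mul_cancel₀ hp.ne']
    linarith [h.p_le.2]
  have h5 : (n : ℝ) ≤ n ^ 2 * (1 / (γ * n)) := by
    rw [mul_one_div, le_div_iff₀ (by positivity)]
    nlinarith [h.lt_one, mul_pos hn hn]
  -- The parts come from the boundary term `1 / p`, from rounding `γ n` down to `p`, and from the `+
  -- 1` in every summand of `costSum`.
  have h6 : (5 : ℝ) / (γ * n) = 2 / (γ * n) + 2 / (γ * n) + 1 / (γ * n) := by ring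
  calc (costSum (n * n) p n : ℝ) ≤ (n * n : ℕ) * (1 / p + Real.log (n / p)) + n := h1
    _ ≤ (n * n : ℕ) * (2 / (γ * n) + (Real.log γ⁻¹ + 2 / (γ * n))) + n ^ 2 * (1 / (γ * n)) := by
        gcongr
        linarith
    _ = _ := by rw [h6]; push_cast; ring

/-- Rounding favours `q ≥ (1 - γ) n`, so only the boundary term and the `+ 1` terms are lost. -/
theorem costSum_q_le :
    (costSum (n * n) q n : ℝ) ≤ n ^ 2 * (Real.log (1 - γ)⁻¹ + 2 / ((1 - γ) * n)) := by
  have hn : (0 : ℝ) < n := by have := h.hn; positivity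
  have hγ : 0 < 1 - γ := by linarith [h.lt_one]
  have hq : (0 : ℝ) < q := by exact_mod_cast h.one_le_q
  have h1 := costSum_le_mul_log (K := n * n) h.one_le_q h.q_le_n
  have h2 : 1 / (q : ℝ) ≤ 1 / ((1 - γ) * n) := one_div_le_one_div_of_le (by positivity) h.q_ge
  have h3 : Real.log (n / q) ≤ Real.log (1 - γ)⁻¹ := by
    apply Real.log_le_log (by positivity)
    rw [div_le_iff₀ hq, inv_mul_eq_div, le_div_iff₀ hγ]
    linarith [h.q_ge]
  have h5 : (n : ℝ) ≤ n ^ 2 * (1 / ((1 - γ) * n)) := by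
    rw [mul_one_div, le_div_iff₀ (by positivity)]
    nlinarith [h.pos, mul_pos hn hn]
  have h6 : (2 : ℝ) / ((1 - γ) * n) = 1 / ((1 - γ) * n) + 1 / ((1 - γ) * n) := by ring
  calc (costSum (n * n) q n : ℝ) ≤ (n * n : ℕ) * (1 / q + Real.log (n / q)) + n := h1
    _ ≤ (n * n : ℕ) * (1 / ((1 - γ) * n) + Real.log (1 - γ)⁻¹) + n ^ 2 * (1 / ((1 - γ) * n)) := by
        gcongr
    _ = _ := by rw [h6]; push_cast; ring

/-- Weighting the two costs by `γ` and `1 - γ` produces the entropy; the errors `5 / (γ n)` and `2 /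
((1 - γ) n)` combine to `7 / n`. -/
theorem cost_total_le :
    (costSum (n * n) p n : ℝ) * m + costSum (n * n) q n * (n.choose 2 - m) ≤
      n ^ 2 * (n ^ 2 / 2 * (natEntropy γ + 7 / n)) := by
  have hn : (0 : ℝ) < n := by have := h.hn; positivity
  have hγ := h.pos
  have hγ' : 0 < 1 - γ := by linarith [h.lt_one]
  have hN : (n.choose 2 : ℝ) ≤ n ^ 2 / 2 := by
    rw [Nat.cast_choose_two]
    nlinarith
  have hH : 0 ≤ natEntropy γ := le_trans (by positivity) (natEntropy_ge h.pos h.lt_one)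
  calc _ ≤ n ^ 2 * (Real.log γ⁻¹ + 5 / (γ * n)) * (γ * n.choose 2) +
        n ^ 2 * (Real.log (1 - γ)⁻¹ + 2 / ((1 - γ) * n)) * ((1 - γ) * n.choose 2) := by
        rw [h.m_eq, show (n.choose 2 : ℝ) - γ * n.choose 2 = (1 - γ) * n.choose 2 by ring]
        gcongr
        · exact h.costSum_p_le
        · exact h.costSum_q_le
    _ = n ^ 2 * (n.choose 2 * (natEntropy γ + 7 / n)) := by
        unfold natEntropy
        rw [Real.log_inv, Real.log_inv]
        field_simp
        ring
    _ ≤ _ := by gcongr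

/-- The loss in the threshold. -/
theorem threshold_sub_ge :
    (n : ℝ) ^ 2 * (Real.log n -
      (4 * Real.log (γ * (1 - γ))⁻¹ + 4 * Real.log (Real.log n + 3) + 11)) ≤
      (threshold n p q : ℝ) - costSum (n * n) p n := by
  have hn4 := h.hn
  have hn : (0 : ℝ) < n := by positivity
  have hγ := h.pos
  have hγ' : 0 < 1 - γ := by linarith [h.lt_one]
  have hp : (0 : ℝ) < p := by exact_mod_cast h.one_le_p
  have hq : (0 : ℝ) < q := by exact_mod_cast h.one_le_q
  have hl : 0 ≤ Real.log n := Real.log_natCast_nonneg n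
  have hlb : (0 : ℝ) < logBound n := by
    have : 0 < logBound n := by unfold logBound; exact Nat.succ_pos _
    exact_mod_cast this
  set g := γ * (1 - γ) with hg
  have hgpos : 0 < g := by positivity
  set M := phraseBound n p q with hM
  have hMn : M ≤ n := phraseBound_le h.p_lt.le h.q_le_n
  have hX : ((p : ℝ) * q) ^ 3 / (n ^ 5 * logBound n ^ 4) ≤ M + 1 := by
    have := Nat.lt_mul_div_succ ((p * q) * (p * q) * (p * q))
      (b := n * ((n * n) * (n * n)) * (logBound n * logBound n * (logBound n * logBound n)))
      (by
        have h1 : 0 < logBound n := by exact_mod_cast hlb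
        have h2 : 0 < n := by omega
        positivity)
    rw [div_le_iff₀ (by positivity)]
    have h3 : ((p : ℝ) * q) * (p * q) * (p * q) <
        n * ((n * n) * (n * n)) * (logBound n * logBound n * (logBound n * logBound n)) *
          (M + 1) := by
      exact_mod_cast this
    nlinarith
  have h1 : Real.log (((p : ℝ) * q) ^ 3 / (n ^ 5 * logBound n ^ 4)) ≤ Real.log (M + 1) :=
    Real.log_le_log (by positivity) hX
  rw [Real.log_div (by positivity) (by positivity), Real.log_mul (by positivity) (by positivity),
    Real.log_pow, Real.log_pow, Real.log_pow] at h1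
  have hpq : Real.log g + 2 * Real.log n - Real.log 2 ≤ Real.log (p * q) := by
    have h2 := Real.log_le_log (by positivity) h.le_mul
    rw [Real.log_div (by positivity) (by norm_num), Real.log_mul (by positivity) (by positivity),
      Real.log_pow] at h2
    exact_mod_cast h2
  have hlog : Real.log (logBound n) ≤ Real.log (Real.log n + 3) :=
    Real.log_le_log hlb (logBound_le_log (by omega))
  have hl2 : Real.log 2 ≤ 1 := by have := Real.log_two_lt_d9; linarith
  have hT : (n : ℝ) ^ 2 * (Real.log (M + 1) - Real.log 2) - (n + 1) ≤ threshold n p q := by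
    rcases Nat.lt_or_ge (M + 1) 2 with hM1 | hM1
    · have h0 : M = 0 := by omega
      have : Real.log ((M : ℝ) + 1) = 0 := by simp [h0]
      rw [this]
      have h2 : (0 : ℝ) ≤ threshold n p q := Nat.cast_nonneg _
      have h3 : 0 ≤ Real.log 2 := Real.log_nonneg (by norm_num)
      nlinarith [mul_nonneg (sq_nonneg (n : ℝ)) h3]
    · have h2 := mul_log_le_harmSum (K := n * n) (a := 2) (b := M + 1) (by norm_num) hM1
      rw [Real.log_div (by positivity) (by norm_num)] at h2
      have h3 : ((M + 1 : ℕ) : ℝ) ≤ n + 1 := by exact_mod_cast Nat.succ_le_succ hMn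
      unfold threshold
      rw [← hM]
      push_cast at h2 h3 ⊢
      rw [pow_two]
      linarith
  have hn1 : (n : ℝ) + 1 ≤ n ^ 2 * 1 := by
    have : (4 : ℝ) ≤ n := by exact_mod_cast hn4
    nlinarith
  have hα := h.costSum_p_le
  have h5 : (5 : ℝ) / (γ * n) ≤ 5 / 2 := by
    have := h.two_le
    gcongr
  have hlogγ : Real.log γ⁻¹ ≤ Real.log g⁻¹ := by
    apply Real.log_le_log (by positivity)
    apply inv_anti₀ hgpos
    rw [hg]
    nlinarith
  have hginv : Real.log g⁻¹ = - Real.log g := Real.log_inv g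
  push_cast at h1
  -- `log (M + 1)` is at least `log n - 3 log g⁻¹ - 3 log 2 - 4 log (log n + 3)`. Subtracting `α`
  -- costs a fourth `log g⁻¹ ≥ log γ⁻¹` and at most `5 / 2`; the constant `11` absorbs all bounded
  -- losses.
  have key : Real.log n - (4 * Real.log g⁻¹ + 4 * Real.log (Real.log n + 3) + 11) ≤
      (Real.log (M + 1) - Real.log 2) - 1 - (Real.log γ⁻¹ + 5 / (γ * n)) := by
    linarith
  have := mul_le_mul_of_nonneg_left key (sq_nonneg (n : ℝ))
  linarith

/-- With costs rounded up and the threshold rounded down, the hypothesis gives `i log (n/p) + z log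
(n/q) ≤ log M` exactly; exponentiate. -/
theorem kraft {i z : ℕ}
    (hi : costSum (n * n) p n * i + costSum (n * n) q n * z ≤ threshold n p q)
    (hM : 1 ≤ phraseBound n p q) :
    1 ≤ (phraseBound n p q : ℝ) * ((p / n : ℝ) ^ i * (q / n : ℝ) ^ z) := by
  have hn4 := h.hn
  have hn : (0 : ℝ) < n := by positivity
  have hp : (0 : ℝ) < p := by exact_mod_cast h.one_le_p
  have hq : (0 : ℝ) < q := by exact_mod_cast h.one_le_q
  have hM' : (0 : ℝ) < phraseBound n p q := by exact_mod_cast hM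
  have h1 := mul_log_le_costSum (K := n * n) h.one_le_p h.p_lt.le
  have h2 := mul_log_le_costSum (K := n * n) h.one_le_q h.q_le_n
  have h3 := harmSum_le_mul_log (K := n * n) (a := 1) le_rfl hM
  have h4 : (costSum (n * n) p n : ℝ) * i + costSum (n * n) q n * z ≤ threshold n p q := by
    exact_mod_cast hi
  unfold threshold at h4
  rw [Nat.cast_one, div_one] at h3
  have h5 : ((n * n : ℕ) : ℝ) * (Real.log (n / p) * i + Real.log (n / q) * z) ≤
      (n * n : ℕ) * Real.log (phraseBound n p q) := by
    calc _ = ((n * n : ℕ) : ℝ) * Real.log (n / p) * i + (n * n : ℕ) * Real.log (n / q) * z := by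
          ring
      _ ≤ (costSum (n * n) p n : ℝ) * i + costSum (n * n) q n * z := by gcongr
      _ ≤ _ := h4.trans h3
  have h6 := le_of_mul_le_mul_left h5 (by push_cast; positivity)
  rw [← Real.log_nonneg_iff (by positivity), Real.log_mul (by positivity) (by positivity),
    Real.log_mul (by positivity) (by positivity), Real.log_pow, Real.log_pow]
  have h7 : Real.log (p / n) = - Real.log (n / p) := by rw [← Real.log_inv, inv_div]
  have h8 : Real.log (q / n) = - Real.log (n / q) := by rw [← Real.log_inv, inv_div]
  rw [h7, h8]
  linarith

/-- For `a + b = n`, the inequality `log (n/a) ≥ 1 - a/n = b/n` gives `n² log (n/a) ≥ n b ≥ a b`.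
This bounds the length of a phrase. -/
theorem min_cost_ge : (p : ℝ) * q ≤ min (costSum (n * n) p n) (costSum (n * n) q n) := by
  have hn4 := h.hn
  have hn : (0 : ℝ) < n := by positivity
  have hp : (0 : ℝ) < p := by exact_mod_cast h.one_le_p
  have hq : (0 : ℝ) < q := by exact_mod_cast h.one_le_q
  have key : ∀ a b : ℝ, 0 < a → 0 < b → a + b = n → a * b ≤ (n * n : ℕ) * Real.log (n / a) := by
    intro a b ha hb hab
    have h1 := Real.one_sub_inv_le_log_of_pos (x := n / a) (by positivity)
    have h2 : 1 - (n / a : ℝ)⁻¹ = b / n := by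
      rw [inv_div, ← hab]
      field_simp
      ring
    rw [h2] at h1
    calc a * b ≤ n * b := by gcongr; linarith
      _ = (n * n : ℕ) * (b / n) := by push_cast; field_simp
      _ ≤ _ := by gcongr
  rw [Nat.cast_min]
  refine le_min ?_ ?_
  · exact (key p q hp hq h.add_eq).trans (mul_log_le_costSum h.one_le_p h.p_lt.le)
  · rw [mul_comm]
    exact (key q p hq hp (by rw [add_comm]; exact h.add_eq)).trans
      (mul_log_le_costSum h.one_le_q h.q_le_n)

/-- This explains the exponents in `phraseBound`: from `D ≤ n² log n / (pq)` and `M ≤ (pq)³ / (n⁵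
log⁴ n)` it follows that `n D² M ≤ pq / log² n`. -/
theorem dictionary_le {D : ℕ}
    (hD : D = threshold n p q / min (costSum (n * n) p n) (costSum (n * n) q n))
    (hM : 1 ≤ phraseBound n p q) :
    (n : ℝ) * D * phraseBound n p q * D ≤ 2 * (γ * (1 - γ)) * n ^ 2 / Real.log n ^ 2 := by
  have hn4 := h.hn
  have hn : (0 : ℝ) < n := by positivity
  have hp : (0 : ℝ) < p := by exact_mod_cast h.one_le_p
  have hq : (0 : ℝ) < q := by exact_mod_cast h.one_le_q
  have hl : 0 < Real.log n := Real.log_pos (by exact_mod_cast (by omega : 1 < n))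
  have hlb := log_le_logBound (n := n) (by omega)
  have hlb0 : (0 : ℝ) < logBound n := hl.trans_le hlb
  set M := phraseBound n p q with hMd
  have hMn : (M : ℝ) ≤ n := by exact_mod_cast phraseBound_le h.p_lt.le h.q_le_n
  have hM0 : (0 : ℝ) < M := by exact_mod_cast hM
  have hT : (threshold n p q : ℝ) ≤ n ^ 2 * Real.log n := by
    have h3 := harmSum_le_mul_log (K := n * n) (a := 1) le_rfl hM
    rw [Nat.cast_one, div_one] at h3
    refine h3.trans ?_
    push_cast
    rw [pow_two]
    gcongr
  have hDr : (D : ℝ) ≤ n ^ 2 * Real.log n / (p * q) := by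
    rw [hD]
    refine Nat.cast_div_le.trans ?_
    exact div_le_div₀ (by positivity) hT (by positivity) h.min_cost_ge
  have hMr : (M : ℝ) ≤ ((p : ℝ) * q) ^ 3 / (n ^ 5 * Real.log n ^ 4) := by
    have h1 : (M : ℝ) ≤ ((p : ℝ) * q) ^ 3 / (n ^ 5 * logBound n ^ 4) := by
      rw [hMd]
      unfold phraseBound
      refine Nat.cast_div_le.trans (le_of_eq ?_)
      push_cast
      congr 1 <;> ring
    refine h1.trans ?_
    gcongr
  calc (n : ℝ) * D * M * D = n * M * D ^ 2 := by ring
    _ ≤ n * (((p : ℝ) * q) ^ 3 / (n ^ 5 * Real.log n ^ 4)) *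
        (n ^ 2 * Real.log n / (p * q)) ^ 2 := by gcongr
    _ = p * q / Real.log n ^ 2 := by
        field_simp
    _ ≤ _ := div_le_div_of_nonneg_right h.mul_le (by positivity)

end Params

theorem Params.exists_output {n m p q : ℕ} {γ : ℝ} (h : Params n γ m p q)
    {G : SimpleGraph (Fin n)} {adj : Fin n → List (Fin n)} (hadj : IsAdjacencyList G adj)
    (hm : G.edgeSet.ncard = m) {w : ℕ} (hw : n ^ 20 < 2 ^ w) {ρ : ℝ}
    (hρ : ρ = 4 * Real.log (γ * (1 - γ))⁻¹ + 4 * Real.log (Real.log n + 3) + 11)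
    (hρn : ρ < Real.log n) :
    ∃ (o : List ℕ) (P : List (Finset (Fin n) × Finset (Fin n))),
      WordRAM.HaltsWithin w WordRAM.bicliqueCmd (adjacencyInput adj)
        (200 * (n + 2 * m) + 4 * bicliqueWeight P) o ∧
      IsBicliqueOutput o P ∧ IsBicliquePartition G P ∧
      (bicliqueWeight P : ℝ) ≤ 2 * (γ * (1 - γ)) * n ^ 2 / Real.log n ^ 2 +
        n ^ 2 / 2 * (natEntropy γ + 7 / n) / (Real.log n - ρ) + n := by
  have hn4 := h.hn
  have hn : (0 : ℝ) < n := by positivity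
  have hp : (0 : ℝ) < p := by exact_mod_cast h.one_le_p
  have hq : (0 : ℝ) < q := by exact_mod_cast h.one_le_q
  have hsub := h.threshold_sub_ge
  rw [← hρ] at hsub
  have hpos : 0 < (n : ℝ) ^ 2 * (Real.log n - ρ) := mul_pos (by positivity) (by linarith)
  have hlt : costSum (n * n) p n < threshold n p q := by
    have : (costSum (n * n) p n : ℝ) < threshold n p q := by linarith
    exact_mod_cast this
  -- For `M = 0` the threshold would be `0` and could not exceed the cost of an entry.
  have hM : 1 ≤ phraseBound n p q := by
    by_contra h0
    have h0' : phraseBound n p q = 0 := by omega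
    have : threshold n p q = 0 := by simp [threshold, h0', harmSum]
    omega
  have hmin : 0 < min (costSum (n * n) p n) (costSum (n * n) q n) := by
    have : (0 : ℝ) < (min (costSum (n * n) p n) (costSum (n * n) q n) : ℕ) :=
      lt_of_lt_of_le (by positivity) h.min_cost_ge
    exact_mod_cast this
  obtain ⟨o, P, S, h1, h2, h3, h4, h5⟩ := exists_bicliqueCmd_output hadj hn4 hm hw h.p_eq h.q_eq rfl
    rfl rfl hlt.le (M := phraseBound n p q) (x := p / n) (y := q / n) (Nat.cast_nonneg _)
    (by positivity) (by positivity) (by rw [← add_div, h.add_eq, div_self hn.ne'])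
    (fun i z hi => h.kraft hi hM)
    -- The number of cells, entries or gaps, that the budget allows if all are charged the cheaper
    -- price.
    (D := threshold n p q / min (costSum (n * n) p n) (costSum (n * n) q n))
    (fun i z hi => by
      rw [Nat.le_div_iff_mul_le hmin]
      refine le_trans ?_ hi
      rw [add_mul, mul_comm i, mul_comm z]
      gcongr
      · exact min_le_left _ _
      · exact min_le_right _ _)
  refine ⟨o, P, h1, h2, h3, h4.trans ?_⟩
  have hle : m ≤ n.choose 2 := hm ▸ ncard_edgeSet_le G
  have h6 : (S : ℝ) * ((threshold n p q : ℝ) - costSum (n * n) p n) ≤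
      n ^ 2 * (n ^ 2 / 2 * (natEntropy γ + 7 / n)) := by
    refine le_trans ?_ h.cost_total_le
    rw [← Nat.cast_sub hlt.le, ← Nat.cast_sub hle]
    exact_mod_cast h5
  have h7 : (S : ℝ) ≤ n ^ 2 / 2 * (natEntropy γ + 7 / n) / (Real.log n - ρ) := by
    rw [le_div_iff₀ (by linarith)]
    have h8 : (n : ℝ) ^ 2 * (S * (Real.log n - ρ)) ≤
        n ^ 2 * (n ^ 2 / 2 * (natEntropy γ + 7 / n)) := by
      refine le_trans ?_ h6
      calc (n : ℝ) ^ 2 * (S * (Real.log n - ρ)) = S * (n ^ 2 * (Real.log n - ρ)) := by ring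
        _ ≤ _ := by gcongr
    exact le_of_mul_le_mul_left h8 (by positivity)
  gcongr
  exact h.dictionary_le rfl hM

/-! ### Asymptotics of the upper bound. -/

namespace IsAdmissible

variable {n : ℕ → ℕ} {γ : ℕ → ℝ} (h : IsAdmissible n γ)

include h

theorem tendsto_log : Tendsto (fun k => Real.log (n k)) atTop atTop :=
  Real.tendsto_log_atTop.comp (tendsto_natCast_atTop_atTop.comp h.tendsto)

/-- The hypothesis `n ^ o(1)` enters here: both `log γ⁻¹` and `log (1 - γ)⁻¹` are at most `e k * log
n`. -/
theorem tendsto_log_inv_div :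
    Tendsto (fun k => Real.log (γ k * (1 - γ k))⁻¹ / Real.log (n k)) atTop (𝓝 0) := by
  obtain ⟨e, he, hmax⟩ := h.subpolynomial
  have he2 : Tendsto (fun k => 2 * e k) atTop (𝓝 0) := by simpa using he.const_mul 2
  refine tendsto_of_tendsto_of_tendsto_of_le_of_le' tendsto_const_nhds he2 ?_ ?_
  · filter_upwards [h.mem_Ioo, h.tendsto_log.eventually_gt_atTop 0] with k hk hl
    have h1 : 0 < 1 - γ k := by linarith [hk.2]
    have h0 := hk.1
    refine div_nonneg (Real.log_nonneg ?_) hl.le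
    rw [one_le_inv₀ (by positivity)]
    nlinarith
  · filter_upwards [h.mem_Ioo, h.tendsto_log.eventually_gt_atTop 0, hmax,
      h.tendsto.eventually_gt_atTop 0] with k hk hl hm hn
    have h1 : 0 < 1 - γ k := by linarith [hk.2]
    have h0 := hk.1
    have hn' : (0 : ℝ) < n k := by exact_mod_cast hn
    rw [div_le_iff₀ hl, mul_inv, Real.log_mul (by positivity) (by positivity)]
    have h2 : Real.log ((n k : ℝ) ^ e k) = e k * Real.log (n k) := Real.log_rpow hn' _
    have h3 : Real.log (γ k)⁻¹ ≤ Real.log ((n k : ℝ) ^ e k) :=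
      Real.log_le_log (by positivity) (hm ▸ le_max_left _ _)
    have h4 : Real.log (1 - γ k)⁻¹ ≤ Real.log ((n k : ℝ) ^ e k) :=
      Real.log_le_log (by positivity) (hm ▸ le_max_right _ _)
    linarith

theorem tendsto_loss :
    Tendsto (fun k => (4 * Real.log (γ k * (1 - γ k))⁻¹ + 4 * Real.log (Real.log (n k) + 3) + 11) /
      Real.log (n k)) atTop (𝓝 0) := by
  have h1 : Tendsto (fun k => Real.log (Real.log (n k) + 3) / Real.log (n k)) atTop (𝓝 0) := by
    have h2 : (fun x : ℝ => Real.log (x + 3)) =o[atTop] fun x : ℝ => x := by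
      have h3 : (fun x : ℝ => Real.log (x + 3)) =o[atTop] fun x : ℝ => x + 3 :=
        Real.isLittleO_log_id_atTop.comp_tendsto (tendsto_atTop_add_const_right _ 3 tendsto_id)
      refine h3.trans_isBigO ?_
      refine (isBigO_refl _ _).add ?_
      exact (isLittleO_const_id_atTop (3 : ℝ)).isBigO
    exact h2.tendsto_div_nhds_zero.comp h.tendsto_log
  have h4 : Tendsto (fun k => 11 / Real.log (n k)) atTop (𝓝 0) :=
    h.tendsto_log.const_div_atTop 11
  have h5 := ((h.tendsto_log_inv_div.const_mul 4).add (h1.const_mul 4)).add h4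
  simp only [mul_zero, add_zero] at h5
  refine h5.congr fun k => ?_
  ring

/-- The left side is `√n`; eventually `log (γ (1 - γ))⁻¹` is below `(log n) / 2`. -/
theorem eventually_exp_le :
    ∀ᶠ k in atTop, Real.exp (Real.log (n k) / 2) ≤ n k * (γ k * (1 - γ k)) := by
  filter_upwards [h.mem_Ioo, h.tendsto_log.eventually_gt_atTop 0,
    h.tendsto_log_inv_div.eventually_lt_const (show (0 : ℝ) < 1 / 2 by norm_num),
    h.tendsto.eventually_gt_atTop 0] with k hk hl ha hn
  have h1 : 0 < 1 - γ k := by linarith [hk.2]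
  have h0 := hk.1
  have hn' : (0 : ℝ) < n k := by exact_mod_cast hn
  rw [div_lt_iff₀ hl, Real.log_inv] at ha
  rw [← Real.le_log_iff_exp_le (by positivity), Real.log_mul (by positivity) (by positivity)]
  linarith

theorem tendsto_mul_atTop : Tendsto (fun k => n k * (γ k * (1 - γ k))) atTop atTop := by
  refine tendsto_atTop_mono' _ h.eventually_exp_le ?_
  exact Real.tendsto_exp_atTop.comp (h.tendsto_log.atTop_div_const (by norm_num))

theorem tendsto_log_div_mul :
    Tendsto (fun k => Real.log (n k) / (n k * (γ k * (1 - γ k)))) atTop (𝓝 0) := by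
  have h1 : Tendsto (fun k => 2 * ((Real.log (n k) / 2) ^ 1 * Real.exp (-(Real.log (n k) / 2))))
      atTop (𝓝 0) := by
    have := (Real.tendsto_pow_mul_exp_neg_atTop_nhds_zero 1).comp
      (h.tendsto_log.atTop_div_const (show (0 : ℝ) < 2 by norm_num))
    simpa using this.const_mul 2
  refine tendsto_of_tendsto_of_tendsto_of_le_of_le' tendsto_const_nhds h1 ?_ ?_
  · filter_upwards [h.tendsto_log.eventually_gt_atTop 0,
      h.tendsto_mul_atTop.eventually_gt_atTop 0] with k hl hg
    exact div_nonneg hl.le hg.le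
  · filter_upwards [h.tendsto_log.eventually_gt_atTop 0, h.eventually_exp_le] with k hl hg
    rw [Real.exp_neg]
    calc Real.log (n k) / (n k * (γ k * (1 - γ k))) ≤
        Real.log (n k) / Real.exp (Real.log (n k) / 2) := by gcongr
      _ = _ := by field_simp

/-- Relative to the main term, and by `natEntropy_ge`, the three summands are at most `4 / l`, `(1 +
7 b) / (1 - ρ / l)` and `2 b`, with `b = l / (n γ (1 - γ))`. Their sum tends to `1`. -/
theorem eventually_bound_le {ε : ℝ} (hε : 0 < ε) :
    ∀ᶠ k in atTop, 2 * (γ k * (1 - γ k)) * n k ^ 2 / Real.log (n k) ^ 2 +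
        n k ^ 2 / 2 * (natEntropy (γ k) + 7 / n k) / (Real.log (n k) -
          (4 * Real.log (γ k * (1 - γ k))⁻¹ + 4 * Real.log (Real.log (n k) + 3) + 11)) + n k ≤
      (1 + ε) * (natEntropy (γ k) * n k ^ 2 / (2 * Real.log (n k))) := by
  have hF : Tendsto (fun k => 4 / Real.log (n k) +
      (1 + 7 * (Real.log (n k) / (n k * (γ k * (1 - γ k))))) /
        (1 - (4 * Real.log (γ k * (1 - γ k))⁻¹ + 4 * Real.log (Real.log (n k) + 3) + 11) /
      Real.log (n k)) + 2 * (Real.log (n k) / (n k * (γ k * (1 - γ k))))) atTop (𝓝 1) := by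
    have h1 := ((h.tendsto_log.const_div_atTop 4).add
      (((h.tendsto_log_div_mul.const_mul 7).const_add 1).div (h.tendsto_loss.const_sub 1)
        (by norm_num))).add (h.tendsto_log_div_mul.const_mul 2)
    simpa using h1
  filter_upwards [hF.eventually_lt_const (show (1 : ℝ) < 1 + ε by linarith), h.mem_Ioo,
    h.tendsto_log.eventually_ge_atTop 1, h.tendsto_mul_atTop.eventually_gt_atTop 0,
    h.tendsto_loss.eventually_lt_const zero_lt_one, h.tendsto.eventually_gt_atTop 0]
    with k hk hγ hl hg hρ hn
  have hn' : (0 : ℝ) < n k := by exact_mod_cast hn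
  set l := Real.log (n k)
  set g := γ k * (1 - γ k) with hgd
  set ρ := 4 * Real.log g⁻¹ + 4 * Real.log (l + 3) + 11
  set H := natEntropy (γ k)
  have hl0 : 0 < l := by linarith
  have hgH : g ≤ H := natEntropy_ge hγ.1 hγ.2
  have hg0 : 0 < g := (mul_pos_iff_of_pos_left hn').1 hg
  have hH : 0 < H := hg0.trans_le hgH
  have hρl : ρ < l := by rwa [div_lt_one hl0] at hρ
  set b := l / (n k * g) with hb
  have hb1 : 1 ≤ b * (n k * H) := by
    rw [hb, div_mul_eq_mul_div, le_div_iff₀ hg, one_mul]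
    calc (n k : ℝ) * g ≤ n k * H := by gcongr
      _ = 1 * (n k * H) := by ring
      _ ≤ l * (n k * H) := by gcongr
  have hb2 : l ≤ b * (n k * H) := by
    rw [hb, div_mul_eq_mul_div, le_div_iff₀ hg]
    gcongr
  have t1 : 2 * g * n k ^ 2 / l ^ 2 ≤ 4 / l * (H * n k ^ 2 / (2 * l)) := by
    calc 2 * g * n k ^ 2 / l ^ 2 ≤ 2 * H * n k ^ 2 / l ^ 2 := by gcongr
      _ = _ := by field_simp; ring
  have t2 : (n k : ℝ) ^ 2 / 2 * (H + 7 / n k) / (l - ρ) ≤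
      (1 + 7 * b) / (1 - ρ / l) * (H * n k ^ 2 / (2 * l)) := by
    have h1 : (7 : ℝ) / n k ≤ 7 * b * H := by
      rw [div_le_iff₀ hn']
      linarith
    calc (n k : ℝ) ^ 2 / 2 * (H + 7 / n k) / (l - ρ) ≤
        (n k : ℝ) ^ 2 / 2 * (H + 7 * b * H) / (l - ρ) := by
          have : 0 < l - ρ := by linarith
          gcongr
      _ = _ := by
          have h2 : l - ρ ≠ 0 := by linarith
          have h3 : 1 - ρ / l = (l - ρ) / l := by field_simp
          rw [h3]
          field_simp
  have t3 : (n k : ℝ) ≤ 2 * b * (H * n k ^ 2 / (2 * l)) := by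
    rw [← mul_div_assoc, le_div_iff₀ (by positivity)]
    nlinarith
  calc _ ≤ 4 / l * (H * n k ^ 2 / (2 * l)) + (1 + 7 * b) / (1 - ρ / l) * (H * n k ^ 2 / (2 * l)) +
        2 * b * (H * n k ^ 2 / (2 * l)) := add_le_add (add_le_add t1 t2) t3
    _ = (4 / l + (1 + 7 * b) / (1 - ρ / l) + 2 * b) * (H * n k ^ 2 / (2 * l)) := by ring
    _ ≤ _ := by gcongr

theorem eventually_output {ε : ℝ} (hε : 0 < ε) :
    ∀ᶠ k in atTop, ∀ G : SimpleGraph (Fin (n k)), HasDensity G (γ k) →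
      ∀ adj : Fin (n k) → List (Fin (n k)), IsAdjacencyList G adj →
      ∀ w : ℕ, n k ^ 21 ≤ 2 ^ w →
        ∃ (o : List ℕ) (P : List (Finset (Fin (n k)) × Finset (Fin (n k)))),
          WordRAM.HaltsWithin w WordRAM.bicliqueCmd (adjacencyInput adj)
            (616 * G.edgeSet.ncard) o ∧
          IsBicliqueOutput o P ∧ IsBicliquePartition G P ∧
          (bicliqueWeight P : ℝ) ≤
            (1 + ε) * (natEntropy (γ k) * n k ^ 2 / (2 * Real.log (n k))) := by
  -- With `min ε 1` the weight is at most twice the main term, so the time constant does not depend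
  -- on `ε`.
  filter_upwards [h.eventually_bound_le (lt_min hε one_pos), h.mem_Ioo,
    h.tendsto_log.eventually_ge_atTop 2, h.tendsto_mul_atTop.eventually_ge_atTop 4,
    h.tendsto_loss.eventually_lt_const zero_lt_one, h.tendsto.eventually_ge_atTop 4,
    h.tendsto_log_inv_div.eventually_lt_const (show (0 : ℝ) < 1 / 2 by norm_num)]
    with k hk hγ hl hg hρ hn ha G hG adj hadj w hw
  have hn' : (4 : ℝ) ≤ n k := by exact_mod_cast hn
  have hl0 : 0 < Real.log (n k) := by linarith
  have h1 : 0 < 1 - γ k := by linarith [hγ.2]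
  have h0 := hγ.1
  set m := G.edgeSet.ncard with hm
  have hmγ : (m : ℝ) = γ k * (n k).choose 2 := hG
  have hγn : 4 ≤ γ k * n k := by nlinarith [mul_pos h0 (show (0 : ℝ) < n k by linarith)]
  have hγn' : 4 ≤ (1 - γ k) * n k := by nlinarith [mul_pos h1 (show (0 : ℝ) < n k by linarith)]
  have hP : Params (n k) (γ k) m (2 * m / (n k - 1)) (n k - 2 * m / (n k - 1)) :=
    ⟨hn, h0, hγ.2, by linarith, by linarith, hmγ, rfl, rfl⟩
  have hw' : n k ^ 20 < 2 ^ w :=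
    lt_of_lt_of_le (Nat.pow_lt_pow_right (by omega) (by norm_num)) hw
  obtain ⟨o, P, ho, h2, h3, h4⟩ := hP.exists_output hadj rfl hw' rfl
    (by rwa [div_lt_one hl0] at hρ)
  have h5 := h4.trans hk
  have hH : 0 < natEntropy (γ k) := lt_of_lt_of_le (by positivity) (natEntropy_ge h0 hγ.2)
  refine ⟨o, P, ?_, h2, h3, h5.trans ?_⟩
  · have hmn : γ k * n k * (n k - 1) = 2 * m := by
      rw [hmγ, Nat.cast_choose_two]
      ring
    have hnm : (n k : ℝ) ≤ m := by nlinarith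
    have hW : (bicliqueWeight P : ℝ) ≤ 4 * m := by
      have hB : natEntropy (γ k) * n k ^ 2 / (2 * Real.log (n k)) ≤ γ k * n k ^ 2 / 2 := by
        rw [div_lt_iff₀ hl0, mul_inv, Real.log_mul (by positivity) (by positivity)] at ha
        have h6 : 0 ≤ Real.log (1 - γ k)⁻¹ := Real.log_nonneg (by
          rw [one_le_inv₀ h1]; linarith)
        -- Here `log γ⁻¹ + 1 ≤ (log n) / 2 + 1 ≤ log n`, the last because `log n ≥ 2`.
        have h7 : natEntropy (γ k) ≤ γ k * Real.log (n k) :=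
          (natEntropy_le hγ.2).trans (by gcongr; linarith)
        calc natEntropy (γ k) * n k ^ 2 / (2 * Real.log (n k)) ≤
            γ k * Real.log (n k) * n k ^ 2 / (2 * Real.log (n k)) := by gcongr
          _ = _ := by field_simp
      have h8 : (1 + min ε 1) ≤ 2 := by linarith [min_le_right ε 1]
      calc (bicliqueWeight P : ℝ) ≤ 2 * (γ k * n k ^ 2 / 2) := h5.trans (by gcongr)
        _ ≤ 4 * m := by nlinarith
    -- With `n ≤ m` and weight at most `4 m`, the constant is `200 * 3 + 4 * 4 = 616`.
    have htime : 200 * (n k + 2 * m) + 4 * bicliqueWeight P ≤ 616 * m := by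
      have h9 : n k ≤ m := by exact_mod_cast hnm
      have h10 : bicliqueWeight P ≤ 4 * m := by exact_mod_cast hW
      omega
    exact ho.mono htime
  · gcongr
    exact min_le_left _ _

end IsAdmissible

/-! ### Counting graphs, and encoding biclique partitions by words. -/

section Counting

open Finset

/-- The binomial distribution with parameters `a + b` and `a / (a + b)` has its mode at `a`. -/
theorem choose_mul_pow_le (a b : ℕ) {j : ℕ} (hj : j ≤ a + b) :
    (a + b).choose j * (a ^ j * b ^ (a + b - j)) ≤ (a + b).choose a * (a ^ a * b ^ b) := by
  have step : ∀ j, (a + b).choose (j + 1) * (j + 1) = (a + b).choose j * (a + b - j) :=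
    fun j => Nat.choose_succ_right_eq _ j
  have hpow : ∀ j, j < a + b → b ^ (a + b - j) = b ^ (a + b - (j + 1)) * b := fun j hj => by
    rw [← pow_succ]; congr 1; omega
  -- The ratio of consecutive terms is `(a + b - j) a / ((j + 1) b)`; for `j < a` one has `a + b - j
  -- ≥ b` and `a ≥ j + 1`. Both inequalities reverse for `j ≥ a`.
  have up : ∀ j, j < a → (a + b).choose j * (a ^ j * b ^ (a + b - j)) ≤
      (a + b).choose (j + 1) * (a ^ (j + 1) * b ^ (a + b - (j + 1))) := by
    intro j hja
    have h1 : (a + b).choose j * b ≤ (a + b).choose (j + 1) * a := by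
      refine Nat.le_of_mul_le_mul_right (c := j + 1) ?_ (Nat.succ_pos j)
      calc (a + b).choose j * b * (j + 1) ≤ (a + b).choose j * (a + b - j) * a := by
            rw [mul_assoc, mul_assoc]
            exact Nat.mul_le_mul_left _ (Nat.mul_le_mul (by omega) (by omega))
        _ = _ := by rw [← step]; ring
    rw [hpow j (by omega)]
    calc _ = (a + b).choose j * b * (a ^ j * b ^ (a + b - (j + 1))) := by ring
      _ ≤ (a + b).choose (j + 1) * a * (a ^ j * b ^ (a + b - (j + 1))) :=
          Nat.mul_le_mul_right _ h1
      _ = _ := by ring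
  have down : ∀ j, a ≤ j → j < a + b →
      (a + b).choose (j + 1) * (a ^ (j + 1) * b ^ (a + b - (j + 1))) ≤
        (a + b).choose j * (a ^ j * b ^ (a + b - j)) := by
    intro j haj hj
    have h1 : (a + b).choose (j + 1) * a ≤ (a + b).choose j * b := by
      refine Nat.le_of_mul_le_mul_right (c := j + 1) ?_ (Nat.succ_pos j)
      calc (a + b).choose (j + 1) * a * (j + 1) = (a + b).choose j * (a + b - j) * a := by
            rw [← step]; ring
        _ ≤ (a + b).choose j * b * (j + 1) := by
            rw [mul_assoc, mul_assoc]
            exact Nat.mul_le_mul_left _ (Nat.mul_le_mul (by omega) (by omega))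
    rw [hpow j hj]
    calc _ = (a + b).choose (j + 1) * a * (a ^ j * b ^ (a + b - (j + 1))) := by ring
      _ ≤ (a + b).choose j * b * (a ^ j * b ^ (a + b - (j + 1))) := Nat.mul_le_mul_right _ h1
      _ = _ := by ring
  have base : (a + b).choose a * (a ^ a * b ^ b) =
      (a + b).choose a * (a ^ a * b ^ (a + b - a)) := by rw [Nat.add_sub_cancel_left]
  rw [base]
  rcases le_total j a with hja | hja
  · exact Nat.decreasingInduction' (P := fun j => (a + b).choose j * (a ^ j * b ^ (a + b - j)) ≤
      (a + b).choose a * (a ^ a * b ^ (a + b - a))) (fun k hk _ ih => (up k hk).trans ih) hja le_rfl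
  · induction j, hja using Nat.le_induction with
    | base => exact le_rfl
    | succ k hk ih => exact (down k hk (by omega)).trans (ih (by omega))

/-- The binomial expansion has `a + b + 1` terms, each at most the one at the mode. -/
theorem pow_le_mul_choose (a b : ℕ) :
    (a + b) ^ (a + b) ≤ (a + b + 1) * ((a + b).choose a * (a ^ a * b ^ b)) := by
  rw [add_pow]
  calc ∑ j ∈ range (a + b + 1), a ^ j * b ^ (a + b - j) * (a + b).choose j ≤
      ∑ j ∈ range (a + b + 1), (a + b).choose a * (a ^ a * b ^ b) := by
        refine sum_le_sum fun j hj => ?_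
        rw [mul_comm]
        exact choose_mul_pow_le a b (Nat.lt_succ_iff.1 (mem_range.1 hj))
    _ = _ := by simp

/-- Take logarithms in `pow_le_mul_choose` with `a = m` and `b = N - m`; then `log m = log γ + log
N` and its analogue for `b` produce the entropy. -/
theorem entropy_le_log_choose {N m : ℕ} {γ : ℝ} (h0 : 0 < γ) (h1 : γ < 1) (hm : (m : ℝ) = γ * N)
    (hN : 0 < N) : N * natEntropy γ - Real.log (N + 1) ≤ Real.log (N.choose m) := by
  have hN' : (0 : ℝ) < N := by exact_mod_cast hN
  have hmN : m ≤ N := by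
    have : (m : ℝ) ≤ N := by rw [hm]; nlinarith
    exact_mod_cast this
  obtain ⟨b, rfl⟩ := Nat.exists_eq_add_of_le hmN
  have h1' : 0 < 1 - γ := by linarith
  have hb : (b : ℝ) = (1 - γ) * (m + b : ℕ) := by push_cast at hm ⊢; linarith
  have hm0 : (0 : ℝ) < m := by rw [hm]; positivity
  have hb0 : (0 : ℝ) < b := by rw [hb]; positivity
  have hc : (0 : ℝ) < (m + b).choose m := by exact_mod_cast Nat.choose_pos hmN
  have h : (((m + b : ℕ) : ℝ)) ^ (m + b) ≤
      ((m + b : ℕ) + 1) * ((m + b).choose m * ((m : ℝ) ^ m * (b : ℝ) ^ b)) := by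
    exact_mod_cast pow_le_mul_choose m b
  have h2 := Real.log_le_log (by positivity) h
  rw [Real.log_mul (by positivity) (by positivity), Real.log_mul (by positivity) (by positivity),
    Real.log_mul (by positivity) (by positivity), Real.log_pow, Real.log_pow, Real.log_pow] at h2
  have h3 : Real.log m = Real.log γ + Real.log (m + b : ℕ) := by
    rw [← Real.log_mul h0.ne' hN'.ne', ← hm]
  have h4 : Real.log b = Real.log (1 - γ) + Real.log (m + b : ℕ) := by
    rw [← Real.log_mul h1'.ne' hN'.ne', ← hb]
  rw [h3, h4] at h2
  unfold natEntropy
  have h5 : (m : ℝ) * Real.log γ + b * Real.log (1 - γ) =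
      (m + b : ℕ) * (γ * Real.log γ + (1 - γ) * Real.log (1 - γ)) := by
    rw [hm, hb]; push_cast; ring
  have h6 : ((m + b : ℕ) : ℝ) = m + b := by push_cast; ring
  rw [h6] at h2 h5 ⊢
  nlinarith

theorem card_graphs_ge {n m : ℕ} : (n.choose 2).choose m ≤
    {G : SimpleGraph (Fin n) | G.edgeSet.ncard = m}.ncard := by
  classical
  have h1 : (n.choose 2).choose m =
      ((⊤ : SimpleGraph (Fin n)).edgeFinset.powersetCard m).card := by
    rw [card_powersetCard, SimpleGraph.card_edgeFinset_top_eq_card_choose_two, Fintype.card_fin]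
  rw [h1, ← Set.ncard_coe_finset]
  have hE : ∀ s ∈ (⊤ : SimpleGraph (Fin n)).edgeFinset.powersetCard m,
      (SimpleGraph.fromEdgeSet (s : Set (Sym2 (Fin n)))).edgeSet = s := by
    intro s hs
    rw [SimpleGraph.edgeSet_fromEdgeSet, sdiff_eq_left, Set.disjoint_left]
    intro e he
    have := (mem_powersetCard.1 hs).1 he
    simpa using this
  refine Set.ncard_le_ncard_of_injOn
    (fun s : Finset (Sym2 (Fin n)) => SimpleGraph.fromEdgeSet (s : Set (Sym2 (Fin n)))) ?_ ?_
    (Set.toFinite _)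
  · intro s hs
    simp only [Set.mem_ofPred_eq]
    rw [hE s hs, Set.ncard_coe_finset]
    exact (mem_powersetCard.1 hs).2
  · intro s hs t ht hst
    have := congrArg SimpleGraph.edgeSet hst
    simp only [hE s hs, hE t ht] at this
    exact_mod_cast this

variable {V : Type*} [DecidableEq V]

/-- Add a vertex to one of the two sides. -/
def addVertex (x : V) (b : Bool) (B : Finset V × Finset V) : Finset V × Finset V :=
  if b then (insert x B.1, B.2) else (B.1, insert x B.2)

/-- Decode a word to a list of pairs of vertex sets: every letter adds a vertex to one of the sides
of the first pair, and a flag may begin a new pair. -/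
def decodePairs : List (V × Bool × Bool) → (Finset V × Finset V) × List (Finset V × Finset V)
  | [] => ((∅, ∅), [])
  | (x, b, f) :: l =>
      if f then ((∅, ∅), addVertex x b (decodePairs l).1 :: (decodePairs l).2)
      else (addVertex x b (decodePairs l).1, (decodePairs l).2)

theorem exists_decodePairs_prefix (w : List (V × Bool × Bool)) {Q : List (Finset V × Finset V)}
    (hw : decodePairs w = ((∅, ∅), Q)) (A C : Finset V) :
    ∃ w', w'.length = w.length + (A.card + C.card) ∧ decodePairs w' = ((A, C), Q) := by
  induction A using Finset.induction_on with
  | empty =>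
    induction C using Finset.induction_on with
    | empty => exact ⟨w, by simp, hw⟩
    | insert x C hx ih =>
      obtain ⟨w', h1, h2⟩ := ih
      refine ⟨(x, false, false) :: w', ?_, ?_⟩
      · rw [card_insert_of_notMem hx, List.length_cons, h1]; omega
      · simp [decodePairs, h2, addVertex]
  | insert x A hx ih =>
    obtain ⟨w', h1, h2⟩ := ih
    refine ⟨(x, true, false) :: w', ?_, ?_⟩
    · rw [card_insert_of_notMem hx, List.length_cons, h1]; omega
    · simp [decodePairs, h2, addVertex]

/-- A vertex of the first side carries the flag that separates pairs, so nonemptiness is needed and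
no extra letter is spent: the length equals the weight exactly. -/
theorem exists_decodePairs (P : List (Finset V × Finset V)) (hP : ∀ B ∈ P, B.1.Nonempty) :
    ∃ w : List (V × Bool × Bool), w.length = bicliqueWeight P ∧
      decodePairs w = ((∅, ∅), P) := by
  induction P with
  | nil => exact ⟨[], rfl, rfl⟩
  | cons B P ih =>
    obtain ⟨w, h1, h2⟩ := ih fun B' hB' => hP B' (List.mem_cons_of_mem _ hB')
    obtain ⟨x, hx⟩ := hP B List.mem_cons_self
    obtain ⟨w', h3, h4⟩ := exists_decodePairs_prefix w h2 (B.1.erase x) B.2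
    refine ⟨(x, true, true) :: w', ?_, ?_⟩
    · have := card_erase_add_one hx
      rw [List.length_cons, h3, h1]
      simp only [bicliqueWeight, List.map_cons, List.sum_cons]
      omega
    · simp [decodePairs, h4, addVertex, insert_erase hx]

end Counting

/-- The edges of the graph are precisely the pairs covered by `P`. -/
theorem graph_eq_of_partition {V : Type*} {G G' : SimpleGraph V} {P : List (Finset V × Finset V)}
    (h : IsBicliquePartition G P) (h' : IsBicliquePartition G' P) : G = G' := by
  have key : ∀ G G' : SimpleGraph V, IsBicliquePartition G P → IsBicliquePartition G' P →
      ∀ u v, G.Adj u v → G'.Adj u v := by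
    intro G G' h h' u v huv
    obtain ⟨i, hi, -⟩ := h.2 u v huv
    have hB := (h'.1 _ (List.get_mem P i)).2.2.2
    rcases hi with ⟨h1, h2⟩ | ⟨h1, h2⟩
    · exact hB u h1 v h2
    · exact (hB v h1 u h2).symm
  ext u v
  exact ⟨key G G' h h' u v, key G' G h' h u v⟩

/-- There are few graphs with biclique partitions of small weight. -/
theorem card_graphs_le {n W : ℕ} (S : Set (SimpleGraph (Fin n))) (hn : 1 ≤ n)
    (hS : ∀ G ∈ S, ∃ P, IsBicliquePartition G P ∧ bicliqueWeight P ≤ W) :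
    S.ncard ≤ (4 * n) ^ (W + 1) := by
  classical
  choose! P hP hW using hS
  have hword : ∀ G ∈ S, ∃ w : List (Fin n × Bool × Bool), w.length = bicliqueWeight (P G) ∧
      decodePairs w = ((∅, ∅), P G) := fun G hG =>
    exists_decodePairs (P G) fun B hB => ((hP G hG).1 B hB).1
  choose! w hw hdec using hword
  let F : ∀ k : ℕ, (Fin k → Fin n × Bool × Bool) → List (Fin n × Bool × Bool) := fun _ f =>
    List.ofFn f
  let T : Finset (List (Fin n × Bool × Bool)) :=
    (Finset.range (W + 1)).biUnion fun k => Finset.univ.image (F k)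
  have hT : T.card ≤ (4 * n) ^ (W + 1) := by
    calc T.card ≤ ∑ k ∈ Finset.range (W + 1), (Finset.univ.image (F k)).card :=
          Finset.card_biUnion_le
      _ ≤ ∑ k ∈ Finset.range (W + 1), (4 * n) ^ k := by
          refine Finset.sum_le_sum fun k _ => Finset.card_image_le.trans (le_of_eq ?_)
          simp only [Finset.card_univ, Fintype.card_fun, Fintype.card_prod, Fintype.card_fin,
            Fintype.card_bool]
          ring
      -- Geometric series over the word lengths `0, …, W`, with ratio `4 n ≥ 2`.
      _ ≤ (4 * n) ^ (W + 1) := (Nat.geomSum_lt (by omega) (by simp)).le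
  refine le_trans ?_ hT
  rw [← Set.ncard_coe_finset]
  refine Set.ncard_le_ncard_of_injOn w ?_ ?_ (Finset.finite_toSet T)
  · intro G hG
    simp only [T, Finset.coe_biUnion, Set.mem_iUnion, Finset.coe_range, Set.mem_Iio]
    refine ⟨(w G).length, ?_, ?_⟩
    · rw [hw G hG]; exact Nat.lt_succ_of_le (hW G hG)
    · simp only [Finset.coe_image, Finset.coe_univ, Set.image_univ, Set.mem_range]
      exact ⟨(w G).get, List.ofFn_get _⟩
  · intro G hG G' hG' hww
    have h1 := hdec G hG
    rw [hww, hdec G' hG'] at h1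
    have h2 : P G' = P G := (Prod.ext_iff.1 h1).2
    have h3 := hP G' hG'
    rw [h2] at h3
    exact graph_eq_of_partition (hP G hG) h3

/-! ### Minimum and maximum weights, and the finite lower bound. -/

theorem binaryEntropy_mul_eq (x : ℝ) (n : ℕ) :
    binaryEntropy x / 2 * ((n : ℝ) ^ 2 / Real.logb 2 n) =
      natEntropy x * n ^ 2 / (2 * Real.log n) := by
  unfold binaryEntropy natEntropy Real.logb
  have h : Real.log 2 ≠ 0 := (Real.log_pos one_lt_two).ne'
  rcases eq_or_ne (Real.log n) 0 with h0 | h0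
  · simp [h0]
  · field_simp

theorem exists_isAdjacencyList {n : ℕ} (G : SimpleGraph (Fin n)) :
    ∃ adj : Fin n → List (Fin n), IsAdjacencyList G adj := by
  classical
  exact ⟨fun v => (G.neighborFinset v).toList, fun v => ⟨Finset.nodup_toList _, by simp⟩⟩

/-- A partition must be supplied, as the infimum of the empty set of naturals is `0` and would not
be attained. -/
theorem exists_minBicliqueWeight_eq {V : Type*} {G : SimpleGraph V}
    {P : List (Finset V × Finset V)} (hP : IsBicliquePartition G P) :
    ∃ Q, IsBicliquePartition G Q ∧ bicliqueWeight Q = minBicliqueWeight G :=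
  Nat.sInf_mem (s := {W | ∃ Q, IsBicliquePartition G Q ∧ bicliqueWeight Q = W}) ⟨_, P, hP, rfl⟩

theorem minBicliqueWeight_le {V : Type*} {G : SimpleGraph V}
    {P : List (Finset V × Finset V)} (hP : IsBicliquePartition G P) :
    minBicliqueWeight G ≤ bicliqueWeight P :=
  Nat.sInf_le ⟨P, hP, rfl⟩

/-- There are finitely many graphs on `n` vertices, so the supremum is over a bounded set and has
its usual meaning. -/
theorem minBicliqueWeight_le_max {n : ℕ} {γ : ℝ} {G : SimpleGraph (Fin n)}
    (hG : HasDensity G γ) : minBicliqueWeight G ≤ maxMinBicliqueWeight n γ := by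
  refine le_csSup (Set.Finite.bddAbove ?_) ⟨G, hG, rfl⟩
  exact (Set.finite_range fun G : SimpleGraph (Fin n) => minBicliqueWeight G).subset
    (by rintro _ ⟨G, -, rfl⟩; exact ⟨G, rfl⟩)

theorem exists_hasDensity {n m : ℕ} {γ : ℝ} (h1 : γ ≤ 1) (hm : γ * n.choose 2 = m) :
    ∃ G : SimpleGraph (Fin n), HasDensity G γ := by
  have hmN : m ≤ n.choose 2 := by
    have : (m : ℝ) ≤ n.choose 2 := by
      rw [← hm]
      exact mul_le_of_le_one_left (Nat.cast_nonneg _) h1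
    exact_mod_cast this
  obtain ⟨G, hG⟩ := Set.nonempty_of_ncard_ne_zero
    ((Nat.choose_pos hmN).trans_le (card_graphs_ge (n := n) (m := m))).ne'
  exact ⟨G, by rw [HasDensity, hm, show G.edgeSet.ncard = m from hG]⟩

theorem maxMinBicliqueWeight_le {n m : ℕ} {γ b : ℝ} (h1 : γ ≤ 1) (hm : γ * n.choose 2 = m)
    (hb : ∀ G : SimpleGraph (Fin n), HasDensity G γ → (minBicliqueWeight G : ℝ) ≤ b) :
    (maxMinBicliqueWeight n γ : ℝ) ≤ b := by
  obtain ⟨G₀, hG₀⟩ := exists_hasDensity h1 hm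
  have hfin : {W : ℕ | ∃ G : SimpleGraph (Fin n), HasDensity G γ ∧ minBicliqueWeight G = W}.Finite :=
    (Set.finite_range fun G : SimpleGraph (Fin n) => minBicliqueWeight G).subset
      (by rintro _ ⟨G, -, rfl⟩; exact ⟨G, rfl⟩)
  have hne : {W : ℕ | ∃ G : SimpleGraph (Fin n), HasDensity G γ ∧
      minBicliqueWeight G = W}.Nonempty := ⟨_, G₀, hG₀, rfl⟩
  obtain ⟨G, hG, hW⟩ := Nat.sSup_mem hne hfin.bddAbove
  rw [maxMinBicliqueWeight, ← hW]
  exact hb G hG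

/-- With `W` the maximum, every graph with `m` edges has a partition of weight at most `W`. So the
binomial coefficient is at most the number of code words; take logarithms. -/
theorem entropy_le_maxMinBicliqueWeight {n m : ℕ} {γ : ℝ} (hn : 2 ≤ n) (h0 : 0 < γ) (h1 : γ < 1)
    (hm : γ * n.choose 2 = m)
    (hP : ∀ G : SimpleGraph (Fin n), HasDensity G γ → ∃ P, IsBicliquePartition G P) :
    n.choose 2 * natEntropy γ - Real.log (n.choose 2 + 1) ≤
      (maxMinBicliqueWeight n γ + 1) * Real.log (4 * n) := by
  refine (entropy_le_log_choose h0 h1 hm.symm (Nat.choose_pos hn)).trans ?_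
  have hdens : ∀ G : SimpleGraph (Fin n), G.edgeSet.ncard = m → HasDensity G γ := fun G hG => by
    rw [HasDensity, hm, hG]
  have hcard := card_graphs_ge.trans (card_graphs_le (W := maxMinBicliqueWeight n γ)
    {G : SimpleGraph (Fin n) | G.edgeSet.ncard = m} (by omega) fun G hG => by
      obtain ⟨P, h⟩ := hP G (hdens G hG)
      obtain ⟨Q, hQ, hW⟩ := exists_minBicliqueWeight_eq h
      exact ⟨Q, hQ, hW.trans_le (minBicliqueWeight_le_max (hdens G hG))⟩)
  have hmN : m ≤ n.choose 2 := by
    have : (m : ℝ) ≤ n.choose 2 := by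
      rw [← hm]
      exact mul_le_of_le_one_left (Nat.cast_nonneg _) h1.le
    exact_mod_cast this
  have hpos : (0 : ℝ) < (n.choose 2).choose m := by exact_mod_cast Nat.choose_pos hmN
  have hcast : ((n.choose 2).choose m : ℝ) ≤ (4 * n) ^ (maxMinBicliqueWeight n γ + 1) := by
    exact_mod_cast hcard
  calc Real.log ((n.choose 2).choose m) ≤ Real.log ((4 * n) ^ (maxMinBicliqueWeight n γ + 1)) :=
        Real.log_le_log hpos hcast
    _ = _ := by rw [Real.log_pow]; push_cast; rfl

/-! ### Asymptotics of the lower bound, and the conclusion. -/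

namespace IsAdmissible

variable {n : ℕ → ℕ} {γ : ℕ → ℝ} (h : IsAdmissible n γ)

include h

theorem eventually_exists_partition {ε : ℝ} (hε : 0 < ε) :
    ∀ᶠ k in atTop, ∀ G : SimpleGraph (Fin (n k)), HasDensity G (γ k) →
      ∃ P, IsBicliquePartition G P ∧ (bicliqueWeight P : ℝ) ≤
        (1 + ε) * (natEntropy (γ k) * n k ^ 2 / (2 * Real.log (n k))) := by
  filter_upwards [h.eventually_output hε] with k hk G hG
  obtain ⟨adj, hadj⟩ := exists_isAdjacencyList G
  -- Only existence of the partition matters, so any admissible word length will do.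
  obtain ⟨-, P, -, -, hP, hW⟩ := hk G hG adj hadj (n k ^ 21) Nat.lt_two_pow_self.le
  exact ⟨P, hP, hW⟩

theorem eventually_maxMin_le {ε : ℝ} (hε : 0 < ε) :
    ∀ᶠ k in atTop, (maxMinBicliqueWeight (n k) (γ k) : ℝ) ≤
      (1 + ε) * (natEntropy (γ k) * n k ^ 2 / (2 * Real.log (n k))) := by
  filter_upwards [h.eventually_exists_partition hε, h.mem_Ioo, h.integral] with k hk hγ ⟨m, hm⟩
  refine maxMinBicliqueWeight_le hγ.2.le hm fun G hG => ?_
  obtain ⟨P, hP, hW⟩ := hk G hG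
  exact (Nat.cast_le.2 (minBicliqueWeight_le hP)).trans hW

theorem eventually_le_maxMin {ε : ℝ} (hε : 0 < ε) :
    ∀ᶠ k in atTop, (1 - ε) * (natEntropy (γ k) * n k ^ 2 / (2 * Real.log (n k))) ≤
      (maxMinBicliqueWeight (n k) (γ k) : ℝ) := by
  have hlim : Tendsto (fun k => (1 - (Real.log (n k))⁻¹ -
      8 * (Real.log (n k) / (n k * (γ k * (1 - γ k))))) / (1 + 2 * (Real.log (n k))⁻¹))
      atTop (𝓝 1) := by
    have hl := h.tendsto_log.inv_tendsto_atTop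
    have := ((hl.const_sub 1).sub (h.tendsto_log_div_mul.const_mul 8)).div
      ((hl.const_mul 2).const_add 1) (by norm_num)
    simp only [sub_zero, mul_zero, add_zero, div_one] at this
    exact this
  filter_upwards [h.eventually_exists_partition hε, h.mem_Ioo, h.integral,
    h.tendsto.eventually_ge_atTop 2, h.tendsto_log.eventually_ge_atTop 2,
    hlim.eventually_const_le (show 1 - ε < 1 by linarith)] with k hk hγ ⟨m, hm⟩ hn hl hε'
  have hlow := entropy_le_maxMinBicliqueWeight hn hγ.1 hγ.2 hm
    fun G hG => (hk G hG).imp fun _ => And.left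
  have hg : 0 < γ k * (1 - γ k) := mul_pos hγ.1 (sub_pos.2 hγ.2)
  have hgH := natEntropy_ge hγ.1 hγ.2
  have hn' : (2 : ℝ) ≤ n k := by exact_mod_cast hn
  have hln : Real.log (n k) ≤ n k := Real.log_le_self (by linarith)
  have hlog4 : Real.log (4 * n k) ≤ Real.log (n k) + 2 := by
    rw [Real.log_mul (by norm_num) (by linarith)]
    have : Real.log 4 = 2 * Real.log 2 := by
      rw [show (4 : ℝ) = 2 ^ 2 by norm_num, Real.log_pow]; norm_num
    linarith [Real.log_two_lt_d9]
  have hlogN : Real.log ((n k).choose 2 + 1) ≤ 2 * Real.log (n k) := by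
    rw [show 2 * Real.log (n k) = Real.log ((n k : ℝ) ^ 2) by rw [Real.log_pow]; norm_num]
    refine Real.log_le_log (by positivity) ?_
    rw [Nat.cast_choose_two]
    nlinarith
  rw [Nat.cast_choose_two] at hlow hlogN
  set l := Real.log (n k)
  set H := natEntropy (γ k)
  set g := γ k * (1 - γ k)
  set W : ℝ := (maxMinBicliqueWeight (n k) (γ k) : ℝ)
  have hW : 0 ≤ W := Nat.cast_nonneg _
  have hl0 : 0 < l := by linarith
  have hH : 0 < H := hg.trans_le hgH
  -- The term `4 l` collects `log (N + 1) ≤ 2 l` and the summand `l + 2 ≤ 2 l` caused by the `+ 1`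
  -- next to `W`.
  have h1 : (n k : ℝ) ^ 2 * H / 2 - n k * H / 2 - 4 * l ≤ W * (l + 2) := by
    have : (W + 1) * Real.log (4 * n k) ≤ (W + 1) * (l + 2) := by gcongr
    linarith
  have h2 : n k * H / 2 ≤ (n k : ℝ) ^ 2 * H / 2 * l⁻¹ := by
    rw [← div_eq_mul_inv, le_div_iff₀ hl0]
    nlinarith [mul_pos (show (0 : ℝ) < n k by linarith) hH]
  have h3 : 4 * l ≤ (n k : ℝ) ^ 2 * H / 2 * (8 * (l / (n k * g))) := by
    have : (n k : ℝ) ^ 2 * H / 2 * (8 * (l / (n k * g))) = 4 * l * (n k * (H / g)) := by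
      field_simp; ring
    rw [this]
    have h4 : 1 ≤ H / g := (one_le_div hg).2 hgH
    exact le_mul_of_one_le_right (by positivity) (by nlinarith)
  calc (1 - ε) * (H * n k ^ 2 / (2 * l)) ≤
      (1 - l⁻¹ - 8 * (l / (n k * g))) / (1 + 2 * l⁻¹) * (H * n k ^ 2 / (2 * l)) := by gcongr
    _ = (n k : ℝ) ^ 2 * H / 2 * (1 - l⁻¹ - 8 * (l / (n k * g))) / (l + 2) := by
      generalize 8 * (l / (n k * g)) = b
      field_simp
    _ ≤ W := by
      rw [div_le_iff₀ (by linarith)]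
      linarith

theorem isEquivalent_maxMin :
    (fun k => (maxMinBicliqueWeight (n k) (γ k) : ℝ)) ~[atTop]
      fun k => natEntropy (γ k) * n k ^ 2 / (2 * Real.log (n k)) := by
  refine isLittleO_iff.2 fun ε hε => ?_
  filter_upwards [h.eventually_maxMin_le hε, h.eventually_le_maxMin hε] with k h1 h2
  rw [Pi.sub_apply, Real.norm_eq_abs, Real.norm_eq_abs]
  refine (abs_le.2 ⟨?_, ?_⟩).trans (mul_le_mul_of_nonneg_left (le_abs_self _) hε.le) <;> linarith

end IsAdmissible

theorem mainTheorem3 :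
    (∀ (n : ℕ → ℕ) (γ : ℕ → ℝ), IsAdmissible n γ →
      (fun k => (maxMinBicliqueWeight (n k) (γ k) : ℝ)) ~[atTop]
        fun k => binaryEntropy (γ k) / 2 * ((n k : ℝ) ^ 2 / Real.logb 2 (n k))) ∧
    (∃ (p : WordRAM.Cmd) (c C : ℕ), ∀ (n : ℕ → ℕ) (γ : ℕ → ℝ), IsAdmissible n γ →
      ∀ ε : ℝ, 0 < ε → ∀ᶠ k in atTop,
        ∀ G : SimpleGraph (Fin (n k)), HasDensity G (γ k) →
        ∀ adj : Fin (n k) → List (Fin (n k)), IsAdjacencyList G adj →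
        ∀ w : ℕ, n k ^ c ≤ 2 ^ w →
          ∃ (o : List ℕ) (P : List (Finset (Fin (n k)) × Finset (Fin (n k)))),
            WordRAM.HaltsWithin w p (adjacencyInput adj) (C * G.edgeSet.ncard) o ∧
            IsBicliqueOutput o P ∧ IsBicliquePartition G P ∧
            (bicliqueWeight P : ℝ) ≤
              (1 + ε) * (binaryEntropy (γ k) / 2 * ((n k : ℝ) ^ 2 / Real.logb 2 (n k)))) := by
  simp only [binaryEntropy_mul_eq]
  exact ⟨fun n γ h => h.isEquivalent_maxMin, WordRAM.bicliqueCmd, 21, 616,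
    fun n γ h ε hε => h.eventually_output hε⟩
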